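/- For nonnegative integers $d_1,d_2,d_3$ with $n=d_1+2d_2+3d_3$ even, let $\mathrm{CM}(d_1,d_2,d_3)$ be the configuration model with $d_i$ vertices of degree $i$ ($i=1,2,3$): the $n$ half-edges attached to the vertices are paired uniformly at random. Explore it as follows. At time $0$ all half-edges are unmatched; the unmatched degree of a vertex is the number of unmatched half-edges attached to it. At each step, as long as there is a vertex of unmatched degree $1$, pick one of these, $\ell$, uniformly at random, reveal its neighbour $v$, and erase all the edges incident to $v$ (with their half-edges). When there is no vertex of unmatched degree $1$ left, the state no longer changes. Let $X^n_k,Y^n_k,Z^n_k$ be the numbers of unmatched half-edges attached to vertices of unmatched degree $1,2,3$ after $k$ steps, and let $\theta^n=\inf\{k\ge 0: X^n_k=0\}$. Let $\mathbf d^n=(d^n_1,d^n_2,d^n_3)$ be degree sequences with $d_1^n+2d_2^n+3d_3^n=n$, where $n\to\infty$ along even integers, and suppose that $$\frac{d^n_1}{n}\to p_1,\qquad \frac{2d^n_2}{n}\to p_2,\qquad \frac{3d^n_3}{n}\to p_3,\qquad\text{with } p_1>0 \text{ or } p_3>0 .$$ For $(\mathscr X,\mathscr Y,\mathscr Z)\in\mathbb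 R^3$ with $\mathscr S=\mathscr X+\mathscr Y+\mathscr Z\neq 0$, write $(\mathbf x,\mathbf y,\mathbf z)=\mathscr S^{-1}(\mathscr X,\mathscr Y,\mathscr Z)$ and $$\phi\begin{pmatrix}\mathscr X\\ \mathscr Y\\ \mathscr Z\end{pmatrix}=\begin{pmatrix} -2\mathbf x-\mathbf y\mathbf z-3\mathbf x^2\mathbf z-2\mathbf y\mathbf x+\mathbf z\mathbf y^2-2\mathbf z\mathbf x\mathbf y-\mathbf z^3-4\mathbf z^2\mathbf x\\ 4\mathbf z^3-2\mathbf x\mathbf y-4\mathbf z\mathbf y^2-4\mathbf x\mathbf y\mathbf z-4\mathbf y^2+4\mathbf z^2\mathbf x\\ -3\mathbf y\mathbf z-3\mathbf z\mathbf y^2-12\mathbf z^2\mathbf y-3\mathbf z\mathbf x^2-6\mathbf x\mathbf y\mathbf z-12\mathbf z^2\mathbf x-9\mathbf z^3 \end{pmatrix}.$$ Then there are a unique $t_{\mathrm{ext}}\in[0,\infty)$ and a unique continuous function $(\mathscr X,\mathscr Y,\mathscr Z):[0,t_{\mathrm{ext}}]\to\mathbb R^3$ with $(\mathscr X,\mathscr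 Y,\mathscr Z)(0)=(p_1,p_2,p_3)$, such that $\mathscr X$ first hits $0$ at time $t_{\mathrm{ext}}$ and $(\mathscr X',\mathscr Y',\mathscr Z')(t)=\phi(\mathscr X(t),\mathscr Y(t),\mathscr Z(t))$ for all $0\le t<t_{\mathrm{ext}}$. Moreover, $$\sup_{t\ge 0}\left\|\frac1n\bigl(X^n_{\lfloor tn\rfloor},Y^n_{\lfloor tn\rfloor},Z^n_{\lfloor tn\rfloor}\bigr)-(\mathscr X,\mathscr Y,\mathscr Z)(t\wedge t_{\mathrm{ext}})\right\|\longrightarrow 0\quad\text{and}\quad \frac{\theta^n}{n}\longrightarrow t_{\mathrm{ext}}$$ in probability as $n\to\infty$. -/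

import Mathlib

open Filter Topology MeasureTheory
open scoped ENNReal

namespace KarpSipser

/-- Numbers of vertices of degree `1`, `2` and `3`. -/
structure DegreeSequence where
  d₁ : ℕ
  d₂ : ℕ
  d₃ : ℕ

/-- The total number `n = d₁ + 2 d₂ + 3 d₃` of half-edges. -/
def DegreeSequence.size (d : DegreeSequence) : ℕ := d.d₁ + 2 * d.d₂ + 3 * d.d₃

abbrev Vertex (d : DegreeSequence) : Type := Fin d.d₁ ⊕ Fin d.d₂ ⊕ Fin d.d₃

def Vertex.degree {d : DegreeSequence} : Vertex d → ℕ
  | .inl _ => 1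
  | .inr (.inl _) => 2
  | .inr (.inr _) => 3

/-- A half-edge is a vertex `h.1` together with one of its slots. -/
abbrev HalfEdge (d : DegreeSequence) : Type := Σ v : Vertex d, Fin (Vertex.degree v)

/-- Perfect matchings of the half-edges, as fixed-point-free involutions; a uniformly random one
is the configuration model. -/
abbrev Pairing (d : DegreeSequence) : Type :=
  {σ : Equiv.Perm (HalfEdge d) // (∀ h, σ (σ h) = h) ∧ ∀ h, σ h ≠ h}

/-- State of the exploration: the configuration, and the set of half-edges that are still
unmatched. -/
abbrev State (d : DegreeSequence) : Type := Pairing d × Finset (HalfEdge d)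

variable {d : DegreeSequence}

/-- Number of unmatched half-edges attached to the vertex `v`. -/
def State.unmatchedDegree (s : State d) (v : Vertex d) : ℕ :=
  (s.2.filter fun h => h.1 = v).card

/-- Unmatched half-edges attached to vertices of unmatched degree `i`. -/
def State.legs (s : State d) (i : ℕ) : Finset (HalfEdge d) :=
  s.2.filter fun h => State.unmatchedDegree s h.1 = i

/-- One step of the leaf-removal algorithm. The leaf `ℓ` is given through its unique unmatched
half-edge `g`. Its neighbour `v = (s.1.1 g).1` is revealed, and all the edges incident to `v` are
erased (the one that joins it to `ℓ` is among them). Vertices of unmatched degree `0` disappear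
from the counts by themselves. -/
def State.remove (s : State d) (g : HalfEdge d) : State d :=
  (s.1, s.2.filter fun h => h.1 ≠ (s.1.1 g).1 ∧ (s.1.1 h).1 ≠ (s.1.1 g).1)

/-- Law of the initial state: the pairing is uniform and every half-edge is unmatched. -/
noncomputable def initialProb (s : State d) : ℝ≥0∞ :=
  if s.2 = Finset.univ then (Fintype.card (Pairing d) : ℝ≥0∞)⁻¹ else 0

open Classical in
/-- Transition probabilities of the exploration: as long as there are leaves, one of them is
chosen uniformly at random and removed together with its neighbour; then the state is frozen.
Leaves correspond bijectively to the elements of `s.legs 1`. -/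
noncomputable def stepProb (s s' : State d) : ℝ≥0∞ :=
  if State.legs s 1 = ∅ then (if s' = s then 1 else 0)
  else (((State.legs s 1).filter fun g => State.remove s g = s').card : ℝ≥0∞) /
    ((State.legs s 1).card : ℝ≥0∞)

/-- `ξ` is (a version of) the leaf-removal exploration of the configuration model with degree
sequence `d`, defined on the probability space `(Ω, P)`. -/
structure IsExploration {Ω : Type*} [MeasurableSpace Ω] (P : Measure Ω)
    (d : DegreeSequence) (ξ : ℕ → Ω → State d) : Prop where
  measurable : ∀ (k : ℕ) (s : State d), MeasurableSet {ω | ξ k ω = s}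
  law : ∀ (k : ℕ) (s : ℕ → State d),
    P {ω | ∀ i ≤ k, ξ i ω = s i} =
      initialProb (s 0) * ∏ i ∈ Finset.range k, stepProb (s i) (s (i + 1))

/-- The rescaled triple `n⁻¹ (X, Y, Z)` in the state `s`, where `X`, `Y`, `Z` are the numbers of
unmatched half-edges attached to vertices of unmatched degree `1`, `2`, `3`. -/
noncomputable def State.rescaled (s : State d) : ℝ × ℝ × ℝ :=
  (((State.legs s 1).card : ℝ) / d.size, ((State.legs s 2).card : ℝ) / d.size,
    ((State.legs s 3).card : ℝ) / d.size)

/-- The first time at which `X = 0`. For an exploration, this time is almost surely finite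
(each step before it removes half-edges), so the default value of `sInf ∅` is
only taken on a null set. -/
noncomputable def extinctionTime {Ω : Type*} (ξ : ℕ → Ω → State d) (ω : Ω) : ℕ :=
  sInf {k : ℕ | (State.legs (ξ k ω) 1).card = 0}

/-- The drift as a function of the proportions `x`, `y`, `z`. -/
def drift (x y z : ℝ) : ℝ × ℝ × ℝ :=
  (-2 * x - y * z - 3 * x ^ 2 * z - 2 * y * x + z * y ^ 2 - 2 * z * x * y - z ^ 3 - 4 * z ^ 2 * x,
   4 * z ^ 3 - 2 * x * y - 4 * z * y ^ 2 - 4 * x * y * z - 4 * y ^ 2 + 4 * z ^ 2 * x,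
   -3 * y * z - 3 * z * y ^ 2 - 12 * z ^ 2 * y - 3 * z * x ^ 2 - 6 * x * y * z - 12 * z ^ 2 * x
     - 9 * z ^ 3)

/-- The vector field `φ`: the drift at the proportion vector `(X, Y, Z) / (X + Y + Z)`. -/
noncomputable def phi (u : ℝ × ℝ × ℝ) : ℝ × ℝ × ℝ :=
  let S := u.1 + u.2.1 + u.2.2
  drift (u.1 / S) (u.2.1 / S) (u.2.2 / S)

/-- `γ` restricted to `[0, T]` is a solution of `γ' = φ(γ)` started at `p` and run until its first
coordinate first hits `0`, at time `T`. -/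
structure IsFluidSolution (p : ℝ × ℝ × ℝ) (T : ℝ) (γ : ℝ → ℝ × ℝ × ℝ) : Prop where
  nonneg : 0 ≤ T
  continuousOn : ContinuousOn γ (Set.Icc 0 T)
  initial : γ 0 = p
  hasDeriv : ∀ t ∈ Set.Ico 0 T, HasDerivWithinAt γ (phi (γ t)) (Set.Icc 0 T) t
  ne_zero : ∀ t ∈ Set.Ico 0 T, (γ t).1 ≠ 0
  hits : (γ T).1 = 0

end KarpSipser

open KarpSipser

/-!
Let `n` be the number of half-edges. A step of the exploration removes boundedly many half-edges,
and given the past, the pairing of the unmatched half-edges is uniform. The expected change of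
`(X, Y, Z)` in one step is therefore `φ` up to `O(1 / n)`, as long as the number of unmatched
half-edges is of order `n`. The rescaled exploration is thus an Euler scheme of step `1 / n` for
`γ' = φ(γ)`, perturbed by a martingale whose second moment is of order `1 / n`, and a Grönwall
argument keeps it close to `γ` while the total mass of `γ` is bounded below.

The equation is solved explicitly by taking the total mass as the new time. Along the solution the
mass decreases, and at the extinction time either the mass vanishes, so that too few half-edges are
left to keep the exploration alive, or the first coordinate crosses `0` transversally, so that the
exploration runs out of leaves while it still follows `γ`.
-/

namespace KarpSipser

open scoped BigOperators

/-! ### The fluid equation -/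

/-- The total mass `S = X + Y + Z`. -/
def mass (u : ℝ × ℝ × ℝ) : ℝ := u.1 + u.2.1 + u.2.2

lemma continuous_mass : Continuous mass := by
  unfold mass; fun_prop

lemma abs_mass_sub_le (u v : ℝ × ℝ × ℝ) : |mass u - mass v| ≤ 3 * ‖u - v‖ := by
  have h₁ : |u.1 - v.1| ≤ ‖u - v‖ := norm_fst_le (u - v)
  have h₂ : |u.2.1 - v.2.1| ≤ ‖u - v‖ := (norm_fst_le (u - v).2).trans (norm_snd_le (u - v))
  have h₃ : |u.2.2 - v.2.2| ≤ ‖u - v‖ := (norm_snd_le (u - v).2).trans (norm_snd_le (u - v))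
  calc |mass u - mass v| = |(u.1 - v.1) + (u.2.1 - v.2.1) + (u.2.2 - v.2.2)| := by
        unfold mass; ring_nf
    _ ≤ |u.1 - v.1| + |u.2.1 - v.2.1| + |u.2.2 - v.2.2| := abs_add_three _ _ _
    _ ≤ 3 * ‖u - v‖ := by linarith

lemma drift_eq_of_sum_eq_one {x y z : ℝ} (h : x + y + z = 1) :
    drift x y z = (-1 - x + (y + 2 * z) * (y - x), -2 * y + (y + 2 * z) * (2 * z - 2 * y),
      -3 * z - 3 * z * (y + 2 * z)) := by
  obtain rfl : x = 1 - y - z := by linarith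
  unfold drift
  ext <;> simp only <;> ring

lemma contDiffAt_phi {u : ℝ × ℝ × ℝ} (hu : mass u ≠ 0) : ContDiffAt ℝ 1 phi u := by
  unfold phi drift mass at *
  fun_prop (disch := assumption)

lemma exists_lipschitzOnWith_phi {δ : ℝ} (hδ : 0 < δ) (R : ℝ) :
    ∃ L, LipschitzOnWith L phi (Metric.closedBall 0 R ∩ {u | δ ≤ mass u}) := by
  have hmass : IsLinearMap ℝ mass := by
    constructor <;> intros <;> simp [mass] <;> ring
  refine ContDiffOn.exists_lipschitzOnWith (n := 1) ?_ one_ne_zero ?_ ?_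
  · exact fun u hu => (contDiffAt_phi (hδ.trans_le hu.2).ne').contDiffWithinAt
  · exact (convex_closedBall _ _).inter (convex_halfSpace_ge hmass δ)
  · exact (isCompact_closedBall _ _).inter_right (isClosed_le continuous_const continuous_mass)

/-! ### Autonomous differential equations -/

lemma exists_orderIso_hasDerivAt {f : ℝ → ℝ} (hf : Continuous f) {m : ℝ} (hm : 0 < m)
    (hmf : ∀ s, m ≤ f s) (a : ℝ) : ∃ e : ℝ ≃o ℝ, e a = 0 ∧ ∀ s, HasDerivAt e (f s) s := by
  set F : ℝ → ℝ := fun s => ∫ x in a..s, f x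
  have hFa : F a = 0 := intervalIntegral.integral_same
  have hF : ∀ s, HasDerivAt F (f s) s := fun s =>
    intervalIntegral.integral_hasDerivAt_right (hf.intervalIntegrable _ _)
      (hf.stronglyMeasurableAtFilter _ _) hf.continuousAt
  have hmono : StrictMono F := strictMono_of_deriv_pos fun s => by
    rw [(hF s).deriv]; exact hm.trans_le (hmf s)
  have hgrow : Monotone fun s => F s - m * s := by
    have hd : ∀ s, HasDerivAt (fun s => F s - m * s) (f s - m * 1) s := fun s =>
      (hF s).sub ((hasDerivAt_id s).const_mul _)
    refine monotone_of_deriv_nonneg (fun s => (hd s).differentiableAt) fun s => ?_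
    rw [(hd s).deriv, mul_one, sub_nonneg]
    exact hmf s
  have htop : Tendsto F atTop atTop := by
    refine tendsto_atTop_mono' _ (f₁ := fun s => m * s + (F a - m * a)) ?_
      (tendsto_atTop_add_const_right _ _ (tendsto_id.const_mul_atTop hm))
    filter_upwards [eventually_ge_atTop a] with s hs
    linarith [hgrow hs]
  have hbot : Tendsto F atBot atBot := by
    refine tendsto_atBot_mono' _ (f₁ := fun s => m * s + (F a - m * a)) ?_
      (tendsto_atBot_add_const_right _ _ (tendsto_id.const_mul_atBot hm))
    filter_upwards [eventually_le_atBot a] with s hs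
    linarith [hgrow hs]
  have hcont : Continuous F := continuous_iff_continuousAt.2 fun s => (hF s).continuousAt
  exact ⟨hmono.orderIsoOfSurjective F (hcont.surjective htop hbot), hFa, hF⟩

lemma exists_orderIso_flow {g : ℝ → ℝ} (hg : Continuous g) (hpos : ∀ s, 0 < g s) {M : ℝ}
    (hM : ∀ s, g s ≤ M) (a : ℝ) :
    ∃ e : ℝ ≃o ℝ, e 0 = a ∧ ∀ t, HasDerivAt e (g (e t)) t := by
  obtain ⟨e, hea, he⟩ := exists_orderIso_hasDerivAt (hg.inv₀ fun s => (hpos s).ne')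
    (inv_pos.2 ((hpos 0).trans_le (hM 0))) (fun s => inv_anti₀ (hpos s) (hM s)) a
  refine ⟨e.symm, by rw [← hea, e.symm_apply_apply], fun t => ?_⟩
  simpa using HasDerivAt.of_local_left_inverse e.symm.continuous.continuousAt (he _)
    (inv_pos.2 (hpos _)).ne' (Eventually.of_forall e.apply_symm_apply)

lemma eqOn_Icc_of_hasDerivWithinAt {E : Type*} [NormedAddCommGroup E] [NormedSpace ℝ E]
    {v : E → E} {γ η : ℝ → E} {a T : ℝ}
    (hv : ∀ t ∈ Set.Ico a T, ContDiffAt ℝ 1 v (γ t)) (h₀ : γ a = η a)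
    (hγc : ContinuousOn γ (Set.Icc a T)) (hηc : ContinuousOn η (Set.Icc a T))
    (hγ : ∀ t ∈ Set.Ico a T, HasDerivWithinAt γ (v (γ t)) (Set.Ici t) t)
    (hη : ∀ t ∈ Set.Ico a T, HasDerivWithinAt η (v (η t)) (Set.Ici t) t) :
    Set.EqOn γ η (Set.Icc a T) := by
  have hclosed : IsClosed ({t | γ t = η t} ∩ Set.Icc a T) := by
    rw [Set.inter_comm]
    exact (hγc.prodMk hηc).preimage_isClosed_of_isClosed isClosed_Icc isClosed_diagonal
  refine fun t ht => hclosed.Icc_subset_of_forall_exists_gt h₀ ?_ ht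
  rintro x ⟨hx : γ x = η x, hxT⟩ y hy
  obtain ⟨L, N, hN, hL⟩ := (hv x hxT).exists_lipschitzOnWith
  have hnear : ∀ {f : ℝ → E}, ContinuousOn f (Set.Icc a T) → N ∈ 𝓝 (f x) →
      ∀ᶠ t in 𝓝[≥] x, f t ∈ N := fun hf hfN =>
    (hf x ⟨hxT.1, hxT.2.le⟩).mono_of_mem_nhdsWithin (Icc_mem_nhdsGE_of_mem hxT) hfN
  obtain ⟨b, hb, hbN⟩ := (mem_nhdsGE_iff_exists_Ico_subset' hy).1
    ((hnear hγc hN).and (hnear hηc (hx ▸ hN)))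
  obtain ⟨c, hxc, hc⟩ := exists_between (lt_min hb (lt_min hy hxT.2))
  obtain ⟨hcb, hcy, hcT⟩ := by simpa only [lt_min_iff] using hc
  have hIco : Set.Ico x c ⊆ Set.Ico a T := fun t ht => ⟨hxT.1.trans ht.1, ht.2.trans hcT⟩
  have hIcc : Set.Icc x c ⊆ Set.Icc a T := Set.Icc_subset_Icc hxT.1 hcT.le
  have heq : Set.EqOn γ η (Set.Icc x c) := ODE_solution_unique_of_mem_Icc_right
    (v := fun _ => v) (s := fun _ => N) (fun _ _ => hL)
    (hγc.mono hIcc) (fun t ht => hγ t (hIco ht)) (fun t ht => (hbN ⟨ht.1, ht.2.trans hcb⟩).1)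
    (hηc.mono hIcc) (fun t ht => hη t (hIco ht)) (fun t ht => (hbN ⟨ht.1, ht.2.trans hcb⟩).2) hx
  exact ⟨c, heq ⟨hxc.le, le_rfl⟩, hxc, hcy.le⟩

/-! ### The explicit solution of the fluid equation -/

/-- The integral curve of `φ`, parametrised by the total mass `s`. The constants
`C = Z / S ^ (3 / 2)` and `K = (1 + y + 2 z) ^ 2 - 4 z` are first integrals of the equation. -/
noncomputable def fluidCurve (C K s : ℝ) : ℝ × ℝ × ℝ :=
  (s * (2 - √(K + 4 * C * √s) + C * √s), s * (√(K + 4 * C * √s) - 1 - 2 * (C * √s)),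
    s * (C * √s))

lemma mass_fluidCurve (C K s : ℝ) : mass (fluidCurve C K s) = s := by
  simp only [mass, fluidCurve]; ring

lemma continuous_fluidCurve (C K : ℝ) : Continuous (fluidCurve C K) := by
  unfold fluidCurve; fun_prop

lemma fluidCurve_one {y z : ℝ} (hy : 0 ≤ y) (hz : 0 ≤ z) :
    fluidCurve z ((1 + y + 2 * z) ^ 2 - 4 * z) 1 = (1 - y - z, y, z) := by
  have hroot : √((1 + y + 2 * z) ^ 2 - 4 * z + 4 * z * 1) = 1 + y + 2 * z := by
    rw [mul_one, sub_add_cancel, Real.sqrt_sq (by positivity)]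
  simp only [fluidCurve, Real.sqrt_one, hroot]
  ext <;> simp only <;> ring

lemma phi_fluidCurve {C K s : ℝ} (hs : s ≠ 0) :
    phi (fluidCurve C K s) =
      drift (2 - √(K + 4 * C * √s) + C * √s) (√(K + 4 * C * √s) - 1 - 2 * (C * √s)) (C * √s) := by
  have hm : (fluidCurve C K s).1 + (fluidCurve C K s).2.1 + (fluidCurve C K s).2.2 = s :=
    mass_fluidCurve C K s
  simp only [phi, hm]
  simp only [fluidCurve, mul_div_cancel_left₀ _ hs]

lemma hasDerivAt_fluidCurve {C K s : ℝ} (hs : 0 < s) (hq : 0 < K + 4 * C * √s) :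
    HasDerivAt (fluidCurve C K)
      (-(2 * √(K + 4 * C * √s))⁻¹ • phi (fluidCurve C K s)) s := by
  rw [phi_fluidCurve hs.ne', drift_eq_of_sum_eq_one (by ring)]
  have : 0 < √s := Real.sqrt_pos.2 hs
  have hq' : 0 < √(K + 4 * C * √s) := Real.sqrt_pos.2 hq
  have hdz : HasDerivAt (fun s => C * √s) (C * √s / (2 * s)) s := by
    refine ((Real.hasDerivAt_sqrt hs.ne').const_mul C).congr_deriv ?_
    nth_rw 3 [← Real.sq_sqrt hs.le]
    field_simp
  have hdq : HasDerivAt (fun s => √(K + 4 * C * √s)) (C * √s / (s * √(K + 4 * C * √s))) s := by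
    have hin : HasDerivAt (fun s => K + 4 * C * √s) (4 * (C * √s / (2 * s))) s := by
      simpa only [mul_assoc] using (hdz.const_mul 4).const_add K
    refine (hin.sqrt hq.ne').congr_deriv ?_
    field_simp
    ring
  have hX := (hasDerivAt_id s).mul ((hdq.const_sub 2).add hdz)
  have hY := (hasDerivAt_id s).mul ((hdq.sub_const 1).sub (hdz.const_mul 2))
  have hZ := (hasDerivAt_id s).mul hdz
  refine (hX.prodMk (hY.prodMk hZ)).congr_deriv ?_
  simp only [Pi.add_apply, Pi.sub_apply, id]
  generalize √(K + 4 * C * √s) = q at hq'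
  generalize C * √s = z
  ext <;> simp only [Prod.smul_mk, smul_eq_mul] <;> field_simp <;> ring

lemma fluidCurve_fst_pos_iff {C K s : ℝ} (hC : 0 ≤ C) (hs : 0 < s) :
    0 < (fluidCurve C K s).1 ↔ K < 4 + C ^ 2 * s := by
  have : 0 ≤ C * √s := by positivity
  have hz2 : (C * √s) ^ 2 = C ^ 2 * s := by rw [mul_pow, Real.sq_sqrt hs.le]
  rw [fluidCurve, mul_pos_iff_of_pos_left hs, sub_add_eq_add_sub, sub_pos,
    Real.sqrt_lt' (by positivity)]
  constructor <;> intro h <;> linarith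

lemma fluidCurve_fst_neg_iff {C K s : ℝ} (hC : 0 ≤ C) (hs : 0 < s) :
    (fluidCurve C K s).1 < 0 ↔ 4 + C ^ 2 * s < K := by
  have : 0 ≤ C * √s := by positivity
  have hz2 : (C * √s) ^ 2 = C ^ 2 * s := by rw [mul_pow, Real.sq_sqrt hs.le]
  rw [fluidCurve, ← neg_pos, ← mul_neg, mul_pos_iff_of_pos_left hs, neg_pos, sub_add_eq_add_sub,
    sub_neg, Real.lt_sqrt (by positivity)]
  constructor <;> intro h <;> linarith

lemma exists_extinction_mass {C K : ℝ} (hC : 0 ≤ C) (hK : K ≤ 4 + C ^ 2)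
    (hK₀ : C = 0 → K < 4) :
    ∃ s₀ ∈ Set.Icc (0 : ℝ) 1, (∀ s, s₀ < s → 0 < (fluidCurve C K s).1) ∧
      (fluidCurve C K s₀).1 = 0 ∧ (0 < s₀ → ∀ s ∈ Set.Ioo 0 s₀, (fluidCurve C K s).1 < 0) := by
  rcases le_or_gt K 4 with hK4 | hK4
  · refine ⟨0, ⟨le_rfl, zero_le_one⟩, fun s hs => (fluidCurve_fst_pos_iff hC hs).2 ?_,
      by simp [fluidCurve], fun h => absurd h (lt_irrefl _)⟩
    rcases hC.eq_or_lt with hC0 | hC0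
    · nlinarith [hK₀ hC0.symm]
    · nlinarith [mul_pos (pow_pos hC0 2) hs]
  · have hC0 : 0 < C := hC.lt_of_ne fun h => absurd (hK₀ h.symm) hK4.not_gt
    have hC2 : 0 < C ^ 2 := by positivity
    have hs₀ : 0 < (K - 4) / C ^ 2 := div_pos (by linarith) hC2
    have hK' : K = 4 + C ^ 2 * ((K - 4) / C ^ 2) := by field_simp; ring
    refine ⟨(K - 4) / C ^ 2, ⟨hs₀.le, (div_le_one hC2).2 (by linarith)⟩, fun s hs => ?_, ?_,
      fun _ s hs => ?_⟩
    · refine (fluidCurve_fst_pos_iff hC (hs₀.trans hs)).2 ?_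
      linarith [mul_lt_mul_of_pos_left hs hC2]
    · exact le_antisymm (not_lt.1 fun h => ((fluidCurve_fst_pos_iff hC hs₀).1 h).ne hK')
        (not_lt.1 fun h => ((fluidCurve_fst_neg_iff hC hs₀).1 h).ne' hK')
    · refine (fluidCurve_fst_neg_iff hC hs.1).2 ?_
      linarith [mul_lt_mul_of_pos_left hs.2 hC2]

lemma exists_fluidCurve_flow {C K : ℝ} (hC : 0 ≤ C) (hK : 0 < K) :
    ∃ S : ℝ → ℝ, S 0 = 1 ∧ Continuous S ∧ StrictAnti S ∧ Function.Surjective S ∧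
      ∀ t, 0 ≤ t → 0 < S t →
        HasDerivAt (fun t => fluidCurve C K (S t)) (phi (fluidCurve C K (S t))) t := by
  -- `S' = -2 q`; the rate is truncated at mass `1` only to make it bounded.
  set rate : ℝ → ℝ := fun s => 2 * √(K + 4 * C * √(min s 1)) with hrate
  have hpos : ∀ s, 0 < rate s := fun s => by positivity
  have hle : ∀ s, rate s ≤ 2 * √(K + 4 * C) := fun s => by
    have h : 4 * C * √(min s 1) ≤ 4 * C :=
      mul_le_of_le_one_right (by positivity) (Real.sqrt_le_one.2 (min_le_right _ _))
    simp only [hrate]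
    gcongr
  obtain ⟨e, he₀, he⟩ := exists_orderIso_flow (by fun_prop) hpos hle 1
  have hanti : StrictAnti fun t => e (-t) := fun a b hab => e.strictMono (neg_lt_neg hab)
  refine ⟨fun t => e (-t), by simpa using he₀, e.continuous.comp continuous_neg, hanti,
    e.surjective.comp neg_surjective, fun t ht hS => ?_⟩
  have hq : 0 < K + 4 * C * √(e (-t)) := by positivity
  have hle1 : e (-t) ≤ 1 := by simpa [he₀] using hanti.antitone ht
  have hS' : HasDerivAt (fun t => e (-t)) (-(2 * √(K + 4 * C * √(e (-t))))) t := by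
    simpa [hrate, min_eq_left hle1, Function.comp_def] using
      (he (-t)).comp t (hasDerivAt_neg t)
  refine ((hasDerivAt_fluidCurve hS hq).scomp t hS').congr_deriv ?_
  have := Real.sqrt_pos.2 hq
  rw [smul_smul, neg_mul_neg, mul_inv_cancel₀ (by positivity), one_smul]

/-- A solution `γ` of the fluid equation that is followed beyond the first time `tExt` at which its
first coordinate vanishes. Either it dies at `tExt` with all its mass, or its first coordinate
becomes negative immediately after `tExt`, while the mass is still positive. -/
structure IsExtendedFluidSolution (p : ℝ × ℝ × ℝ) (tExt : ℝ) (γ : ℝ → ℝ × ℝ × ℝ) : Prop where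
  nonneg : 0 ≤ tExt
  continuous : Continuous γ
  initial : γ 0 = p
  pos : ∀ t ∈ Set.Ico 0 tExt, 0 < (γ t).1 ∧ 0 < mass (γ t)
  hits : (γ tExt).1 = 0
  hasDerivAt : ∀ t, 0 ≤ t → 0 < mass (γ t) → HasDerivAt γ (phi (γ t)) t
  dies_or_crosses : γ tExt = 0 ∨ ∀ η > 0, ∃ T ∈ Set.Ioo tExt (tExt + η), (γ T).1 < 0 ∧
    ∀ t ∈ Set.Icc 0 T, 0 < mass (γ t)

lemma exists_isExtendedFluidSolution {x y z : ℝ} (hx : 0 ≤ x) (hy : 0 ≤ y) (hz : 0 ≤ z)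
    (hsum : x + y + z = 1) (hxz : 0 < x ∨ 0 < z) :
    ∃ (tExt : ℝ) (γ : ℝ → ℝ × ℝ × ℝ), IsExtendedFluidSolution (x, y, z) tExt γ := by
  set K := (1 + y + 2 * z) ^ 2 - 4 * z with hKdef
  have hK : K ≤ 4 + z ^ 2 := by nlinarith [hKdef]
  have hK₀ : z = 0 → K < 4 := fun h => by
    have hx' : 0 < x := hxz.resolve_right h.not_gt
    nlinarith
  obtain ⟨s₀, hs₀, hpos, hzero, hneg⟩ := exists_extinction_mass hz hK hK₀
  obtain ⟨S, hS0, hSc, hSanti, hSsurj, hSd⟩ := exists_fluidCurve_flow hz (K := K) (by nlinarith)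
  obtain ⟨tExt, rfl⟩ := hSsurj s₀
  have hmass : ∀ t, mass (fluidCurve z K (S t)) = S t := fun t => mass_fluidCurve _ _ _
  refine ⟨tExt, fun t => fluidCurve z K (S t), ?_, (continuous_fluidCurve z K).comp hSc, ?_, ?_,
    hzero, fun t ht hm => hSd t ht (hmass t ▸ hm), ?_⟩
  · exact hSanti.le_iff_ge.1 (hS0 ▸ hs₀.2)
  · rw [hS0, fluidCurve_one hy hz, ← hsum]
    ext <;> simp only; ring
  · intro t ht
    have hlt := hSanti ht.2
    exact ⟨hpos _ hlt, (hmass t).symm ▸ hs₀.1.trans_lt hlt⟩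
  rcases hs₀.1.eq_or_lt with h | h
  · exact Or.inl (by simp [← h, fluidCurve])
  refine Or.inr fun η hη => ?_
  obtain ⟨t', ht'⟩ := hSsurj (S tExt / 2)
  have hlt : tExt < t' := hSanti.lt_iff_gt.1 (by linarith)
  obtain ⟨T, hT, hT'⟩ := exists_between (lt_min hlt (lt_add_of_pos_right tExt hη))
  have hST : 0 < S T := (ht' ▸ half_pos h).trans (hSanti (hT'.trans_le (min_le_left _ _)))
  exact ⟨T, ⟨hT, hT'.trans_le (min_le_right _ _)⟩, hneg h _ ⟨hST, hSanti hT⟩,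
    fun t ht => (hmass t).symm ▸ hST.trans_le (hSanti.antitone ht.2)⟩

section

variable {p : ℝ × ℝ × ℝ} {tExt : ℝ} {γ : ℝ → ℝ × ℝ × ℝ}

lemma IsExtendedFluidSolution.isFluidSolution (hγ : IsExtendedFluidSolution p tExt γ) :
    IsFluidSolution p tExt γ where
  nonneg := hγ.nonneg
  continuousOn := hγ.continuous.continuousOn
  initial := hγ.initial
  hasDeriv t ht := (hγ.hasDerivAt t ht.1 (hγ.pos t ht).2).hasDerivWithinAt
  ne_zero t ht := (hγ.pos t ht).1.ne'
  hits := hγ.hits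

lemma IsExtendedFluidSolution.eq_of_isFluidSolution {η : ℝ → ℝ × ℝ × ℝ} {T : ℝ}
    (hγ : IsExtendedFluidSolution p tExt γ) (hη : IsFluidSolution p T η) :
    T = tExt ∧ Set.EqOn η γ (Set.Icc 0 tExt) := by
  have heq : Set.EqOn γ η (Set.Icc 0 (min T tExt)) := by
    have hpos : ∀ t ∈ Set.Ico 0 (min T tExt), 0 < mass (γ t) := fun t ht =>
      (hγ.pos t ⟨ht.1, ht.2.trans_le (min_le_right _ _)⟩).2
    refine eqOn_Icc_of_hasDerivWithinAt (fun t ht => contDiffAt_phi (hpos t ht).ne')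
      (hγ.initial.trans hη.initial.symm) hγ.continuous.continuousOn
      (hη.continuousOn.mono (Set.Icc_subset_Icc_right (min_le_left _ _)))
      (fun t ht => (hγ.hasDerivAt t ht.1 (hpos t ht)).hasDerivWithinAt) fun t ht => ?_
    have htT : t ∈ Set.Ico 0 T := ⟨ht.1, ht.2.trans_le (min_le_left _ _)⟩
    exact (hη.hasDeriv t htT).mono_of_mem_nhdsWithin (Icc_mem_nhdsGE_of_mem htT)
  have hend := heq ⟨le_min hη.nonneg hγ.nonneg, le_rfl⟩
  obtain rfl : T = tExt := by
    rcases lt_trichotomy T tExt with h | h | h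
    · rw [min_eq_left h.le] at hend
      exact absurd (hend ▸ hη.hits) (hγ.pos T ⟨hη.nonneg, h⟩).1.ne'
    · exact h
    · rw [min_eq_right h.le] at hend
      exact absurd (hend ▸ hγ.hits) (hη.ne_zero tExt ⟨hγ.nonneg, h⟩)
  exact ⟨rfl, (min_self T ▸ heq).symm⟩

end

/-! ### Averages over nested finite sets -/

lemma abs_expect_le {ι : Type*} {B : Finset ι} {L : ι → ℝ} {c : ℝ} (hc : 0 ≤ c)
    (hL : ∀ m ∈ B, |L m| ≤ c) : |𝔼 m ∈ B, L m| ≤ c := by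
  rcases B.eq_empty_or_nonempty with rfl | hB
  · simpa using hc
  · exact (Finset.abs_expect_le _ _).trans (Finset.expect_le hB hL)

lemma abs_expect_sub_expect_le {ι : Type*} [DecidableEq ι] {A B : Finset ι} (hBA : B ⊆ A)
    (hB : B.Nonempty) {L : ι → ℝ} {c : ℝ} (hc : 0 ≤ c) (hL : ∀ m ∈ A, |L m| ≤ c) :
    |𝔼 m ∈ B, L m - 𝔼 m ∈ A, L m| ≤ 2 * c * (A \ B).card / A.card := by
  have : (0 : ℝ) < B.card := by exact_mod_cast hB.card_pos
  have hA₀ : (0 : ℝ) < A.card := by exact_mod_cast (hB.mono hBA).card_pos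
  have hcard : (A.card : ℝ) = (A \ B).card + B.card := by
    exact_mod_cast (Finset.card_sdiff_add_card_eq_card hBA).symm
  have hdiff : 𝔼 m ∈ B, L m - 𝔼 m ∈ A, L m =
      ((A \ B).card * 𝔼 m ∈ B, L m - ∑ m ∈ A \ B, L m) / A.card := by
    rw [Finset.expect_eq_sum_div_card, Finset.expect_eq_sum_div_card, ← Finset.sum_sdiff hBA]
    field_simp
    rw [hcard]
    ring
  have hsum : |∑ m ∈ A \ B, L m| ≤ (A \ B).card * c := by
    rw [← nsmul_eq_mul]
    exact (Finset.abs_sum_le_sum_abs _ _).trans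
      (Finset.sum_le_card_nsmul _ _ _ fun m hm => hL m (Finset.sdiff_subset hm))
  have hmul : |((A \ B).card : ℝ) * 𝔼 m ∈ B, L m| ≤ (A \ B).card * c := by
    rw [abs_mul, Nat.abs_cast]
    gcongr
    exact abs_expect_le hc fun m hm => hL m (hBA hm)
  rw [hdiff, abs_div, abs_of_pos hA₀]
  gcongr
  exact (abs_sub _ _).trans (by linarith)

/-! ### Exchangeable weights on pairings -/

/-- Fixed-point-free involutions, that is, perfect matchings of `H`. -/
abbrev PairingOn (H : Type*) : Type _ :=
  {σ : Equiv.Perm H // (∀ h, σ (σ h) = h) ∧ ∀ h, σ h ≠ h}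

section Pairings

variable {H : Type*} [DecidableEq H]

/-- The pairing `σ` with the roles of `a` and `b` exchanged. -/
def swapPairing (a b : H) (σ : PairingOn H) : PairingOn H :=
  ⟨Equiv.swap a b * σ.1 * Equiv.swap a b, fun h => by simp [σ.2.1], fun h e => by
    have := congrArg (Equiv.swap a b) e
    simp only [Equiv.Perm.mul_apply, Equiv.swap_apply_self] at this
    exact σ.2.2 _ this⟩

lemma swapPairing_apply (a b : H) (σ : PairingOn H) (h : H) :
    (swapPairing a b σ).1 h = Equiv.swap a b (σ.1 (Equiv.swap a b h)) := rfl

lemma swapPairing_involutive (a b : H) : Function.Involutive (swapPairing a b) := fun σ => by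
  ext h
  simp [swapPairing_apply]

/-- Exchangeability in `B` of a weight (an unnormalised law) on the pairings. -/
def SwapInvariant (B : Finset H) (W : PairingOn H → ℝ) : Prop :=
  ∀ a ∈ B, ∀ b ∈ B, ∀ σ, W (swapPairing a b σ) = W σ

/-- The restriction of the weight `W` to the pairings that pair `g` with `h`. -/
def restrictWeight (W : PairingOn H → ℝ) (g h : H) (σ : PairingOn H) : ℝ :=
  if σ.1 g = h then W σ else 0

variable {W : PairingOn H → ℝ} {A B : Finset H} {g h : H}

lemma SwapInvariant.mono (hW : SwapInvariant A W) (hBA : B ⊆ A) : SwapInvariant B W :=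
  fun a ha b hb σ => hW a (hBA ha) b (hBA hb) σ

lemma SwapInvariant.restrictWeight (hW : SwapInvariant B W) (hg : g ∉ B) (hh : h ∉ B) :
    SwapInvariant B (restrictWeight W g h) := by
  intro a ha b hb σ
  have hne : ∀ {x}, x ∉ B → x ≠ a ∧ x ≠ b := fun hx =>
    ⟨fun e => hx (e ▸ ha), fun e => hx (e ▸ hb)⟩
  have hiff : (swapPairing a b σ).1 g = h ↔ σ.1 g = h := by
    rw [swapPairing_apply, Equiv.swap_apply_of_ne_of_ne (hne hg).1 (hne hg).2,
      Equiv.swap_apply_eq_iff, Equiv.swap_apply_of_ne_of_ne (hne hh).1 (hne hh).2]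
  simp only [KarpSipser.restrictWeight, hiff, hW a ha b hb σ]

lemma restrictWeight_nonneg (hW : ∀ σ, 0 ≤ W σ) (g h : H) (σ : PairingOn H) :
    0 ≤ restrictWeight W g h σ := by
  unfold restrictWeight; split_ifs <;> simp [hW]

lemma restrictWeight_ne_zero {σ : PairingOn H} (hσ : restrictWeight W g h σ ≠ 0) :
    σ.1 g = h ∧ W σ ≠ 0 := by
  unfold restrictWeight at hσ
  split_ifs at hσ with hgh
  · exact ⟨hgh, hσ⟩
  · exact absurd rfl hσ

variable [Fintype H]

lemma sum_mul_eq_sum_restrictWeight_mul (hsupp : ∀ σ, W σ ≠ 0 → σ.1 g ∈ B)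
    (F : PairingOn H → H → ℝ) :
    ∑ σ, W σ * F σ (σ.1 g) = ∑ h ∈ B, ∑ σ, restrictWeight W g h σ * F σ h := by
  rw [Finset.sum_comm]
  refine Finset.sum_congr rfl fun σ _ => ?_
  by_cases hσ : W σ = 0
  · simp [hσ, restrictWeight]
  · simp only [restrictWeight, ite_mul, zero_mul]
    rw [Finset.sum_ite_eq, if_pos (hsupp σ hσ)]

lemma sum_eq_sum_restrictWeight (hsupp : ∀ σ, W σ ≠ 0 → σ.1 g ∈ B) :
    ∑ σ, W σ = ∑ h ∈ B, ∑ σ, restrictWeight W g h σ := by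
  simpa using sum_mul_eq_sum_restrictWeight_mul hsupp fun _ _ => 1

lemma SwapInvariant.sum_restrictWeight_congr (hW : SwapInvariant B W) (hh : h ∉ B) {a b : H}
    (ha : a ∈ B) (hb : b ∈ B) :
    ∑ σ, KarpSipser.restrictWeight W h a σ = ∑ σ, KarpSipser.restrictWeight W h b σ := by
  rw [← Equiv.sum_comp (swapPairing_involutive a b).toPerm]
  refine Finset.sum_congr rfl fun σ _ => ?_
  have hne : h ≠ a ∧ h ≠ b := ⟨fun e => hh (e ▸ ha), fun e => hh (e ▸ hb)⟩
  have hiff : (swapPairing a b σ).1 h = a ↔ σ.1 h = b := by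
    rw [swapPairing_apply, Equiv.swap_apply_of_ne_of_ne hne.1 hne.2, Equiv.swap_apply_eq_iff,
      Equiv.swap_apply_left]
  simp only [Function.Involutive.coe_toPerm, KarpSipser.restrictWeight, hiff, hW a ha b hb σ]

lemma SwapInvariant.sum_mul_apply (hW : SwapInvariant B W) (hh : h ∉ B)
    (hsupp : ∀ σ, W σ ≠ 0 → σ.1 h ∈ B) (L : H → ℝ) :
    ∑ σ, W σ * L (σ.1 h) = (∑ σ, W σ) * 𝔼 m ∈ B, L m := by
  rw [sum_mul_eq_sum_restrictWeight_mul hsupp fun _ m => L m]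
  rcases B.eq_empty_or_nonempty with rfl | hB
  · simp
  have hB₀ : (B.card : ℝ) ≠ 0 := by exact_mod_cast hB.card_pos.ne'
  have hunif : ∀ m ∈ B, ∑ σ, KarpSipser.restrictWeight W h m σ = (∑ σ, W σ) / B.card := by
    intro m hm
    rw [sum_eq_sum_restrictWeight hsupp,
      Finset.sum_congr rfl fun a ha => hW.sum_restrictWeight_congr hh ha hm,
      Finset.sum_const, nsmul_eq_mul, mul_div_cancel_left₀ _ hB₀]
  calc ∑ m ∈ B, ∑ σ, KarpSipser.restrictWeight W h m σ * L m
      = ∑ m ∈ B, (∑ σ, W σ) / B.card * L m :=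
        Finset.sum_congr rfl fun m hm => by rw [← Finset.sum_mul, hunif m hm]
    _ = (∑ σ, W σ) * 𝔼 m ∈ B, L m := by
        rw [← Finset.mul_sum, Finset.expect_eq_sum_div_card]
        ring

lemma SwapInvariant.sum_mul_indicator (hW : SwapInvariant B W) (hh : h ∉ B)
    (hsupp : ∀ σ, W σ ≠ 0 → σ.1 h ∈ B) (p : H → Prop) [DecidablePred p] :
    ∑ σ, W σ * (if p (σ.1 h) then 1 else 0) =
      (B.filter p).card / B.card * ∑ σ, W σ := by
  rw [hW.sum_mul_apply hh hsupp fun m => if p m then 1 else 0, mul_comm,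
    Finset.expect_eq_sum_div_card, Finset.sum_boole]

end Pairings

/-! ### Degrees and removals for a fixed pairing -/

section Degrees

variable {H V : Type*} [DecidableEq V]

/-- The elements of `A` attached to the vertex `v`. -/
def fiber (π : H → V) (A : Finset H) (v : V) : Finset H := A.filter fun h => π h = v

/-- The number of elements of `A` attached to the vertex `v`: its unmatched degree, when `A` is the
set of unmatched half-edges. -/
def deg (π : H → V) (A : Finset H) (v : V) : ℕ := (fiber π A v).card

/-- The set that is left of `A` when all edges at the vertex of the partner of `g` are erased. -/
def removeSet (π : H → V) (σ : PairingOn H) (A : Finset H) (g : H) : Finset H :=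
  A.filter fun h => π h ≠ π (σ.1 g) ∧ π (σ.1 h) ≠ π (σ.1 g)

/-- The change of the potential of `c` when only the half-edge `m` is erased. -/
def gain (π : H → V) (c : ℕ → ℝ) (A : Finset H) (m : H) : ℝ :=
  c (deg π A (π m) - 1) - c (deg π A (π m))

variable {π : H → V} {σ : PairingOn H} {A A' : Finset H} {g h : H} {u v : V} {c : ℕ → ℝ} {D : ℕ}
  {M : ℝ}

lemma mem_fiber : h ∈ fiber π A v ↔ h ∈ A ∧ π h = v := by
  simp [fiber]

lemma deg_le [Fintype H] (hπ : ∀ v, deg π Finset.univ v ≤ D) (A : Finset H) (v : V) :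
    deg π A v ≤ D :=
  (Finset.card_le_card (Finset.filter_subset_filter _ (Finset.subset_univ A))).trans (hπ v)

lemma eq_of_deg_eq_one (hg : g ∈ A) (hg₁ : deg π A (π g) = 1) (hh : h ∈ A) (hhg : π h = π g) :
    h = g :=
  Finset.card_le_one.1 (le_of_eq hg₁) h (mem_fiber.2 ⟨hh, hhg⟩) g (mem_fiber.2 ⟨hg, rfl⟩)

lemma deg_removeSet_self (σ : PairingOn H) (A : Finset H) (g : H) :
    deg π (removeSet π σ A g) (π (σ.1 g)) = 0 := by
  simp only [deg, Finset.card_eq_zero, Finset.eq_empty_iff_forall_notMem, mem_fiber, removeSet,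
    Finset.mem_filter]
  tauto

lemma abs_sub_le_of_mem_Icc_zero (hc : ∀ k, c k ∈ Set.Icc 0 M) (i j : ℕ) : |c i - c j| ≤ M := by
  simpa using abs_sub_le_of_le_of_le (hc i).1 (hc i).2 (hc j).1 (hc j).2

lemma abs_gain_le (hc : ∀ k, c k ∈ Set.Icc 0 M) (A : Finset H) (m : H) : |gain π c A m| ≤ M :=
  abs_sub_le_of_mem_Icc_zero hc _ _

lemma deg_removeSet (hA : ∀ h ∈ A, σ.1 h ∈ A) (hu : u ≠ π (σ.1 g)) :
    deg π (removeSet π σ A g) u =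
      deg π A u - ((fiber π A (π (σ.1 g))).filter fun h => π (σ.1 h) = u).card := by
  classical
  set matched := ((fiber π A (π (σ.1 g))).filter fun h => π (σ.1 h) = u).image σ.1
  have hfiber : fiber π (removeSet π σ A g) u = fiber π A u \ matched := by
    ext h
    simp only [matched, mem_fiber, removeSet, Finset.mem_filter, Finset.mem_sdiff,
      Finset.mem_image]
    constructor
    · rintro ⟨⟨hh, -, hσh⟩, rfl⟩
      refine ⟨⟨hh, rfl⟩, ?_⟩
      rintro ⟨h', ⟨⟨-, hh'⟩, -⟩, rfl⟩
      exact hσh (by rwa [σ.2.1])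
    · rintro ⟨⟨hh, rfl⟩, hnot⟩
      refine ⟨⟨hh, hu, fun e => hnot ⟨σ.1 h, ⟨⟨hA h hh, e⟩, ?_⟩, σ.2.1 h⟩⟩, rfl⟩
      rw [σ.2.1]
  have hsub : matched ⊆ fiber π A u := by
    intro h
    simp only [matched, mem_fiber, Finset.mem_filter, Finset.mem_image]
    rintro ⟨h', ⟨⟨hh', -⟩, hu'⟩, rfl⟩
    exact ⟨hA _ hh', hu'⟩
  rw [deg, deg, hfiber, Finset.card_sdiff_of_subset hsub,
    Finset.card_image_of_injective _ σ.1.injective]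

lemma card_sdiff_removeSet_le [DecidableEq H] [Fintype H] (hπ : ∀ v, deg π Finset.univ v ≤ D)
    (σ : PairingOn H) (A : Finset H) (g : H) : (A \ removeSet π σ A g).card ≤ 2 * D := by
  have hsub : A \ removeSet π σ A g ⊆ fiber π Finset.univ (π (σ.1 g)) ∪
      (fiber π Finset.univ (π (σ.1 g))).image σ.1 := by
    intro h
    simp only [removeSet, Finset.mem_sdiff, Finset.mem_filter, Finset.mem_union, mem_fiber,
      Finset.mem_univ, true_and, Finset.mem_image]
    rintro ⟨hh, hnot⟩
    by_cases hv : π h = π (σ.1 g)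
    · exact Or.inl hv
    · by_cases hσv : π (σ.1 h) = π (σ.1 g)
      · exact Or.inr ⟨σ.1 h, hσv, σ.2.1 h⟩
      · exact absurd ⟨hh, hv, hσv⟩ hnot
  calc (A \ removeSet π σ A g).card ≤ _ := Finset.card_le_card hsub
    _ ≤ _ := Finset.card_union_le _ _
    _ ≤ D + D := add_le_add (hπ _) (Finset.card_image_le.trans (hπ _))
    _ = 2 * D := (two_mul D).symm

variable [Fintype V]

/-- The sum over all vertices of a function of their degree. Every quantity tracked along the
exploration is of this form. -/
noncomputable def potential (π : H → V) (c : ℕ → ℝ) (A : Finset H) : ℝ := ∑ v, c (deg π A v)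

lemma abs_potential_sub_le [DecidableEq H] (hc : ∀ k, c k ∈ Set.Icc 0 M) (hA : A' ⊆ A) :
    |potential π c A' - potential π c A| ≤ M * (A \ A').card := by
  have hM : 0 ≤ M := (hc 0).1.trans (hc 0).2
  have hcard : (A \ A').card = ∑ v, (fiber π (A \ A') v).card :=
    Finset.card_eq_sum_card_fiberwise fun x _ => Finset.mem_coe.2 (Finset.mem_univ (π x))
  rw [potential, potential, ← Finset.sum_sub_distrib, hcard, Nat.cast_sum, Finset.mul_sum]
  refine (Finset.abs_sum_le_sum_abs _ _).trans (Finset.sum_le_sum fun v _ => ?_)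
  rcases (fiber π (A \ A') v).eq_empty_or_nonempty with hempty | hne
  · have hfiber : fiber π A' v = fiber π A v := by
      ext h
      have hh : h ∉ fiber π (A \ A') v := hempty ▸ Finset.notMem_empty h
      simp only [mem_fiber, Finset.mem_sdiff] at hh ⊢
      have := @hA h
      tauto
    simp [deg, hfiber, hempty]
  · exact (abs_sub_le_of_mem_Icc_zero hc _ _).trans
      (le_mul_of_one_le_right hM (by exact_mod_cast hne.card_pos))

lemma abs_potential_removeSet_sub_le [Fintype H] (hπ : ∀ v, deg π Finset.univ v ≤ D)
    (hc : ∀ k, c k ∈ Set.Icc 0 M) (σ : PairingOn H) (A : Finset H) (g : H) :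
    |potential π c (removeSet π σ A g) - potential π c A| ≤ 2 * D * M := by
  classical
  have hM : 0 ≤ M := (hc 0).1.trans (hc 0).2
  calc |potential π c (removeSet π σ A g) - potential π c A|
      ≤ M * (A \ removeSet π σ A g).card := abs_potential_sub_le hc (Finset.filter_subset _ _)
    _ ≤ M * (2 * D) := by
      gcongr
      exact_mod_cast card_sdiff_removeSet_le hπ σ A g
    _ = 2 * D * M := mul_comm _ _

lemma potential_removeSet_sub (hA : ∀ h ∈ A, σ.1 h ∈ A) (hc₀ : c 0 = 0)
    (hloop : ∀ h ∈ fiber π A (π (σ.1 g)), π (σ.1 h) ≠ π (σ.1 g))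
    (hmult : ∀ h ∈ fiber π A (π (σ.1 g)), ∀ h' ∈ fiber π A (π (σ.1 g)), h ≠ h' →
      π (σ.1 h) ≠ π (σ.1 h')) :
    potential π c (removeSet π σ A g) - potential π c A =
      -c (deg π A (π (σ.1 g))) + ∑ h ∈ fiber π A (π (σ.1 g)), gain π c A (σ.1 h) := by
  set v := π (σ.1 g) with hv
  have hvertex : ∀ u, c (deg π (removeSet π σ A g) u) - c (deg π A u) =
      (if u = v then -c (deg π A v) else 0) +
        ∑ h ∈ fiber π A v, if π (σ.1 h) = u then gain π c A (σ.1 h) else 0 := by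
    intro u
    by_cases hu : u = v
    · rw [hu, if_pos rfl, Finset.sum_eq_zero fun h hh => if_neg (hloop h hh), hv,
        deg_removeSet_self, hc₀]
      ring
    · rw [if_neg hu, zero_add, deg_removeSet hA hu, ← Finset.sum_filter]
      rcases ((fiber π A v).filter fun h => π (σ.1 h) = u).eq_empty_or_nonempty with he | ⟨h, hh⟩
      · rw [he]
        simp
      · have hs : ((fiber π A v).filter fun h => π (σ.1 h) = u) = {h} := by
          refine Finset.eq_singleton_iff_unique_mem.2 ⟨hh, fun h' hh' => ?_⟩
          rw [Finset.mem_filter] at hh hh'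
          by_contra hne
          exact hmult h' hh'.1 h hh.1 hne (hh'.2.trans hh.2.symm)
        rw [hs, Finset.sum_singleton, Finset.card_singleton, gain, (Finset.mem_filter.1 hh).2]
  rw [potential, potential, ← Finset.sum_sub_distrib, Finset.sum_congr rfl fun u _ => hvertex u,
    Finset.sum_add_distrib, Finset.sum_ite_eq', if_pos (Finset.mem_univ _), Finset.sum_comm]
  congr 1
  exact Finset.sum_congr rfl fun h _ => by rw [Finset.sum_ite_eq, if_pos (Finset.mem_univ _)]

end Degrees

/-! ### The drift of one step for an exchangeable pairing -/

section Drift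

variable {H V : Type*} [DecidableEq V]

/-- The other half-edges at the vertex of `h₀`. -/
def siblings [DecidableEq H] (π : H → V) (A : Finset H) (h₀ : H) : Finset H :=
  (fiber π A (π h₀)).erase h₀

/-- First-order approximation of the change of the potential when a leaf is paired with `h₀`:
the vertex of `h₀` and the leaf disappear, and every other neighbour loses one half-edge. -/
noncomputable def linearChange [DecidableEq H] (π : H → V) (c : ℕ → ℝ) (A : Finset H)
    (σ : PairingOn H) (h₀ : H) : ℝ :=
  -c (deg π A (π h₀)) - c 1 + ∑ h ∈ siblings π A h₀, gain π c A (σ.1 h)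

/-- The number of loops and of pairs of parallel edges at the vertex of `h₀`, each counted once for
every half-edge that witnesses it. -/
noncomputable def defects [DecidableEq H] (π : H → V) (A : Finset H) (σ : PairingOn H)
    (h₀ : H) : ℝ :=
  ∑ h ∈ siblings π A h₀, ((if π (σ.1 h) = π h₀ then 1 else 0) +
    ∑ h' ∈ (siblings π A h₀).erase h, if σ.1 h ≠ h' ∧ π (σ.1 h') = π (σ.1 h) then 1 else 0)

/-- The mean of `linearChange` when the partners of the siblings of `h₀` are uniform on `A`. -/
noncomputable def meanChange (π : H → V) (c : ℕ → ℝ) (A : Finset H) (h₀ : H) : ℝ :=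
  -c (deg π A (π h₀)) - c 1 + ((deg π A (π h₀) : ℝ) - 1) * 𝔼 m ∈ A, gain π c A m

/-- The asymptotic drift of the potential in a step: the mean of `meanChange` when the partner of
the leaf is uniform on `A`. -/
noncomputable def meanDrift (π : H → V) (c : ℕ → ℝ) (A : Finset H) : ℝ :=
  𝔼 h ∈ A, meanChange π c A h

variable {π : H → V} {σ : PairingOn H} {A T : Finset H} {g h h' h₀ : H} {c : ℕ → ℝ} {D : ℕ} {M : ℝ}
  {W : PairingOn H → ℝ}

lemma abs_meanChange_le [Fintype H] (hπ : ∀ v, deg π Finset.univ v ≤ D)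
    (hc : ∀ k, c k ∈ Set.Icc 0 M) (hh₀ : h₀ ∈ A) : |meanChange π c A h₀| ≤ (D + 2) * M := by
  have hM : 0 ≤ M := (hc 0).1.trans (hc 0).2
  have hpos : 0 < deg π A (π h₀) := Finset.card_pos.2 ⟨h₀, (mem_fiber (π := π)).2 ⟨hh₀, rfl⟩⟩
  have hdeg_pos : (1 : ℝ) ≤ deg π A (π h₀) := by exact_mod_cast hpos
  have hdeg_le : (deg π A (π h₀) : ℝ) ≤ D := by exact_mod_cast deg_le hπ A _
  have hmul : |((deg π A (π h₀) : ℝ) - 1) * 𝔼 m ∈ A, gain π c A m| ≤ D * M := by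
    rw [abs_mul, abs_of_nonneg (sub_nonneg.2 hdeg_pos)]
    gcongr
    · linarith
    · exact abs_expect_le hM fun m _ => abs_gain_le hc A m
  have h₁ := hc 1
  have hdeg := hc (deg π A (π h₀))
  rw [meanChange, abs_le]
  constructor <;> linarith [(abs_le.1 hmul).1, (abs_le.1 hmul).2, h₁.1, h₁.2, hdeg.1, hdeg.2]

variable [DecidableEq H]

lemma mem_siblings : h ∈ siblings π A h₀ ↔ h ≠ h₀ ∧ h ∈ A ∧ π h = π h₀ := by
  simp [siblings, mem_fiber]

lemma card_siblings (hh : h₀ ∈ A) : ((siblings π A h₀).card : ℝ) = (deg π A (π h₀) : ℝ) - 1 := by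
  rw [eq_sub_iff_add_eq, siblings, deg]
  exact_mod_cast Finset.card_erase_add_one (mem_fiber (π := π).2 ⟨hh, rfl⟩)

lemma card_siblings_le [Fintype H] (hπ : ∀ v, deg π Finset.univ v ≤ D) (A : Finset H) (h₀ : H) :
    (siblings π A h₀).card ≤ D :=
  Finset.card_erase_le.trans (deg_le hπ A _)

lemma ne_of_mem_siblings (hg : g ∈ A) (hg₁ : deg π A (π g) = 1) (hh₀ : h₀ ∈ A.erase g)
    (hh : h ∈ siblings π A h₀) : h ≠ g := by
  rintro rfl
  exact Finset.ne_of_mem_erase hh₀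
    (eq_of_deg_eq_one hg hg₁ (Finset.mem_of_mem_erase hh₀) (mem_siblings.1 hh).2.2.symm)

lemma one_le_defects_of_loop (hh : h ∈ siblings π A h₀) (hloop : π (σ.1 h) = π h₀) :
    1 ≤ defects π A σ h₀ := by
  refine le_trans ?_ (Finset.single_le_sum (fun _ _ => by positivity) hh)
  rw [if_pos hloop]
  exact le_add_of_nonneg_right (by positivity)

lemma one_le_defects_of_parallel (hh : h ∈ siblings π A h₀) (hh' : h' ∈ (siblings π A h₀).erase h)
    (hne : σ.1 h ≠ h') (hpar : π (σ.1 h') = π (σ.1 h)) : 1 ≤ defects π A σ h₀ := by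
  refine le_trans ?_ (Finset.single_le_sum (fun _ _ => by positivity) hh)
  refine le_trans ?_ (le_add_of_nonneg_left (by positivity))
  refine le_trans ?_ (Finset.single_le_sum (fun _ _ => by positivity) hh')
  rw [if_pos ⟨hne, hpar⟩]

lemma potential_removeSet_sub_eq_linearChange [Fintype V] (hA : ∀ h ∈ A, σ.1 h ∈ A) (hg : g ∈ A)
    (hg₁ : deg π A (π g) = 1) (hc₀ : c 0 = 0) (hdef : defects π A σ (σ.1 g) < 1) :
    potential π c (removeSet π σ A g) - potential π c A = linearChange π c A σ (σ.1 g) := by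
  have hself : σ.1 g ∈ fiber π A (π (σ.1 g)) := mem_fiber.2 ⟨hA g hg, rfl⟩
  have hleaf : ∀ h ∈ A, π (σ.1 h) = π g → h = σ.1 g := fun h hh e => by
    rw [← eq_of_deg_eq_one hg hg₁ (hA h hh) e, σ.2.1]
  have hloop : ∀ h ∈ fiber π A (π (σ.1 g)), π (σ.1 h) ≠ π (σ.1 g) := by
    intro h hh e
    by_cases hne : h = σ.1 g
    · rw [hne, σ.2.1] at e
      exact σ.2.2 g (eq_of_deg_eq_one hg hg₁ (hA g hg) e.symm)
    · exact hdef.not_ge (one_le_defects_of_loop (Finset.mem_erase.2 ⟨hne, hh⟩) e)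
  have hmult : ∀ h ∈ fiber π A (π (σ.1 g)), ∀ h' ∈ fiber π A (π (σ.1 g)), h ≠ h' →
      π (σ.1 h) ≠ π (σ.1 h') := by
    intro h hh h' hh' hne e
    by_cases hhg : h = σ.1 g
    · refine hne (hhg.trans (hleaf h' (mem_fiber.1 hh').1 ?_).symm)
      rw [← e, hhg, σ.2.1]
    by_cases hhg' : h' = σ.1 g
    · refine hne ((hleaf h (mem_fiber.1 hh).1 ?_).trans hhg'.symm)
      rw [e, hhg', σ.2.1]
    · refine hdef.not_ge (one_le_defects_of_parallel (Finset.mem_erase.2 ⟨hhg, hh⟩)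
        (Finset.mem_erase.2 ⟨hne.symm, Finset.mem_erase.2 ⟨hhg', hh'⟩⟩) (fun e' => ?_) e.symm)
      exact hloop h hh (by rw [e']; exact (mem_fiber.1 hh').2)
  have hgain : gain π c A g = -c 1 := by simp [gain, hg₁, hc₀]
  rw [potential_removeSet_sub hA hc₀ hloop hmult, linearChange, siblings,
    Finset.sum_erase_eq_sub hself, σ.2.1, hgain]
  ring

lemma mem_sdiff_of_restrictWeight_ne_zero (hsupp : ∀ σ, W σ ≠ 0 → ∀ h ∈ A, σ.1 h ∈ A)
    (hhg : h ≠ g) (hhh₀ : h ≠ h₀) (hh : h ∈ A) (hσ : restrictWeight W g h₀ σ ≠ 0) :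
    σ.1 h ∈ A \ {g, h₀, h} := by
  obtain ⟨hgh₀, hWσ⟩ := restrictWeight_ne_zero hσ
  have hinv := σ.2.1 h
  simp only [Finset.mem_sdiff, Finset.mem_insert, Finset.mem_singleton, not_or]
  refine ⟨hsupp σ hWσ h hh, fun e => ?_, fun e => ?_, σ.2.2 h⟩
  · exact hhh₀ (by rw [← hinv, e, hgh₀])
  · exact hhg (by rw [← hinv, e, ← hgh₀, σ.2.1])

lemma card_le_two_mul_card_sdiff (hT : 2 * T.card ≤ A.card) : A.card ≤ 2 * (A \ T).card := by
  have := Finset.le_card_sdiff T A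
  omega

/-- A nonnegative, exchangeable weight on the pairings that match the elements of `A` with each
other. Conditionally on the past of the exploration, `A` being the set of unmatched half-edges, the
law of the pairing is of this kind. -/
structure IsExchangeableOn (A : Finset H) (W : PairingOn H → ℝ) : Prop where
  nonneg : ∀ σ, 0 ≤ W σ
  swapInvariant : SwapInvariant A W
  apply_mem : ∀ σ, W σ ≠ 0 → ∀ h ∈ A, σ.1 h ∈ A

lemma IsExchangeableOn.apply_mem_erase (hW : IsExchangeableOn A W) (hg : g ∈ A) (hσ : W σ ≠ 0) :
    σ.1 g ∈ A.erase g :=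
  Finset.mem_erase.2 ⟨σ.2.2 g, hW.apply_mem σ hσ g hg⟩

variable [Fintype H]

lemma abs_sum_siblings_le (hπ : ∀ v, deg π Finset.univ v ≤ D) {f : H → ℝ} {b : ℝ} (hb : 0 ≤ b)
    (hf : ∀ h ∈ siblings π A h₀, |f h| ≤ b) : |∑ h ∈ siblings π A h₀, f h| ≤ D * b :=
  calc |∑ h ∈ siblings π A h₀, f h| ≤ ∑ h ∈ siblings π A h₀, |f h| := Finset.abs_sum_le_sum_abs _ _
    _ ≤ (siblings π A h₀).card * b := by
      rw [← nsmul_eq_mul]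
      exact Finset.sum_le_card_nsmul _ _ _ hf
    _ ≤ D * b := by
      gcongr
      exact card_siblings_le hπ A h₀

lemma abs_linearChange_le (hπ : ∀ v, deg π Finset.univ v ≤ D) (hc : ∀ k, c k ∈ Set.Icc 0 M)
    (A : Finset H) (σ : PairingOn H) (h₀ : H) : |linearChange π c A σ h₀| ≤ (D + 2) * M := by
  have hsum := abs_le.1 (abs_sum_siblings_le hπ ((hc 0).1.trans (hc 0).2)
    fun h (_ : h ∈ siblings π A h₀) => abs_gain_le (π := π) hc A (σ.1 h))
  have h₁ := hc 1
  have hdeg := hc (deg π A (π h₀))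
  rw [linearChange, abs_le]
  constructor <;> linarith [hsum.1, hsum.2, h₁.1, h₁.2, hdeg.1, hdeg.2]

lemma abs_potential_change_sub_linearChange_le [Fintype V] (hπ : ∀ v, deg π Finset.univ v ≤ D)
    (hA : ∀ h ∈ A, σ.1 h ∈ A) (hg : g ∈ A) (hg₁ : deg π A (π g) = 1) (hc₀ : c 0 = 0)
    (hc : ∀ k, c k ∈ Set.Icc 0 M) :
    |potential π c (removeSet π σ A g) - potential π c A - linearChange π c A σ (σ.1 g)| ≤
      (3 * D + 2) * M * defects π A σ (σ.1 g) := by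
  have hM : 0 ≤ M := (hc 0).1.trans (hc 0).2
  rcases lt_or_ge (defects π A σ (σ.1 g)) 1 with hdef | hdef
  · rw [potential_removeSet_sub_eq_linearChange hA hg hg₁ hc₀ hdef, sub_self, abs_zero]
    unfold defects
    positivity
  · calc |potential π c (removeSet π σ A g) - potential π c A - linearChange π c A σ (σ.1 g)|
        ≤ 2 * D * M + (D + 2) * M := (abs_sub _ _).trans
          (add_le_add (abs_potential_removeSet_sub_le hπ hc σ A g)
            (abs_linearChange_le hπ hc A σ _))
      _ = (3 * D + 2) * M := by ring
      _ ≤ (3 * D + 2) * M * defects π A σ (σ.1 g) :=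
        le_mul_of_one_le_right (by positivity) hdef

lemma sum_mul_indicator_le (hπ : ∀ v, deg π Finset.univ v ≤ D) (hW₀ : ∀ σ, 0 ≤ W σ)
    (hW : SwapInvariant (A \ T) W) (hh : h ∈ T) (hsupp : ∀ σ, W σ ≠ 0 → σ.1 h ∈ A \ T)
    (hT : 2 * T.card ≤ A.card) (v : V) :
    ∑ σ, W σ * (if π (σ.1 h) = v then 1 else 0) ≤ 2 * D / A.card * ∑ σ, W σ := by
  rw [hW.sum_mul_indicator (by simp [hh]) hsupp fun m => π m = v]
  refine mul_le_mul_of_nonneg_right ?_ (Finset.sum_nonneg fun σ _ => hW₀ σ)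
  rcases (A \ T).eq_empty_or_nonempty with hempty | hne
  · simp only [hempty, Finset.filter_empty, Finset.card_empty, Nat.cast_zero, zero_div]
    positivity
  · have hcard := card_le_two_mul_card_sdiff hT
    have hdeg : (deg π (A \ T) v : ℝ) ≤ D := by exact_mod_cast deg_le hπ (A \ T) v
    have hB : (0 : ℝ) < (A \ T).card := by exact_mod_cast hne.card_pos
    have hA : (0 : ℝ) < A.card := by
      exact_mod_cast (hne.mono Finset.sdiff_subset).card_pos
    rw [div_le_div_iff₀ hB hA]
    calc (deg π (A \ T) v : ℝ) * A.card ≤ D * (2 * (A \ T).card) := by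
          gcongr
          exact_mod_cast hcard
      _ = 2 * D * (A \ T).card := by ring

lemma IsExchangeableOn.sum_restrictWeight_loop_le (hW : IsExchangeableOn A W)
    (hπ : ∀ v, deg π Finset.univ v ≤ D) (hg : g ∈ A) (hg₁ : deg π A (π g) = 1)
    (hh₀ : h₀ ∈ A.erase g) (hA : 10 ≤ A.card) (hh : h ∈ siblings π A h₀) :
    ∑ σ, restrictWeight W g h₀ σ * (if π (σ.1 h) = π h₀ then 1 else 0) ≤
      2 * D / A.card * ∑ σ, restrictWeight W g h₀ σ := by
  have hcard : ({g, h₀, h} : Finset H).card ≤ 3 := Finset.card_le_three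
  refine sum_mul_indicator_le (T := {g, h₀, h}) hπ (restrictWeight_nonneg hW.nonneg g h₀)
    ((hW.swapInvariant.mono Finset.sdiff_subset).restrictWeight (by simp) (by simp)) (by simp)
    (fun σ hσ => ?_) (by omega) _
  exact mem_sdiff_of_restrictWeight_ne_zero hW.apply_mem (ne_of_mem_siblings hg hg₁ hh₀ hh)
    (mem_siblings.1 hh).1 (mem_siblings.1 hh).2.1 hσ

/-- Reveal the partner `m` of `h` first: the partner of `h'` is then uniform on what is left. -/
lemma IsExchangeableOn.sum_restrictWeight_parallel_le (hW : IsExchangeableOn A W)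
    (hπ : ∀ v, deg π Finset.univ v ≤ D) (hg : g ∈ A) (hg₁ : deg π A (π g) = 1)
    (hh₀ : h₀ ∈ A.erase g) (hA : 10 ≤ A.card) (hh : h ∈ siblings π A h₀)
    (hh' : h' ∈ (siblings π A h₀).erase h) :
    ∑ σ, restrictWeight W g h₀ σ * (if σ.1 h ≠ h' ∧ π (σ.1 h') = π (σ.1 h) then 1 else 0) ≤
      2 * D / A.card * ∑ σ, restrictWeight W g h₀ σ := by
  set W₀ := restrictWeight W g h₀
  have hW₀ : ∀ σ, 0 ≤ W₀ σ := restrictWeight_nonneg hW.nonneg g h₀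
  have hsupp : ∀ x ∈ siblings π A h₀, ∀ σ, W₀ σ ≠ 0 → σ.1 x ∈ A \ {g, h₀, x} := fun x hx σ hσ =>
    mem_sdiff_of_restrictWeight_ne_zero hW.apply_mem (ne_of_mem_siblings hg hg₁ hh₀ hx)
      (mem_siblings.1 hx).1 (mem_siblings.1 hx).2.1 hσ
  rw [sum_mul_eq_sum_restrictWeight_mul (hsupp h hh) fun σ m =>
      if m ≠ h' ∧ π (σ.1 h') = π m then 1 else 0,
    sum_eq_sum_restrictWeight (hsupp h hh), Finset.mul_sum]
  refine Finset.sum_le_sum fun m _ => ?_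
  have hm₀ : ∀ σ, 0 ≤ restrictWeight W₀ h m σ := restrictWeight_nonneg hW₀ h m
  by_cases hmh : m = h'
  · simp only [hmh, ne_eq, not_true_eq_false, false_and, if_false, mul_zero, Finset.sum_const_zero]
    exact mul_nonneg (by positivity) (Finset.sum_nonneg fun σ _ => hmh ▸ hm₀ σ)
  · simp only [ne_eq, hmh, not_false_eq_true, true_and]
    have hcard : ({g, h₀, h, m, h'} : Finset H).card ≤ 5 := Finset.card_le_five
    refine sum_mul_indicator_le (T := {g, h₀, h, m, h'}) hπ hm₀
      (((hW.swapInvariant.mono Finset.sdiff_subset).restrictWeight (by simp) (by simp)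
        ).restrictWeight (by simp) (by simp)) (by simp) (fun σ hσ => ?_) (by omega) _
    obtain ⟨hhm, hσ₀⟩ := restrictWeight_ne_zero hσ
    have hmem := hsupp h' (Finset.mem_of_mem_erase hh') σ hσ₀
    simp only [Finset.mem_sdiff, Finset.mem_insert, Finset.mem_singleton, not_or] at hmem ⊢
    refine ⟨hmem.1, hmem.2.1, hmem.2.2.1, fun e => hmh ?_, fun e => ?_, hmem.2.2.2⟩
    · rw [← hhm, ← e, σ.2.1]
    · exact Finset.ne_of_mem_erase hh' (σ.1.injective (e.trans hhm.symm))

lemma sum_mul_defects (W : PairingOn H → ℝ) (A : Finset H) (h₀ : H) :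
    ∑ σ, W σ * defects π A σ h₀ =
      ∑ h ∈ siblings π A h₀, (∑ σ, W σ * (if π (σ.1 h) = π h₀ then 1 else 0) +
        ∑ h' ∈ (siblings π A h₀).erase h,
          ∑ σ, W σ * (if σ.1 h ≠ h' ∧ π (σ.1 h') = π (σ.1 h) then 1 else 0)) := by
  simp only [defects, Finset.mul_sum, mul_add]
  rw [Finset.sum_comm]
  refine Finset.sum_congr rfl fun h _ => ?_
  rw [Finset.sum_add_distrib, Finset.sum_comm (s := Finset.univ)]

lemma IsExchangeableOn.sum_restrictWeight_defects_le (hW : IsExchangeableOn A W)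
    (hπ : ∀ v, deg π Finset.univ v ≤ D) (hg : g ∈ A) (hg₁ : deg π A (π g) = 1)
    (hh₀ : h₀ ∈ A.erase g) (hA : 10 ≤ A.card) :
    ∑ σ, restrictWeight W g h₀ σ * defects π A σ h₀ ≤
      2 * D ^ 2 * (D + 1) / A.card * ∑ σ, restrictWeight W g h₀ σ := by
  set b := 2 * (D : ℝ) / A.card * ∑ σ, restrictWeight W g h₀ σ with hb
  have hb₀ : 0 ≤ b := mul_nonneg (by positivity)
    (Finset.sum_nonneg fun σ _ => restrictWeight_nonneg hW.nonneg g h₀ σ)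
  have hcard : ((siblings π A h₀).card : ℝ) ≤ D := by exact_mod_cast card_siblings_le hπ A h₀
  have hparallel : ∀ h ∈ siblings π A h₀, ∑ h' ∈ (siblings π A h₀).erase h,
      ∑ σ, restrictWeight W g h₀ σ *
        (if σ.1 h ≠ h' ∧ π (σ.1 h') = π (σ.1 h) then 1 else 0) ≤ D * b := by
    intro h hh
    refine (Finset.sum_le_card_nsmul _ _ b fun h' hh' =>
      hW.sum_restrictWeight_parallel_le hπ hg hg₁ hh₀ hA hh hh').trans ?_
    rw [nsmul_eq_mul]
    gcongr
    exact_mod_cast Finset.card_erase_le.trans (card_siblings_le hπ A h₀)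
  rw [sum_mul_defects]
  calc _ ≤ (siblings π A h₀).card • (b + D * b) := Finset.sum_le_card_nsmul _ _ _ fun h hh =>
        add_le_add (hW.sum_restrictWeight_loop_le hπ hg hg₁ hh₀ hA hh) (hparallel h hh)
    _ ≤ D * (b + D * b) := by
      rw [nsmul_eq_mul]
      gcongr
    _ = _ := by rw [hb]; ring

lemma IsExchangeableOn.abs_sum_restrictWeight_linearChange_sub_le (hW : IsExchangeableOn A W)
    (hπ : ∀ v, deg π Finset.univ v ≤ D) (hg : g ∈ A) (hg₁ : deg π A (π g) = 1)
    (hh₀ : h₀ ∈ A.erase g) (hA : 10 ≤ A.card) (hc : ∀ k, c k ∈ Set.Icc 0 M) :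
    |∑ σ, restrictWeight W g h₀ σ * (linearChange π c A σ h₀ - meanChange π c A h₀)| ≤
      6 * D * M / A.card * ∑ σ, restrictWeight W g h₀ σ := by
  have hM : 0 ≤ M := (hc 0).1.trans (hc 0).2
  set W₀ := restrictWeight W g h₀
  have hW₀ : 0 ≤ ∑ σ, W₀ σ := Finset.sum_nonneg fun σ _ => restrictWeight_nonneg hW.nonneg g h₀ σ
  have hpartner : ∀ h ∈ siblings π A h₀, ∑ σ, W₀ σ * gain π c A (σ.1 h) =
      (∑ σ, W₀ σ) * 𝔼 m ∈ A \ {g, h₀, h}, gain π c A m := fun h hh =>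
    ((hW.swapInvariant.mono Finset.sdiff_subset).restrictWeight (by simp) (by simp)).sum_mul_apply
      (by simp) (fun σ hσ => mem_sdiff_of_restrictWeight_ne_zero hW.apply_mem
        (ne_of_mem_siblings hg hg₁ hh₀ hh) (mem_siblings.1 hh).1 (mem_siblings.1 hh).2.1 hσ) _
  have hexpand : ∑ σ, W₀ σ * (linearChange π c A σ h₀ - meanChange π c A h₀) =
      (∑ σ, W₀ σ) * ∑ h ∈ siblings π A h₀,
        (𝔼 m ∈ A \ {g, h₀, h}, gain π c A m - 𝔼 m ∈ A, gain π c A m) := by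
    simp only [linearChange, meanChange, add_sub_add_left_eq_sub, mul_sub, Finset.sum_sub_distrib,
      Finset.mul_sum]
    rw [Finset.sum_comm (s := Finset.univ), Finset.sum_congr rfl hpartner, ← Finset.sum_mul,
      ← card_siblings (Finset.mem_of_mem_erase hh₀), Finset.sum_const, nsmul_eq_mul]
    ring
  have hexclude : ∀ h ∈ siblings π A h₀,
      |𝔼 m ∈ A \ {g, h₀, h}, gain π c A m - 𝔼 m ∈ A, gain π c A m| ≤ 6 * M / A.card := by
    intro h _
    have hT : ({g, h₀, h} : Finset H).card ≤ 3 := Finset.card_le_three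
    have hcard := card_le_two_mul_card_sdiff (A := A) (T := {g, h₀, h}) (by omega)
    refine (abs_expect_sub_expect_le Finset.sdiff_subset (Finset.card_pos.1 (by omega)) hM
      fun m _ => abs_gain_le hc A m).trans ?_
    rw [show 6 * M = 2 * M * 3 by ring]
    gcongr
    rw [sdiff_sdiff_right_self]
    exact_mod_cast (Finset.card_le_card Finset.inter_subset_right).trans hT
  rw [hexpand, abs_mul, abs_of_nonneg hW₀, mul_comm]
  gcongr
  exact (abs_sum_siblings_le hπ (by positivity) hexclude).trans_eq (by ring)

lemma IsExchangeableOn.abs_sum_potential_change_sub_linearChange_le [Fintype V]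
    (hW : IsExchangeableOn A W) (hπ : ∀ v, deg π Finset.univ v ≤ D) (hg : g ∈ A)
    (hg₁ : deg π A (π g) = 1) (hA : 10 ≤ A.card) (hc₀ : c 0 = 0) (hc : ∀ k, c k ∈ Set.Icc 0 M) :
    |∑ σ, W σ * (potential π c (removeSet π σ A g) - potential π c A -
        linearChange π c A σ (σ.1 g))| ≤
      (3 * D + 2) * M * (2 * D ^ 2 * (D + 1)) / A.card * ∑ σ, W σ := by
  have hM : 0 ≤ M := (hc 0).1.trans (hc 0).2
  have hpartner : ∀ σ, W σ ≠ 0 → σ.1 g ∈ A.erase g := fun _ => hW.apply_mem_erase hg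
  calc _ ≤ ∑ σ, |W σ * (potential π c (removeSet π σ A g) - potential π c A -
        linearChange π c A σ (σ.1 g))| := Finset.abs_sum_le_sum_abs _ _
    _ ≤ ∑ σ, (3 * D + 2) * M * (W σ * defects π A σ (σ.1 g)) := by
      refine Finset.sum_le_sum fun σ _ => ?_
      rw [abs_mul, abs_of_nonneg (hW.nonneg σ), mul_left_comm]
      by_cases hσ : W σ = 0
      · simp [hσ]
      · exact mul_le_mul_of_nonneg_left (abs_potential_change_sub_linearChange_le hπ
          (hW.apply_mem σ hσ) hg hg₁ hc₀ hc) (hW.nonneg σ)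
    _ = (3 * D + 2) * M *
        ∑ h ∈ A.erase g, ∑ σ, restrictWeight W g h σ * defects π A σ h := by
      rw [← Finset.mul_sum, sum_mul_eq_sum_restrictWeight_mul hpartner fun σ h => defects π A σ h]
    _ ≤ (3 * D + 2) * M *
        ∑ h ∈ A.erase g, 2 * D ^ 2 * (D + 1) / A.card * ∑ σ, restrictWeight W g h σ := by
      gcongr with h hh
      exact hW.sum_restrictWeight_defects_le hπ hg hg₁ hh hA
    _ = _ := by
      rw [← Finset.mul_sum, ← sum_eq_sum_restrictWeight hpartner]
      ring

lemma IsExchangeableOn.abs_sum_linearChange_sub_meanChange_le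
    (hW : IsExchangeableOn A W) (hπ : ∀ v, deg π Finset.univ v ≤ D) (hg : g ∈ A)
    (hg₁ : deg π A (π g) = 1) (hA : 10 ≤ A.card) (hc : ∀ k, c k ∈ Set.Icc 0 M) :
    |∑ σ, W σ * (linearChange π c A σ (σ.1 g) - meanChange π c A (σ.1 g))| ≤
      6 * D * M / A.card * ∑ σ, W σ := by
  have hpartner : ∀ σ, W σ ≠ 0 → σ.1 g ∈ A.erase g := fun _ => hW.apply_mem_erase hg
  rw [sum_mul_eq_sum_restrictWeight_mul hpartner fun σ h =>
    linearChange π c A σ h - meanChange π c A h, sum_eq_sum_restrictWeight hpartner, Finset.mul_sum]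
  exact (Finset.abs_sum_le_sum_abs _ _).trans (Finset.sum_le_sum fun h hh =>
    hW.abs_sum_restrictWeight_linearChange_sub_le hπ hg hg₁ hh hA hc)

lemma IsExchangeableOn.abs_sum_meanChange_sub_meanDrift_le
    (hW : IsExchangeableOn A W) (hπ : ∀ v, deg π Finset.univ v ≤ D) (hg : g ∈ A) (hA : 2 ≤ A.card)
    (hc : ∀ k, c k ∈ Set.Icc 0 M) :
    |∑ σ, W σ * (meanChange π c A (σ.1 g) - meanDrift π c A)| ≤
      2 * ((D + 2) * M) / A.card * ∑ σ, W σ := by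
  have hM : 0 ≤ M := (hc 0).1.trans (hc 0).2
  have hW₀ : 0 ≤ ∑ σ, W σ := Finset.sum_nonneg fun σ _ => hW.nonneg σ
  have hcard := Finset.card_erase_add_one hg
  simp only [mul_sub, Finset.sum_sub_distrib]
  rw [(hW.swapInvariant.mono (Finset.erase_subset _ _)).sum_mul_apply (Finset.notMem_erase g A)
      (fun _ => hW.apply_mem_erase hg) (meanChange π c A),
    ← Finset.sum_mul, ← mul_sub, abs_mul, abs_of_nonneg hW₀, mul_comm]
  refine mul_le_mul_of_nonneg_right ?_ hW₀
  refine (abs_expect_sub_expect_le (Finset.erase_subset _ _) (Finset.card_pos.1 (by omega))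
    (by positivity) fun m hm => abs_meanChange_le hπ hc hm).trans_eq ?_
  rw [Finset.sdiff_erase_self hg, Finset.card_singleton, Nat.cast_one, mul_one]

lemma IsExchangeableOn.abs_sum_potential_change_sub_meanDrift_le [Fintype V]
    (hW : IsExchangeableOn A W) (hπ : ∀ v, deg π Finset.univ v ≤ D) (hg : g ∈ A)
    (hg₁ : deg π A (π g) = 1) (hA : 10 ≤ A.card) (hc₀ : c 0 = 0) (hc : ∀ k, c k ∈ Set.Icc 0 M) :
    |∑ σ, W σ * (potential π c (removeSet π σ A g) - potential π c A - meanDrift π c A)| ≤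
      (2 * D ^ 2 * (D + 1) * (3 * D + 2) + 8 * D + 4) * M / A.card * ∑ σ, W σ := by
  have hsplit : ∑ σ, W σ * (potential π c (removeSet π σ A g) - potential π c A -
      meanDrift π c A) =
      ∑ σ, W σ * (potential π c (removeSet π σ A g) - potential π c A -
        linearChange π c A σ (σ.1 g)) +
      ∑ σ, W σ * (linearChange π c A σ (σ.1 g) - meanChange π c A (σ.1 g)) +
      ∑ σ, W σ * (meanChange π c A (σ.1 g) - meanDrift π c A) := by
    rw [← Finset.sum_add_distrib, ← Finset.sum_add_distrib]
    exact Finset.sum_congr rfl fun σ _ => by ring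
  rw [hsplit]
  refine (abs_add_three _ _ _).trans ((add_le_add (add_le_add
    (hW.abs_sum_potential_change_sub_linearChange_le hπ hg hg₁ hA hc₀ hc)
    (hW.abs_sum_linearChange_sub_meanChange_le hπ hg hg₁ hA hc))
    (hW.abs_sum_meanChange_sub_meanDrift_le hπ hg (by omega) hc)).trans_eq ?_)
  ring

end Drift

/-! ### Counts of half-edges as potentials -/

section Counts

variable {d : DegreeSequence}

/-- The vertex of a half-edge. -/
abbrev vertexOf (h : HalfEdge d) : Vertex d := h.1

/-- The elements of `A` attached to a vertex of degree `i`, that is, `State.legs` as a function of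
the set of unmatched half-edges. -/
def legsOf (A : Finset (HalfEdge d)) (i : ℕ) : Finset (HalfEdge d) :=
  A.filter fun h => deg vertexOf A (vertexOf h) = i

/-- The function of the degree whose potential counts the half-edges at vertices of degree `i`. -/
noncomputable def legWeight (i k : ℕ) : ℝ := if k = i then i else 0

/-- The proportion of the elements of `A` that are attached to a vertex of degree `i`. -/
noncomputable def legFraction (A : Finset (HalfEdge d)) (i : ℕ) : ℝ := (legsOf A i).card / A.card

/-- `State.rescaled` as a function of the set of unmatched half-edges. -/
noncomputable def rescaledOf (A : Finset (HalfEdge d)) : ℝ × ℝ × ℝ :=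
  ((legsOf A 1).card / (d.size : ℝ), (legsOf A 2).card / (d.size : ℝ),
    (legsOf A 3).card / (d.size : ℝ))

variable {A : Finset (HalfEdge d)}

lemma deg_univ (v : Vertex d) :
    deg vertexOf (Finset.univ : Finset (HalfEdge d)) v = Vertex.degree v := by
  have hslots : fiber vertexOf (Finset.univ : Finset (HalfEdge d)) v =
      Finset.univ.image fun i : Fin (Vertex.degree v) => (⟨v, i⟩ : HalfEdge d) := by
    ext ⟨w, i⟩
    simp only [mem_fiber, Finset.mem_univ, true_and, Finset.mem_image]
    constructor
    · rintro rfl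
      exact ⟨i, rfl⟩
    · rintro ⟨j, hj⟩
      exact (congrArg Sigma.fst hj).symm
  rw [deg, hslots, Finset.card_image_of_injective _ sigma_mk_injective, Finset.card_univ,
    Fintype.card_fin]

lemma deg_vertexOf_le (v : Vertex d) : deg vertexOf (Finset.univ : Finset (HalfEdge d)) v ≤ 3 := by
  rw [deg_univ]
  rcases v with _ | _ | _ <;> simp [Vertex.degree]

lemma card_halfEdge (d : DegreeSequence) : Fintype.card (HalfEdge d) = d.size := by
  rw [Fintype.card_sigma]
  simp only [Fintype.card_fin]
  simp only [Fintype.sum_sum_type, Vertex.degree, Finset.sum_const, Finset.card_univ,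
    Fintype.card_fin, smul_eq_mul, DegreeSequence.size]
  ring

lemma legs_eq_legsOf (s : State d) (i : ℕ) : State.legs s i = legsOf s.2 i := rfl

lemma remove_eq (s : State d) (g : HalfEdge d) :
    State.remove s g = (s.1, removeSet vertexOf s.1 s.2 g) := rfl

lemma legWeight_zero (i : ℕ) : legWeight i 0 = 0 := by
  rcases eq_or_ne 0 i with rfl | hi
  · simp [legWeight]
  · exact if_neg hi

lemma legWeight_mem_Icc {i : ℕ} (hi : i ≤ 3) (k : ℕ) : legWeight i k ∈ Set.Icc (0 : ℝ) 3 := by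
  unfold legWeight
  split_ifs
  · exact ⟨by positivity, by exact_mod_cast hi⟩
  · norm_num

lemma card_legsOf (A : Finset (HalfEdge d)) (i : ℕ) :
    ((legsOf A i).card : ℝ) = potential vertexOf (legWeight i) A := by
  have hcard : (legsOf A i).card = ∑ v, (fiber vertexOf (legsOf A i) v).card :=
    Finset.card_eq_sum_card_fiberwise fun x _ => Finset.mem_coe.2 (Finset.mem_univ (vertexOf x))
  rw [hcard, potential, Nat.cast_sum]
  refine Finset.sum_congr rfl fun v _ => ?_
  unfold legWeight
  split_ifs with hv
  · have hfiber : fiber vertexOf (legsOf A i) v = fiber vertexOf A v := by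
      ext x
      simp only [mem_fiber, legsOf, Finset.mem_filter]
      exact ⟨fun hx => ⟨hx.1.1, hx.2⟩, fun hx => ⟨⟨hx.1, hx.2 ▸ hv⟩, hx.2⟩⟩
    rw [hfiber]
    exact_mod_cast hv
  · have hfiber : fiber vertexOf (legsOf A i) v = ∅ := by
      ext x
      simp only [mem_fiber, legsOf, Finset.mem_filter, Finset.notMem_empty, iff_false]
      rintro ⟨⟨-, hx⟩, rfl⟩
      exact hv hx
    simp [hfiber]

lemma sum_apply_deg (A : Finset (HalfEdge d)) (f : ℕ → ℝ) :
    ∑ h ∈ A, f (deg vertexOf A (vertexOf h)) =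
      f 1 * (legsOf A 1).card + f 2 * (legsOf A 2).card + f 3 * (legsOf A 3).card := by
  have hmem : ∀ h ∈ A, deg vertexOf A (vertexOf h) ∈ ({1, 2, 3} : Finset ℕ) := fun h hh => by
    have hpos : 0 < deg vertexOf A (vertexOf h) := Finset.card_pos.2 ⟨h, mem_fiber.2 ⟨hh, rfl⟩⟩
    have hle := deg_le deg_vertexOf_le A (vertexOf h)
    simp only [Finset.mem_insert, Finset.mem_singleton]
    omega
  have hfiber : ∀ i, ∑ h ∈ A with deg vertexOf A (vertexOf h) = i,
      f (deg vertexOf A (vertexOf h)) = f i * (legsOf A i).card := fun i => by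
    rw [Finset.sum_congr rfl fun h hh => by rw [(Finset.mem_filter.1 hh).2], Finset.sum_const,
      nsmul_eq_mul, mul_comm]
    rfl
  rw [← Finset.sum_fiberwise_of_maps_to hmem]
  simp [hfiber, add_assoc]

lemma card_eq_sum_legsOf (A : Finset (HalfEdge d)) :
    (A.card : ℝ) = (legsOf A 1).card + (legsOf A 2).card + (legsOf A 3).card := by
  simpa using sum_apply_deg A fun _ => 1

lemma mass_rescaledOf (A : Finset (HalfEdge d)) : mass (rescaledOf A) = A.card / d.size := by
  rw [mass, rescaledOf, card_eq_sum_legsOf A]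
  ring

lemma expect_apply_deg (A : Finset (HalfEdge d)) (f : ℕ → ℝ) :
    𝔼 h ∈ A, f (deg vertexOf A (vertexOf h)) =
      f 1 * legFraction A 1 + f 2 * legFraction A 2 + f 3 * legFraction A 3 := by
  rw [Finset.expect_eq_sum_div_card, sum_apply_deg]
  simp only [legFraction]
  ring

lemma sum_legFraction (hA : A.Nonempty) :
    legFraction A 1 + legFraction A 2 + legFraction A 3 = 1 := by
  simpa [Finset.expect_const hA] using (expect_apply_deg A fun _ => 1).symm

lemma expect_gain (A : Finset (HalfEdge d)) (c : ℕ → ℝ) :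
    𝔼 m ∈ A, gain vertexOf c A m =
      (c 0 - c 1) * legFraction A 1 + (c 1 - c 2) * legFraction A 2 +
        (c 2 - c 3) * legFraction A 3 :=
  expect_apply_deg A fun k => c (k - 1) - c k

lemma meanDrift_eq (hA : A.Nonempty) (c : ℕ → ℝ) :
    meanDrift vertexOf c A =
      -(c 1 * legFraction A 1 + c 2 * legFraction A 2 + c 3 * legFraction A 3) - c 1 +
        (legFraction A 2 + 2 * legFraction A 3) *
          ((c 0 - c 1) * legFraction A 1 + (c 1 - c 2) * legFraction A 2 +
            (c 2 - c 3) * legFraction A 3) := by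
  rw [← expect_gain A c, meanDrift]
  refine (expect_apply_deg A
    fun k => -c k - c 1 + ((k : ℝ) - 1) * 𝔼 m ∈ A, gain vertexOf c A m).trans ?_
  have hsum := sum_legFraction hA
  push_cast
  linear_combination (-c 1) * hsum

lemma phi_rescaledOf_eq_drift (hA : A.Nonempty) :
    phi (rescaledOf A) = drift (legFraction A 1) (legFraction A 2) (legFraction A 3) := by
  have hcard : (A.card : ℝ) ≠ 0 := by exact_mod_cast hA.card_pos.ne'
  have hmass : (rescaledOf A).1 + (rescaledOf A).2.1 + (rescaledOf A).2.2 = A.card / d.size :=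
    mass_rescaledOf A
  have hsize : (d.size : ℝ) ≠ 0 := by
    rw [← card_halfEdge d]
    exact_mod_cast (hA.card_pos.trans_le A.card_le_univ).ne'
  simp only [phi, hmass]
  simp only [rescaledOf, legFraction]
  congr 1 <;> field_simp

lemma phi_rescaledOf (hA : A.Nonempty) :
    phi (rescaledOf A) = (meanDrift vertexOf (legWeight 1) A, meanDrift vertexOf (legWeight 2) A,
      meanDrift vertexOf (legWeight 3) A) := by
  rw [phi_rescaledOf_eq_drift hA, drift_eq_of_sum_eq_one (sum_legFraction hA)]
  simp only [meanDrift_eq hA, legWeight]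
  refine Prod.ext ?_ (Prod.ext ?_ ?_) <;> norm_num only [if_true, if_false] <;> ring

lemma abs_meanDrift_le (A : Finset (HalfEdge d)) {c : ℕ → ℝ} {M : ℝ}
    (hc : ∀ k, c k ∈ Set.Icc 0 M) : |meanDrift vertexOf c A| ≤ 5 * M :=
  abs_expect_le (mul_nonneg (by norm_num) ((hc 0).1.trans (hc 0).2)) fun _ hm =>
    (abs_meanChange_le deg_vertexOf_le hc hm).trans_eq (by norm_num)

end Counts

/-! ### Trajectories of the exploration -/

section Trajectories

variable {d : DegreeSequence} {σ : Pairing d} {A : Finset (HalfEdge d)} {s s' : State d}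

/-- `s'` is a possible successor of the state `s`. -/
def IsStep (s s' : State d) : Prop := stepProb s s' ≠ 0

lemma removeSet_closed (hA : ∀ h ∈ A, σ.1 h ∈ A) (g : HalfEdge d) :
    ∀ h ∈ removeSet vertexOf σ A g, σ.1 h ∈ removeSet vertexOf σ A g := by
  intro h hh
  simp only [removeSet, Finset.mem_filter] at hh ⊢
  exact ⟨hA h hh.1, hh.2.2, by rw [σ.2.1]; exact hh.2.1⟩

lemma IsStep.eq_or_exists (h : IsStep s s') :
    (legsOf s.2 1 = ∅ ∧ s' = s) ∨
      ∃ g ∈ legsOf s.2 1, s' = (s.1, removeSet vertexOf s.1 s.2 g) := by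
  unfold IsStep stepProb at h
  split_ifs at h with hlegs hs'
  · exact Or.inl ⟨hlegs, hs'⟩
  · exact absurd rfl h
  · right
    by_contra! hne
    have hremove : ∀ g ∈ State.legs s 1, State.remove s g ≠ s' := fun g hg e => hne g hg e.symm
    classical
    exact h (by rw [Finset.filter_false_of_mem hremove]; simp)

lemma IsStep.fst_eq (h : IsStep s s') : s'.1 = s.1 := by
  rcases h.eq_or_exists with ⟨-, rfl⟩ | ⟨g, -, rfl⟩ <;> rfl

lemma IsStep.subset (h : IsStep s s') : s'.2 ⊆ s.2 := by
  rcases h.eq_or_exists with ⟨-, rfl⟩ | ⟨g, -, rfl⟩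
  · exact subset_rfl
  · exact Finset.filter_subset _ _

lemma IsStep.closed (h : IsStep s s') (hs : ∀ x ∈ s.2, s.1.1 x ∈ s.2) :
    ∀ x ∈ s'.2, s'.1.1 x ∈ s'.2 := by
  rcases h.eq_or_exists with ⟨-, rfl⟩ | ⟨g, -, rfl⟩
  · exact hs
  · exact removeSet_closed hs g

lemma IsStep.eq_of_legsOf_eq_empty (h : IsStep s s') (hs : legsOf s.2 1 = ∅) : s' = s := by
  rcases h.eq_or_exists with ⟨-, hs'⟩ | ⟨g, hg, -⟩
  · exact hs'
  · exact absurd (hs ▸ hg) (Finset.notMem_empty g)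

/-- The half-edge of the leaf and its partner are both erased. -/
lemma IsStep.card_add_two_le (h : IsStep s s') (hs : ∀ x ∈ s.2, s.1.1 x ∈ s.2)
    (hlegs : legsOf s.2 1 ≠ ∅) : s'.2.card + 2 ≤ s.2.card := by
  obtain ⟨g, hg, rfl⟩ := h.eq_or_exists.resolve_left fun h' => hlegs h'.1
  have hgA : g ∈ s.2 := (Finset.mem_filter.1 hg).1
  have hpair : ({g, s.1.1 g} : Finset (HalfEdge d)) ⊆ s.2 \ removeSet vertexOf s.1 s.2 g := by
    intro x hx
    simp only [Finset.mem_insert, Finset.mem_singleton] at hx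
    rcases hx with rfl | rfl
    · simp [removeSet, hgA]
    · simp [removeSet, hs g hgA]
  have hcard := Finset.card_le_card hpair
  rw [Finset.card_pair (s.1.2.2 g).symm] at hcard
  have hsdiff : (s.2 \ removeSet vertexOf s.1 s.2 g).card +
      (removeSet vertexOf s.1 s.2 g).card = s.2.card :=
    Finset.card_sdiff_add_card_eq_card (Finset.filter_subset _ _)
  change (removeSet vertexOf s.1 s.2 g).card + 2 ≤ s.2.card
  omega

lemma IsStep.abs_potential_sub_le (h : IsStep s s') {c : ℕ → ℝ} {M : ℝ}
    (hc : ∀ k, c k ∈ Set.Icc 0 M) :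
    |potential vertexOf c s'.2 - potential vertexOf c s.2| ≤ 6 * M := by
  have hM : 0 ≤ M := (hc 0).1.trans (hc 0).2
  rcases h.eq_or_exists with ⟨-, rfl⟩ | ⟨g, -, rfl⟩
  · simpa using hM
  · exact (abs_potential_removeSet_sub_le deg_vertexOf_le hc s.1 s.2 g).trans_eq (by norm_num)

/-- Possible trajectories of the exploration. -/
structure IsTrajectory (s : ℕ → State d) : Prop where
  initial : (s 0).2 = Finset.univ
  step : ∀ k, IsStep (s k) (s (k + 1))

namespace IsTrajectory

variable {s : ℕ → State d}

lemma closed (hs : IsTrajectory s) (k : ℕ) : ∀ h ∈ (s k).2, (s k).1.1 h ∈ (s k).2 := by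
  induction k with
  | zero => rw [hs.initial]; exact fun _ _ => Finset.mem_univ _
  | succ k ih => exact (hs.step k).closed ih

lemma fst_eq (hs : IsTrajectory s) (k : ℕ) : (s k).1 = (s 0).1 := by
  induction k with
  | zero => rfl
  | succ k ih => rw [(hs.step k).fst_eq, ih]

lemma antitone (hs : IsTrajectory s) : Antitone fun k => (s k).2 :=
  antitone_nat_of_succ_le fun k => (hs.step k).subset

lemma frozen (hs : IsTrajectory s) {k l : ℕ} (hk : legsOf (s k).2 1 = ∅) (hkl : k ≤ l) :
    s l = s k := by
  induction l, hkl using Nat.le_induction with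
  | base => rfl
  | succ l _ ih =>
    rw [← ih] at hk ⊢
    exact (hs.step l).eq_of_legsOf_eq_empty hk

lemma card_add_le (hs : IsTrajectory s) (k l : ℕ)
    (hlegs : ∀ i, k ≤ i → i < k + l → legsOf (s i).2 1 ≠ ∅) :
    (s (k + l)).2.card + 2 * l ≤ (s k).2.card := by
  induction l with
  | zero => simp
  | succ l ih =>
    have hcard := ih fun i hi hil => hlegs i hi (by omega)
    have hstep := (hs.step (k + l)).card_add_two_le (hs.closed _)
      (hlegs (k + l) (by omega) (by omega))
    rw [← add_assoc]
    omega

end IsTrajectory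

end Trajectories

/-! ### Exchangeability given the past -/

section PathWeight

variable {d : DegreeSequence} {k : ℕ} {σ τ : Pairing d} {A A' : Finset (HalfEdge d)}
  {B : ℕ → Finset (HalfEdge d)} {a b x g : HalfEdge d}

/-- The probability of following the path `B` for `k` steps with the pairing `σ`. -/
noncomputable def pathWeight (k : ℕ) (σ : Pairing d) (B : ℕ → Finset (HalfEdge d)) : ℝ :=
  (initialProb (σ, B 0) * ∏ i ∈ Finset.range k, stepProb (σ, B i) (σ, B (i + 1))).toReal

lemma pathWeight_ne_zero (h : pathWeight k σ B ≠ 0) :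
    B 0 = Finset.univ ∧ ∀ i < k, IsStep (σ, B i) (σ, B (i + 1)) := by
  have hmul : initialProb (σ, B 0) *
      ∏ i ∈ Finset.range k, stepProb (σ, B i) (σ, B (i + 1)) ≠ 0 :=
    fun e => h (by rw [pathWeight, e, ENNReal.toReal_zero])
  rw [mul_ne_zero_iff, Finset.prod_ne_zero_iff] at hmul
  refine ⟨?_, fun i hi => hmul.2 i (Finset.mem_range.2 hi)⟩
  by_contra hB
  exact hmul.1 (if_neg hB)

lemma closed_of_pathWeight_ne_zero (h : pathWeight k σ B ≠ 0) {i : ℕ} (hi : i ≤ k) :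
    ∀ x ∈ B i, σ.1 x ∈ B i := by
  obtain ⟨hB₀, hstep⟩ := pathWeight_ne_zero h
  induction i with
  | zero => rw [hB₀]; exact fun _ _ => Finset.mem_univ _
  | succ i ih => exact (hstep i hi).closed (ih (by omega))

lemma subset_of_pathWeight_ne_zero (h : pathWeight k σ B ≠ 0) {i : ℕ} (hi : i ≤ k) :
    B k ⊆ B i := by
  obtain ⟨-, hstep⟩ := pathWeight_ne_zero h
  induction hi using Nat.decreasingInduction with
  | self => exact subset_rfl
  | of_succ i hi ih => exact ih.trans (hstep i hi).subset

lemma removeSet_eq_of_agree (hτ : ∀ x ∈ A', τ.1 x ∈ A') (hagree : ∀ x ∉ A', τ.1 x = σ.1 x)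
    (h : removeSet vertexOf σ A g = A') : removeSet vertexOf τ A g = A' := by
  have hmem : ∀ y, y ∈ A' ↔ y ∈ A ∧ vertexOf y ≠ vertexOf (σ.1 g) ∧
      vertexOf (σ.1 y) ≠ vertexOf (σ.1 g) := fun y => by rw [← h]; exact Finset.mem_filter
  have hg : τ.1 g = σ.1 g := hagree g fun hg => ((hmem g).1 hg).2.2 rfl
  ext x
  rw [removeSet, Finset.mem_filter, hg]
  by_cases hx : x ∈ A'
  · simp only [hx, iff_true]
    exact ⟨((hmem x).1 hx).1, ((hmem x).1 hx).2.1, ((hmem _).1 (hτ x hx)).2.1⟩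
  · rw [hagree x hx, ← hmem]

/-- A step reveals nothing about the pairing of the half-edges that it leaves. -/
lemma stepProb_congr (hσ : ∀ x ∈ A', σ.1 x ∈ A') (hτ : ∀ x ∈ A', τ.1 x ∈ A')
    (hagree : ∀ x ∉ A', τ.1 x = σ.1 x) :
    stepProb (τ, A) (τ, A') = stepProb (σ, A) (σ, A') := by
  have hremove : ∀ g, State.remove (τ, A) g = (τ, A') ↔ State.remove (σ, A) g = (σ, A') := by
    intro g
    simp only [remove_eq, Prod.mk.injEq, true_and]
    exact ⟨removeSet_eq_of_agree hσ fun x hx => (hagree x hx).symm,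
      removeSet_eq_of_agree hτ hagree⟩
  have hlegs : State.legs (τ, A) 1 = State.legs (σ, A) 1 := rfl
  unfold stepProb
  classical
  rw [hlegs, Finset.filter_congr fun g _ => hremove g]
  simp only [Prod.mk.injEq, true_and]

lemma swap_apply_mem (ha : a ∈ A) (hb : b ∈ A) (hx : x ∈ A) : Equiv.swap a b x ∈ A := by
  rw [Equiv.swap_apply_def]
  split_ifs <;> assumption

lemma swapPairing_apply_of_notMem (ha : a ∈ A) (hb : b ∈ A) (hσ : ∀ y ∈ A, σ.1 y ∈ A)
    (hx : x ∉ A) : (swapPairing a b σ).1 x = σ.1 x := by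
  have hswap : ∀ y ∉ A, Equiv.swap a b y = y := fun y hy =>
    Equiv.swap_apply_of_ne_of_ne (fun e => hy (e ▸ ha)) fun e => hy (e ▸ hb)
  rw [swapPairing_apply, hswap x hx, hswap _ fun h => hx (σ.2.1 x ▸ hσ _ h)]

lemma pathWeight_swapPairing_of_ne_zero (ha : a ∈ B k) (hb : b ∈ B k)
    (h : pathWeight k σ B ≠ 0) : pathWeight k (swapPairing a b σ) B = pathWeight k σ B := by
  have hprod : ∀ i ∈ Finset.range k,
      stepProb (swapPairing a b σ, B i) (swapPairing a b σ, B (i + 1)) =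
        stepProb (σ, B i) (σ, B (i + 1)) := by
    intro i hi
    have hik : i + 1 ≤ k := Finset.mem_range.1 hi
    have hσ := closed_of_pathWeight_ne_zero h hik
    have ha' := subset_of_pathWeight_ne_zero h hik ha
    have hb' := subset_of_pathWeight_ne_zero h hik hb
    refine stepProb_congr hσ (fun x hx => ?_) fun x => swapPairing_apply_of_notMem ha' hb' hσ
    exact swap_apply_mem ha' hb' (hσ _ (swap_apply_mem ha' hb' hx))
  rw [pathWeight, pathWeight, Finset.prod_congr rfl hprod]
  rfl

lemma isExchangeableOn_pathWeight (k : ℕ) (B : ℕ → Finset (HalfEdge d)) :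
    IsExchangeableOn (B k) fun σ => pathWeight k σ B where
  nonneg _ := ENNReal.toReal_nonneg
  swapInvariant a ha b hb σ := by
    by_cases hσ : pathWeight k σ B = 0
    · by_contra hne
      have hswap : pathWeight k (swapPairing a b σ) B ≠ 0 := fun e => hne (e.trans hσ.symm)
      have hback := pathWeight_swapPairing_of_ne_zero ha hb hswap
      rw [swapPairing_involutive a b σ] at hback
      exact hne hback.symm
    · exact pathWeight_swapPairing_of_ne_zero ha hb hσ
  apply_mem _ hσ := closed_of_pathWeight_ne_zero hσ le_rfl

lemma sum_stepProb_mul (σ : Pairing d) (hA : legsOf A 1 ≠ ∅) (Ψ : Finset (HalfEdge d) → ℝ) :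
    ∑ A', (stepProb (σ, A) (σ, A')).toReal * Ψ A' =
      𝔼 g ∈ legsOf A 1, Ψ (removeSet vertexOf σ A g) := by
  classical
  have hprob : ∀ A', (stepProb (σ, A) (σ, A')).toReal =
      (∑ g ∈ legsOf A 1, if removeSet vertexOf σ A g = A' then 1 else 0) /
        (legsOf A 1).card := by
    intro A'
    have hremove : ∀ g, State.remove (σ, A) g = (σ, A') ↔ removeSet vertexOf σ A g = A' :=
      fun g => by simp only [remove_eq, Prod.mk.injEq, true_and]
    unfold stepProb
    rw [legs_eq_legsOf, if_neg hA, ENNReal.toReal_div, ENNReal.toReal_natCast,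
      ENNReal.toReal_natCast, Finset.sum_boole]
    simp only [hremove]
  simp only [hprob, div_mul_eq_mul_div, ← Finset.sum_div, Finset.sum_mul]
  rw [Finset.sum_comm, Finset.expect_eq_sum_div_card]
  simp

end PathWeight

section Law

variable {d : DegreeSequence} {Ω : Type*} [MeasurableSpace Ω] {P : Measure Ω}
  {ξ : ℕ → Ω → State d} {c : ℕ → ℝ} {M : ℝ}

lemma IsExchangeableOn.abs_sum_stepProb_mul_potential_change_le {A : Finset (HalfEdge d)}
    {W : Pairing d → ℝ} (hW : IsExchangeableOn A W) (hA : 10 ≤ A.card) (hlegs : legsOf A 1 ≠ ∅)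
    (hc₀ : c 0 = 0) (hc : ∀ k, c k ∈ Set.Icc 0 M) :
    |∑ σ, W σ * ∑ A', (stepProb (σ, A) (σ, A')).toReal * (potential vertexOf c A' -
      potential vertexOf c A - meanDrift vertexOf c A)| ≤ 820 * M / A.card * ∑ σ, W σ := by
  have hM : 0 ≤ M := (hc 0).1.trans (hc 0).2
  simp only [fun σ => sum_stepProb_mul σ hlegs fun A' => potential vertexOf c A' -
    potential vertexOf c A - meanDrift vertexOf c A, Finset.mul_expect]
  rw [← Finset.expect_sum_comm]
  refine abs_expect_le (mul_nonneg (by positivity) (Finset.sum_nonneg fun σ _ => hW.nonneg σ))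
    fun g hg => ?_
  obtain ⟨hgA, hg₁⟩ := Finset.mem_filter.1 hg
  refine (hW.abs_sum_potential_change_sub_meanDrift_le deg_vertexOf_le hgA hg₁ hA hc₀
    hc).trans_eq ?_
  norm_num

lemma IsExploration.measurableSet (hξ : IsExploration P d ξ) (k : ℕ) (p : State d → Prop) :
    MeasurableSet {ω | p (ξ k ω)} := by
  have hunion : {ω | p (ξ k ω)} = ⋃ s ∈ {s | p s}, {ω | ξ k ω = s} := by ext; simp
  rw [hunion]
  exact MeasurableSet.biUnion (Set.to_countable _) fun s _ => hξ.measurable k s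

lemma IsExploration.ae_initial (hξ : IsExploration P d ξ) :
    ∀ᵐ ω ∂P, (ξ 0 ω).2 = Finset.univ := by
  rw [ae_iff]
  refine measure_mono_null (t := ⋃ s : {s : State d // s.2 ≠ Finset.univ},
    {ω | ∀ i ≤ 0, ξ i ω = s.1}) (fun ω hω => ?_) (measure_iUnion_null fun s => ?_)
  · refine Set.mem_iUnion.2 ⟨⟨ξ 0 ω, hω⟩, fun i hi => ?_⟩
    rw [Nat.le_zero.1 hi]
  · rw [hξ.law 0 fun _ => s.1, initialProb, if_neg s.2, zero_mul]

/-- A finite history as an infinite sequence. -/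
def extendHistory {α : Type*} {k : ℕ} (A : Fin (k + 1) → α) (i : ℕ) : α := A ⟨min i k, by omega⟩

lemma extendHistory_apply {α : Type*} {k : ℕ} (B : ℕ → α) {i : ℕ} (hi : i ≤ k) :
    extendHistory (fun j : Fin (k + 1) => B j) i = B i := by
  simp only [extendHistory, min_eq_left hi]

lemma IsExploration.ae_isStep (hξ : IsExploration P d ξ) (k : ℕ) :
    ∀ᵐ ω ∂P, IsStep (ξ k ω) (ξ (k + 1) ω) := by
  rw [ae_iff]
  refine measure_mono_null (t := ⋃ q : {q : Fin (k + 2) → State d //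
    stepProb (extendHistory q k) (extendHistory q (k + 1)) = 0},
    {ω | ∀ i ≤ k + 1, ξ i ω = extendHistory q.1 i})
    (fun ω hω => ?_) (measure_iUnion_null fun q => ?_)
  · have hext : ∀ i ≤ k + 1, extendHistory (fun i : Fin (k + 2) => ξ i ω) i = ξ i ω :=
      fun i hi => extendHistory_apply (fun i => ξ i ω) hi
    refine Set.mem_iUnion.2 ⟨⟨fun i => ξ i ω, ?_⟩, fun i hi => (hext i hi).symm⟩
    rw [hext k (by omega), hext (k + 1) le_rfl]
    simpa [IsStep] using hω
  · rw [hξ.law (k + 1) (extendHistory q.1), Finset.prod_range_succ, q.2, mul_zero, mul_zero]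

lemma IsExploration.ae_isTrajectory (hξ : IsExploration P d ξ) :
    ∀ᵐ ω ∂P, IsTrajectory fun k => ξ k ω := by
  filter_upwards [hξ.ae_initial, ae_all_iff.2 hξ.ae_isStep] with ω hinit hstep
  exact ⟨hinit, hstep⟩

lemma integrable_comp_of_finite [IsFiniteMeasure P] {α : Type*} [Finite α] {Q : Ω → α}
    (hQ : ∀ a, MeasurableSet {ω | Q ω = a}) (F : α → ℝ) : Integrable (fun ω => F (Q ω)) P := by
  let _ : MeasurableSpace α := ⊤
  have hQm : Measurable Q := measurable_to_countable' hQ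
  exact (Integrable.of_finite (μ := P.map Q) (f := F)).comp_measurable hQm

lemma integral_comp_of_fintype [IsFiniteMeasure P] {α : Type*} [Fintype α] {Q : Ω → α}
    (hQ : ∀ a, MeasurableSet {ω | Q ω = a}) (F : α → ℝ) :
    ∫ ω, F (Q ω) ∂P = ∑ a, P.real {ω | Q ω = a} * F a := by
  let _ : MeasurableSpace α := ⊤
  have hQm : Measurable Q := measurable_to_countable' hQ
  have hF : Measurable F := measurable_from_top
  rw [← integral_map hQm.aemeasurable hF.aestronglyMeasurable,
    integral_fintype Integrable.of_finite]
  refine Finset.sum_congr rfl fun a _ => ?_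
  rw [map_measureReal_apply hQm (measurableSet_singleton a), smul_eq_mul]
  rfl

/-- The pairing, the sets of unmatched half-edges up to time `k`, and the one at time `k + 1`. -/
abbrev history (s : ℕ → State d) (k : ℕ) :
    Pairing d × (Fin (k + 1) → Finset (HalfEdge d)) × Finset (HalfEdge d) :=
  ((s 0).1, (fun i => (s i).2), (s (k + 1)).2)

lemma IsExploration.measurableSet_history (hξ : IsExploration P d ξ) (k : ℕ)
    (a : Pairing d × (Fin (k + 1) → Finset (HalfEdge d)) × Finset (HalfEdge d)) :
    MeasurableSet {ω | history (fun i => ξ i ω) k = a} := by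
  have hinter : {ω | history (fun i => ξ i ω) k = a} =
      {ω | (ξ 0 ω).1 = a.1} ∩ ((⋂ i : Fin (k + 1), {ω | (ξ i ω).2 = a.2.1 i}) ∩
        {ω | (ξ (k + 1) ω).2 = a.2.2}) := by
    ext ω
    simp [Prod.ext_iff, funext_iff]
  rw [hinter]
  exact (hξ.measurableSet 0 fun s => s.1 = a.1).inter
    ((MeasurableSet.iInter fun i : Fin (k + 1) => hξ.measurableSet i fun s => s.2 = a.2.1 i).inter
      (hξ.measurableSet (k + 1) fun s => s.2 = a.2.2))

lemma IsTrajectory.history_eq_iff {s : ℕ → State d} (hs : IsTrajectory s) {k : ℕ}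
    {σ : Pairing d} {A : Fin (k + 1) → Finset (HalfEdge d)} {A' : Finset (HalfEdge d)} :
    history s k = (σ, A, A') ↔
      ∀ i ≤ k + 1, s i = (σ, if i ≤ k then extendHistory A i else A') := by
  simp only [history, Prod.mk.injEq]
  constructor
  · rintro ⟨hσ, hA, hA'⟩ i hi
    refine Prod.ext ((hs.fst_eq i).trans hσ) ?_
    split_ifs with hik
    · rw [← hA]; exact (extendHistory_apply (fun j => (s j).2) hik).symm
    · obtain rfl : i = k + 1 := by omega
      exact hA'
  · intro h
    refine ⟨by rw [h 0 (by omega)], ?_, by rw [h (k + 1) le_rfl]; simp⟩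
    ext1 i
    have hik : (i : ℕ) ≤ k := by omega
    rw [h i (by omega)]
    simp only [hik, if_true, extendHistory, min_eq_left hik]

lemma IsExploration.measureReal_history (hξ : IsExploration P d ξ) (k : ℕ)
    (σ : Pairing d) (A : Fin (k + 1) → Finset (HalfEdge d)) (A' : Finset (HalfEdge d)) :
    P.real {ω | history (fun i => ξ i ω) k = (σ, A, A')} =
      pathWeight k σ (extendHistory A) *
        (stepProb (σ, extendHistory A k) (σ, A')).toReal := by
  set s : ℕ → State d := fun i => (σ, if i ≤ k then extendHistory A i else A') with hs
  have hpath : P {ω | history (fun i => ξ i ω) k = (σ, A, A')} =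
      P {ω | ∀ i ≤ k + 1, ξ i ω = s i} := by
    refine measure_congr ?_
    filter_upwards [hξ.ae_isTrajectory] with ω hω
    exact propext hω.history_eq_iff
  have hle : ∀ i ≤ k, s i = (σ, extendHistory A i) := fun i hi => by simp only [hs, hi, if_true]
  have hlast : s (k + 1) = (σ, A') := by simp [hs]
  rw [Measure.real, hpath, hξ.law (k + 1) s, Finset.prod_range_succ, ← mul_assoc,
    ENNReal.toReal_mul, pathWeight, hle 0 (by omega), hle k le_rfl, hlast,
    Finset.prod_congr rfl fun i hi => by
      rw [hle i (Finset.mem_range.1 hi).le, hle (i + 1) (Finset.mem_range.1 hi)]]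

variable [IsFiniteMeasure P]

set_option synthInstance.maxSize 512 in
lemma IsExploration.integrable_history (hξ : IsExploration P d ξ) (k : ℕ)
    (G : (Fin (k + 1) → Finset (HalfEdge d)) → Finset (HalfEdge d) → ℝ) :
    Integrable (fun ω => G (fun i => (ξ i ω).2) (ξ (k + 1) ω).2) P :=
  integrable_comp_of_finite (hξ.measurableSet_history k) fun a => G a.2.1 a.2.2

set_option synthInstance.maxSize 512 in
lemma IsExploration.integral_history (hξ : IsExploration P d ξ) (k : ℕ)
    (G : (Fin (k + 1) → Finset (HalfEdge d)) → Finset (HalfEdge d) → ℝ) :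
    ∫ ω, G (fun i => (ξ i ω).2) (ξ (k + 1) ω).2 ∂P =
      ∑ A, ∑ σ : Pairing d, pathWeight k σ (extendHistory A) *
        ∑ A', (stepProb (σ, extendHistory A k) (σ, A')).toReal * G A A' := by
  rw [integral_comp_of_fintype (hξ.measurableSet_history k) fun a => G a.2.1 a.2.2,
    Fintype.sum_prod_type, Finset.sum_congr rfl fun σ _ => Fintype.sum_prod_type _,
    Finset.sum_comm]
  refine Finset.sum_congr rfl fun A _ => Finset.sum_congr rfl fun σ _ => ?_
  rw [Finset.mul_sum]
  refine Finset.sum_congr rfl fun A' _ => ?_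
  rw [hξ.measureReal_history, mul_assoc]

lemma IsExploration.abs_integral_mul_potential_change_le (hξ : IsExploration P d ξ) (k : ℕ)
    {s₀ : ℝ} (hs₀ : 10 ≤ s₀) {F : (Fin (k + 1) → Finset (HalfEdge d)) → ℝ}
    (hF : ∀ A, F A ≠ 0 → legsOf (A (Fin.last k)) 1 ≠ ∅ ∧ s₀ ≤ (A (Fin.last k)).card)
    (hc₀ : c 0 = 0) (hc : ∀ k, c k ∈ Set.Icc 0 M) :
    |∫ ω, F (fun i => (ξ i ω).2) * (potential vertexOf c (ξ (k + 1) ω).2 -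
      potential vertexOf c (ξ k ω).2 - meanDrift vertexOf c (ξ k ω).2) ∂P| ≤
      820 * M / s₀ * ∫ ω, |F fun i => (ξ i ω).2| ∂P := by
  have hM : 0 ≤ M := (hc 0).1.trans (hc 0).2
  have hchange := hξ.integral_history k fun A A' => F A * (potential vertexOf c A' -
    potential vertexOf c (A (Fin.last k)) - meanDrift vertexOf c (A (Fin.last k)))
  simp only [Fin.val_last] at hchange
  rw [hchange, hξ.integral_history k fun A _ => |F A|, Finset.mul_sum]
  refine (Finset.abs_sum_le_sum_abs _ _).trans (Finset.sum_le_sum fun A _ => ?_)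
  by_cases hFA : F A = 0
  · simp [hFA]
  obtain ⟨hlegs, hcard⟩ := hF A hFA
  have hext : extendHistory A k = A (Fin.last k) := by simp [extendHistory, Fin.last]
  set W : Pairing d → ℝ := fun σ => pathWeight k σ (extendHistory A)
  have hW : IsExchangeableOn (A (Fin.last k)) W :=
    hext ▸ isExchangeableOn_pathWeight k (extendHistory A)
  have hWsum : 0 ≤ ∑ σ, W σ := Finset.sum_nonneg fun σ _ => hW.nonneg σ
  have habs : ∀ σ : Pairing d,
      ∑ A', (stepProb (σ, A (Fin.last k)) (σ, A')).toReal * |F A| = |F A| := fun σ => by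
    rw [sum_stepProb_mul σ hlegs fun _ => |F A|,
      Finset.expect_const (Finset.nonempty_iff_ne_empty.2 hlegs)]
  have hbound := hW.abs_sum_stepProb_mul_potential_change_le
    (by exact_mod_cast hs₀.trans hcard) hlegs hc₀ hc
  rw [hext]
  simp only [habs, ← Finset.sum_mul, mul_left_comm _ (F A), ← Finset.mul_sum, abs_mul]
  calc |F A| * _ ≤ |F A| * (820 * M / (A (Fin.last k)).card * ∑ σ, W σ) := by gcongr
    _ ≤ |F A| * (820 * M / s₀ * ∑ σ, W σ) := by gcongr
    _ = _ := by ring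

end Law

/-! ### Second moment bound for the noise -/

section Noise

variable {d : DegreeSequence} {s₀ : ℝ} {c : ℕ → ℝ} {M : ℝ} {k : ℕ}

/-- The exploration can be compared with its drift: there are leaves, and at least `s₀` half-edges
are unmatched. -/
def IsActive (s₀ : ℝ) (A : Finset (HalfEdge d)) : Prop := legsOf A 1 ≠ ∅ ∧ s₀ ≤ A.card

open Classical in
/-- The centred change of the potential in a step from an active state. -/
noncomputable def noise (s₀ : ℝ) (c : ℕ → ℝ) (A A' : Finset (HalfEdge d)) : ℝ :=
  if IsActive s₀ A then
    potential vertexOf c A' - potential vertexOf c A - meanDrift vertexOf c A else 0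

/-- The noise accumulated in the first `k` steps. -/
noncomputable def noiseSum (s₀ : ℝ) (c : ℕ → ℝ) (s : ℕ → State d) (k : ℕ) : ℝ :=
  ∑ i ∈ Finset.range k, noise s₀ c (s i).2 (s (i + 1)).2

lemma abs_noise_le (s₀ : ℝ) (hc : ∀ k, c k ∈ Set.Icc 0 M) {s s' : State d} (h : IsStep s s') :
    |noise s₀ c s.2 s'.2| ≤ 11 * M := by
  have hM : 0 ≤ M := (hc 0).1.trans (hc 0).2
  unfold noise
  split_ifs
  · have hstep := h.abs_potential_sub_le hc
    have hdrift := abs_meanDrift_le s.2 hc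
    exact (abs_sub _ _).trans (by linarith)
  · simpa using hM

lemma IsTrajectory.abs_noiseSum_sub_le {s : ℕ → State d} (hs : IsTrajectory s) (s₀ : ℝ)
    (hc : ∀ k, c k ∈ Set.Icc 0 M) {l : ℕ} (hkl : k ≤ l) :
    |noiseSum s₀ c s l - noiseSum s₀ c s k| ≤ 11 * M * ((l : ℝ) - k) := by
  unfold noiseSum
  rw [← Finset.sum_Ico_eq_sub _ hkl]
  calc _ ≤ _ := Finset.abs_sum_le_sum_abs _ _
    _ ≤ ∑ _i ∈ Finset.Ico k l, 11 * M :=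
      Finset.sum_le_sum fun i _ => abs_noise_le s₀ hc (hs.step i)
    _ = _ := by rw [Finset.sum_const, Nat.card_Ico, nsmul_eq_mul, Nat.cast_sub hkl, mul_comm]

lemma IsTrajectory.abs_noiseSum_le {s : ℕ → State d} (hs : IsTrajectory s) (s₀ : ℝ)
    (hc : ∀ k, c k ∈ Set.Icc 0 M) (k : ℕ) : |noiseSum s₀ c s k| ≤ 11 * M * k := by
  simpa [noiseSum] using hs.abs_noiseSum_sub_le s₀ hc (Nat.zero_le k)

variable {Ω : Type*} [MeasurableSpace Ω] {P : Measure Ω} [IsProbabilityMeasure P]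
  {ξ : ℕ → Ω → State d}

lemma IsExploration.integrable_noiseSum_sq (hξ : IsExploration P d ξ) (s₀ : ℝ) (c : ℕ → ℝ) (k : ℕ) :
    Integrable (fun ω => noiseSum s₀ c (fun i => ξ i ω) k ^ 2) P := by
  refine (hξ.integrable_history k fun A _ =>
    (∑ i : Fin k, noise s₀ c (A i.castSucc) (A i.succ)) ^ 2).congr
    (Eventually.of_forall fun ω => ?_)
  simp only [noiseSum, Finset.sum_range, Fin.val_castSucc, Fin.val_succ]

lemma IsExploration.integrable_noiseSum_mul_noise (hξ : IsExploration P d ξ) (s₀ : ℝ) (c : ℕ → ℝ)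
    (k : ℕ) : Integrable (fun ω =>
      noiseSum s₀ c (fun i => ξ i ω) k * noise s₀ c (ξ k ω).2 (ξ (k + 1) ω).2) P := by
  refine (hξ.integrable_history k fun A A' =>
    (∑ i : Fin k, noise s₀ c (A i.castSucc) (A i.succ)) * noise s₀ c (A (Fin.last k)) A').congr
    (Eventually.of_forall fun ω => ?_)
  simp only [noiseSum, Finset.sum_range, Fin.val_castSucc, Fin.val_succ, Fin.val_last]

lemma IsExploration.integrable_noise_sq (hξ : IsExploration P d ξ) (s₀ : ℝ) (c : ℕ → ℝ) (k : ℕ) :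
    Integrable (fun ω => noise s₀ c (ξ k ω).2 (ξ (k + 1) ω).2 ^ 2) P :=
  (hξ.integrable_history k fun A A' => noise s₀ c (A (Fin.last k)) A' ^ 2).congr
    (Eventually.of_forall fun ω => by simp only [Fin.val_last])

lemma IsExploration.integral_noise_sq_le (hξ : IsExploration P d ξ) (s₀ : ℝ)
    (hc : ∀ k, c k ∈ Set.Icc 0 M) (k : ℕ) :
    ∫ ω, noise s₀ c (ξ k ω).2 (ξ (k + 1) ω).2 ^ 2 ∂P ≤ (11 * M) ^ 2 := by
  have hbound : ∀ᵐ ω ∂P, ‖noise s₀ c (ξ k ω).2 (ξ (k + 1) ω).2 ^ 2‖ ≤ (11 * M) ^ 2 := by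
    filter_upwards [hξ.ae_isStep k] with ω hω
    rw [norm_pow]
    exact pow_le_pow_left₀ (norm_nonneg _) (abs_noise_le s₀ hc hω) 2
  simpa using (le_abs_self _).trans (norm_integral_le_of_norm_le_const hbound)

lemma IsExploration.abs_integral_noiseSum_mul_noise_le (hξ : IsExploration P d ξ) (hs₀ : 10 ≤ s₀)
    (hc₀ : c 0 = 0) (hc : ∀ k, c k ∈ Set.Icc 0 M) (k : ℕ) :
    |∫ ω, noiseSum s₀ c (fun i => ξ i ω) k * noise s₀ c (ξ k ω).2 (ξ (k + 1) ω).2 ∂P| ≤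
      820 * M / s₀ * (11 * M * k) := by
  classical
  have hM : 0 ≤ M := (hc 0).1.trans (hc 0).2
  set F : (Fin (k + 1) → Finset (HalfEdge d)) → ℝ := fun A =>
    if IsActive s₀ (A (Fin.last k)) then
      ∑ i : Fin k, noise s₀ c (A i.castSucc) (A i.succ) else 0 with hF
  have hF_eq : ∀ ω, F (fun i => (ξ i ω).2) =
      if IsActive s₀ (ξ k ω).2 then noiseSum s₀ c (fun i => ξ i ω) k else 0 := by
    intro ω
    simp only [hF, noiseSum, Finset.sum_range, Fin.val_castSucc, Fin.val_succ, Fin.val_last]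
  have hmul : ∀ ω, noiseSum s₀ c (fun i => ξ i ω) k * noise s₀ c (ξ k ω).2 (ξ (k + 1) ω).2 =
      F (fun i => (ξ i ω).2) * (potential vertexOf c (ξ (k + 1) ω).2 -
        potential vertexOf c (ξ k ω).2 - meanDrift vertexOf c (ξ k ω).2) := by
    intro ω
    rw [hF_eq, noise]
    split_ifs <;> simp
  have hF_le : ∀ᵐ ω ∂P, ‖|F fun i => (ξ i ω).2|‖ ≤ 11 * M * k := by
    filter_upwards [hξ.ae_isTrajectory] with ω hω
    rw [Real.norm_eq_abs, abs_abs, hF_eq]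
    split_ifs
    · exact hω.abs_noiseSum_le s₀ hc k
    · rw [abs_zero]; positivity
  have hF_int : ∫ ω, |F fun i => (ξ i ω).2| ∂P ≤ 11 * M * k := by
    simpa using (le_abs_self _).trans (norm_integral_le_of_norm_le_const hF_le)
  simp only [hmul]
  refine (hξ.abs_integral_mul_potential_change_le k hs₀ (F := F) (fun A hA => ?_) hc₀ hc).trans ?_
  · by_contra hactive
    exact hA (if_neg hactive)
  · gcongr

lemma IsExploration.integral_noiseSum_sq_le (hξ : IsExploration P d ξ) (hs₀ : 10 ≤ s₀)
    (hc₀ : c 0 = 0) (hc : ∀ k, c k ∈ Set.Icc 0 M) (k : ℕ) :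
    ∫ ω, noiseSum s₀ c (fun i => ξ i ω) k ^ 2 ∂P ≤ M ^ 2 * k * (121 + 18040 * k / s₀) := by
  induction k with
  | zero => simp [noiseSum]
  | succ k ih =>
    have hexpand : ∀ ω, noiseSum s₀ c (fun i => ξ i ω) (k + 1) ^ 2 =
        noiseSum s₀ c (fun i => ξ i ω) k ^ 2 +
          (2 * (noiseSum s₀ c (fun i => ξ i ω) k * noise s₀ c (ξ k ω).2 (ξ (k + 1) ω).2) +
            noise s₀ c (ξ k ω).2 (ξ (k + 1) ω).2 ^ 2) := by
      intro ω
      simp only [noiseSum, Finset.sum_range_succ]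
      ring
    have hcross_int := (hξ.integrable_noiseSum_mul_noise s₀ c k).const_mul 2
    have hcross := (le_abs_self _).trans (hξ.abs_integral_noiseSum_mul_noise_le hs₀ hc₀ hc k)
    have hsq := hξ.integral_noise_sq_le s₀ hc k
    have hrest_int : Integrable (fun ω =>
        2 * (noiseSum s₀ c (fun i => ξ i ω) k * noise s₀ c (ξ k ω).2 (ξ (k + 1) ω).2) +
          noise s₀ c (ξ k ω).2 (ξ (k + 1) ω).2 ^ 2) P :=
      hcross_int.add (hξ.integrable_noise_sq s₀ c k)
    simp only [hexpand]
    rw [integral_add (hξ.integrable_noiseSum_sq s₀ c k) hrest_int,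
      integral_add hcross_int (hξ.integrable_noise_sq s₀ c k), integral_const_mul]
    calc _ ≤ M ^ 2 * k * (121 + 18040 * k / s₀) +
          (2 * (820 * M / s₀ * (11 * M * k)) + (11 * M) ^ 2) := by gcongr
      _ = M ^ 2 * (k + 1) * (121 + 18040 * k / s₀) := by ring
      _ ≤ M ^ 2 * ↑(k + 1) * (121 + 18040 * ↑(k + 1) / s₀) := by push_cast; gcongr; simp

lemma IsExploration.measure_noiseSum_le (hξ : IsExploration P d ξ) (hs₀ : 10 ≤ s₀)
    (hc₀ : c 0 = 0) (hc : ∀ k, c k ∈ Set.Icc 0 M) (k : ℕ) {b : ℝ} (hb : 0 < b) :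
    P {ω | b < |noiseSum s₀ c (fun i => ξ i ω) k|} ≤
      ENNReal.ofReal (M ^ 2 * k * (121 + 18040 * k / s₀) / b ^ 2) := by
  have hmarkov := mul_meas_ge_le_integral_of_nonneg (μ := P)
    (f := fun ω => noiseSum s₀ c (fun i => ξ i ω) k ^ 2)
    (Eventually.of_forall fun ω => sq_nonneg _) (hξ.integrable_noiseSum_sq s₀ c k) (b ^ 2)
  calc _ ≤ P {ω | b ^ 2 ≤ noiseSum s₀ c (fun i => ξ i ω) k ^ 2} :=
        measure_mono fun ω hω => (pow_le_pow_left₀ hb.le (le_of_lt hω) 2).trans_eq (sq_abs _)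
    _ = ENNReal.ofReal (P.real _) := (ofReal_measureReal).symm
    _ ≤ _ := ENNReal.ofReal_le_ofReal <| by
      rw [le_div_iff₀ (by positivity), mul_comm]
      exact hmarkov.trans (hξ.integral_noiseSum_sq_le hs₀ hc₀ hc k)

lemma IsTrajectory.exists_mul_lt_abs_noiseSum {s : ℕ → State d} (hs : IsTrajectory s)
    (hc : ∀ k, c k ∈ Set.Icc 0 M) {q J : ℕ} (hq : 0 < q) {b : ℝ} (hk : k ≤ J * q)
    (hb : b + 11 * M * q < |noiseSum s₀ c s k|) :
    ∃ i ∈ Finset.range (J + 1), b < |noiseSum s₀ c s (i * q)| := by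
  have hM : 0 ≤ M := (hc 0).1.trans (hc 0).2
  refine ⟨k / q, Finset.mem_range.2 (Nat.lt_succ_of_le (Nat.div_le_of_le_mul (by lia))), ?_⟩
  have hvar := hs.abs_noiseSum_sub_le s₀ hc (Nat.div_mul_le_self k q)
  have hgap : (k : ℝ) - (k / q * q : ℕ) ≤ q := by
    have hdiv := Nat.div_add_mod' k q
    have hmod := Nat.mod_lt k hq
    have hle : (k : ℝ) ≤ (k / q * q : ℕ) + q := by exact_mod_cast (by omega)
    linarith
  have hgap' : 11 * M * ((k : ℝ) - (k / q * q : ℕ)) ≤ 11 * M * q := by gcongr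
  have htri := abs_sub_abs_le_abs_sub (noiseSum s₀ c s k) (noiseSum s₀ c s (k / q * q))
  linarith

lemma IsExploration.measure_exists_noiseSum_le (hξ : IsExploration P d ξ) (hs₀ : 10 ≤ s₀)
    (hc₀ : c 0 = 0) (hc : ∀ k, c k ∈ Set.Icc 0 M) {q J : ℕ} (hq : 0 < q) {b : ℝ} (hb : 0 < b) :
    P {ω | ∃ k ≤ J * q, b + 11 * M * q < |noiseSum s₀ c (fun i => ξ i ω) k|} ≤
      ENNReal.ofReal ((J + 1) * (M ^ 2 * (J * q) * (121 + 18040 * (J * q) / s₀) / b ^ 2)) := by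
  have hgrid : P {ω | ∃ k ≤ J * q, b + 11 * M * q < |noiseSum s₀ c (fun i => ξ i ω) k|} ≤
      P (⋃ i ∈ Finset.range (J + 1),
        {ω | b < |noiseSum s₀ c (fun i => ξ i ω) (i * q)|}) := by
    refine measure_mono_ae ?_
    filter_upwards [hξ.ae_isTrajectory] with ω hω
    rintro ⟨k, hk, hbk⟩
    obtain ⟨i, hi, hib⟩ := hω.exists_mul_lt_abs_noiseSum hc hq hk hbk
    exact Set.mem_iUnion₂.2 ⟨i, hi, hib⟩
  refine hgrid.trans ((measure_biUnion_finset_le _ _).trans ?_)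
  calc _ ≤ ∑ _i ∈ Finset.range (J + 1),
        ENNReal.ofReal (M ^ 2 * (J * q) * (121 + 18040 * (J * q) / s₀) / b ^ 2) := by
        refine Finset.sum_le_sum fun i hi => (hξ.measure_noiseSum_le hs₀ hc₀ hc _ hb).trans ?_
        have hiJ : (i : ℝ) ≤ J := by exact_mod_cast Nat.lt_succ_iff.1 (Finset.mem_range.1 hi)
        refine ENNReal.ofReal_le_ofReal ?_
        push_cast
        gcongr
    _ = _ := by
      rw [Finset.sum_const, Finset.card_range, nsmul_eq_mul, ENNReal.ofReal_mul (by positivity),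
        ← ENNReal.ofReal_natCast]
      push_cast
      rfl

end Noise

lemma exists_measure_noiseSum_le {T δ ε : ℝ} (hδ : 0 < δ) (hε : 0 < ε) :
    ∃ C n₀ : ℝ, ∀ (d : DegreeSequence) (Ω : Type*) [MeasurableSpace Ω] (P : Measure Ω)
      [IsProbabilityMeasure P] (ξ : ℕ → Ω → State d), IsExploration P d ξ → n₀ ≤ d.size →
      ∀ c : ℕ → ℝ, c 0 = 0 → (∀ k, c k ∈ Set.Icc 0 3) →
      P {ω | ∃ k : ℕ, (k : ℝ) ≤ T * d.size ∧
        ε * d.size < |noiseSum (δ * d.size) c (fun i => ξ i ω) k|} ≤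
        ENNReal.ofReal (C / d.size) := by
  -- The grid has `J` points, independently of the size.
  set e := ε / 132 with he
  have he_pos : 0 < e := by positivity
  set J := ⌈T / e⌉₊
  refine ⟨(J + 1) * (9 * (J * (e + 1)) * (121 + 18040 * (J * (e + 1)) / δ) * 4 / ε ^ 2),
    max 1 (max (10 / δ) (132 / ε)), ?_⟩
  intro d Ω _ P _ ξ hξ hsize c hc₀ hc
  simp only [max_le_iff, div_le_iff₀ hδ, div_le_iff₀ hε] at hsize
  obtain ⟨hn₁, hnδ, hnε⟩ := hsize
  set n : ℝ := (d.size : ℝ)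
  have : 0 < n := by linarith
  set q := ⌈e * n⌉₊
  have hq : 0 < q := Nat.ceil_pos.2 (by positivity)
  have hq_le : (q : ℝ) ≤ e * n + 1 := (Nat.ceil_lt_add_one (by positivity)).le
  have hq_mul : (q : ℝ) ≤ (e + 1) * n := by linarith
  have hJq : (J : ℝ) * q ≤ J * ((e + 1) * n) := by gcongr
  have hmax := hξ.measure_exists_noiseSum_le (s₀ := δ * n) (by linarith) hc₀ hc (J := J) hq
    (b := ε * n / 2) (by positivity)
  refine (measure_mono ?_).trans (hmax.trans (ENNReal.ofReal_le_ofReal ?_))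
  · rintro ω ⟨k, hk, hkε⟩
    refine ⟨k, ?_, lt_of_le_of_lt ?_ hkε⟩
    · have hkJ : (k : ℝ) ≤ J * q := calc
        (k : ℝ) ≤ T * n := hk
        _ = T / e * (e * n) := by field_simp
        _ ≤ J * q := by gcongr <;> exact Nat.le_ceil _
      exact_mod_cast hkJ
    · have hen : e * n = ε * n / 132 := by rw [he]; ring
      linarith
  · calc _ ≤ (J + 1) * (3 ^ 2 * (J * ((e + 1) * n)) *
          (121 + 18040 * (J * ((e + 1) * n)) / (δ * n)) / (ε * n / 2) ^ 2) := by gcongr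
      _ = _ := by field_simp; ring

/-! ### Perturbed Euler schemes -/

lemma le_mul_pow_of_le_add_sum {e : ℕ → ℝ} {a b : ℝ} (hb : 0 ≤ b) {K : ℕ}
    (h : ∀ k ≤ K, e k ≤ a + b * ∑ i ∈ Finset.range k, e i) {k : ℕ} (hk : k ≤ K) :
    e k ≤ a * (1 + b) ^ k := by
  have hgeom : ∀ m : ℕ, a + b * ∑ i ∈ Finset.range m, a * (1 + b) ^ i = a * (1 + b) ^ m := by
    intro m
    induction m with
    | zero => simp
    | succ m ih => rw [Finset.sum_range_succ, mul_add, ← add_assoc, ih]; ring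
  induction k using Nat.strong_induction_on with
  | _ k ih =>
    calc e k ≤ a + b * ∑ i ∈ Finset.range k, e i := h k hk
      _ ≤ a + b * ∑ i ∈ Finset.range k, a * (1 + b) ^ i := by
        gcongr with i hi
        have hik := Finset.mem_range.1 hi
        exact ih i hik (by omega)
      _ = a * (1 + b) ^ k := hgeom k

section Euler
variable {E : Type*} [NormedAddCommGroup E] [NormedSpace ℝ E] {F : E → E} {D : Set E} {L : NNReal}
  {γ : ℝ → E} {ε : ℝ}

lemma norm_sub_sub_smul_le {γ' : ℝ → E} {a b : ℝ} (hab : a ≤ b)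
    (hγ : ∀ t ∈ Set.Icc a b, HasDerivAt γ (γ' t) t)
    (hε : ∀ t ∈ Set.Icc a b, ‖γ' t - γ' a‖ ≤ ε) :
    ‖γ b - γ a - (b - a) • γ' a‖ ≤ ε * (b - a) := by
  have hderiv : ∀ t ∈ Set.Icc a b,
      HasDerivWithinAt (fun t => γ t - t • γ' a) (γ' t - γ' a) (Set.Icc a b) t := fun t ht => by
    have hline : HasDerivAt (fun t => t • γ' a) (γ' a) t := by
      simpa only [one_smul] using (hasDerivAt_id' t).smul_const (γ' a)
    exact ((hγ t ht).sub hline).hasDerivWithinAt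
  have hmvt := Convex.norm_image_sub_le_of_norm_hasDerivWithin_le hderiv hε (convex_Icc a b)
    (Set.left_mem_Icc.2 hab) (Set.right_mem_Icc.2 hab)
  rw [Real.norm_of_nonneg (sub_nonneg.2 hab)] at hmvt
  convert hmvt using 2
  rw [sub_smul]
  abel

lemma norm_smul_sub_sub_le (hL : LipschitzOnWith L F D) {a b : ℝ} (hab : a ≤ b)
    (hγ : ∀ t ∈ Set.Icc a b, HasDerivAt γ (F (γ t)) t)
    (hε : ∀ t ∈ Set.Icc a b, ‖F (γ t) - F (γ a)‖ ≤ ε) (hγD : γ a ∈ D) {u : E} (hu : u ∈ D) :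
    ‖(b - a) • F u - (γ b - γ a)‖ ≤ (b - a) * (L * ‖u - γ a‖ + ε) := by
  have hab₀ := sub_nonneg.2 hab
  calc ‖(b - a) • F u - (γ b - γ a)‖
      = ‖(b - a) • (F u - F (γ a)) - (γ b - γ a - (b - a) • F (γ a))‖ := by
        rw [smul_sub]; congr 1; abel
    _ ≤ (b - a) * ‖F u - F (γ a)‖ + ε * (b - a) := by
        refine (norm_sub_le _ _).trans (add_le_add ?_ (norm_sub_sub_smul_le hab hγ hε))
        rw [norm_smul, Real.norm_of_nonneg hab₀]
    _ ≤ (b - a) * (L * ‖u - γ a‖) + ε * (b - a) := by gcongr; exact hL.norm_sub_le hu hγD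
    _ = (b - a) * (L * ‖u - γ a‖ + ε) := by ring

variable {T h : ℝ} {u w : ℕ → E} {K : ℕ}

lemma norm_euler_sub_le_add_sum (hL : LipschitzOnWith L F D) (hγD : ∀ t ∈ Set.Icc 0 T, γ t ∈ D)
    (hγ : ∀ t ∈ Set.Icc 0 T, HasDerivAt γ (F (γ t)) t)
    (hmod : ∀ a ∈ Set.Icc 0 T, ∀ b ∈ Set.Icc 0 T, |a - b| ≤ h → ‖F (γ a) - F (γ b)‖ ≤ ε)
    (hh : 0 ≤ h) (hε : 0 ≤ ε) (hinit : ‖u 0 - γ 0‖ ≤ ε) {k : ℕ} (hk : k * h ≤ T)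
    (huD : ∀ i < k, u i ∈ D)
    (hu : u k = u 0 + ∑ i ∈ Finset.range k, h • F (u i) + w k) (hw : ‖w k‖ ≤ ε) :
    ‖u k - γ (k * h)‖ ≤ (2 + T) * ε + L * h * ∑ i ∈ Finset.range k, ‖u i - γ (i * h)‖ := by
  have hstep : ∀ i < k, ‖h • F (u i) - (γ ((i + 1 : ℕ) * h) - γ (i * h))‖ ≤
      h * (L * ‖u i - γ (i * h)‖ + ε) := by
    intro i hi
    have hlen : ((i + 1 : ℕ) : ℝ) * h - i * h = h := by push_cast; ring
    have hsub : Set.Icc (i * h) ((i + 1 : ℕ) * h) ⊆ Set.Icc 0 T := by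
      refine Set.Icc_subset_Icc (by positivity) (le_trans ?_ hk)
      gcongr
      exact hi
    have hle : (i : ℝ) * h ≤ (i + 1 : ℕ) * h := by gcongr; exact i.le_succ
    have hleft := Set.left_mem_Icc.2 hle
    have hmod' : ∀ t ∈ Set.Icc (i * h) ((i + 1 : ℕ) * h), ‖F (γ t) - F (γ (i * h))‖ ≤ ε :=
      fun t ht => hmod t (hsub ht) _ (hsub hleft) <|
        (abs_of_nonneg (sub_nonneg.2 ht.1)).trans_le ((sub_le_sub_right ht.2 _).trans_eq hlen)
    simpa only [hlen] using norm_smul_sub_sub_le hL hle (fun t ht => hγ t (hsub ht)) hmod'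
      (hγD _ (hsub hleft)) (huD i hi)
  have htele : γ (k * h) = γ 0 + ∑ i ∈ Finset.range k, (γ ((i + 1 : ℕ) * h) - γ (i * h)) := by
    rw [Finset.sum_range_sub fun i : ℕ => γ (i * h)]; simp
  have hsplit : u k - γ (k * h) = (u 0 - γ 0) +
      ∑ i ∈ Finset.range k, (h • F (u i) - (γ ((i + 1 : ℕ) * h) - γ (i * h))) + w k := by
    rw [hu, htele, Finset.sum_sub_distrib fun i => h • F (u i)]
    abel
  calc ‖u k - γ (k * h)‖
      ≤ ε + ∑ i ∈ Finset.range k, h * (L * ‖u i - γ (i * h)‖ + ε) + ε := by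
        rw [hsplit]
        refine norm_add₃_le.trans (add_le_add (add_le_add hinit ?_) hw)
        exact norm_sum_le_of_le _ fun i hi => hstep i (Finset.mem_range.1 hi)
    _ = (2 + k * h) * ε + L * h * ∑ i ∈ Finset.range k, ‖u i - γ (i * h)‖ := by
        rw [← Finset.mul_sum, Finset.sum_add_distrib, ← Finset.mul_sum, Finset.sum_const,
          Finset.card_range, nsmul_eq_mul]
        ring
    _ ≤ (2 + T) * ε + L * h * ∑ i ∈ Finset.range k, ‖u i - γ (i * h)‖ := by gcongr

lemma norm_euler_sub_le (hL : LipschitzOnWith L F D) (hγD : ∀ t ∈ Set.Icc 0 T, γ t ∈ D)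
    (hγ : ∀ t ∈ Set.Icc 0 T, HasDerivAt γ (F (γ t)) t)
    (hmod : ∀ a ∈ Set.Icc 0 T, ∀ b ∈ Set.Icc 0 T, |a - b| ≤ h → ‖F (γ a) - F (γ b)‖ ≤ ε)
    (hh : 0 ≤ h) (hinit : ‖u 0 - γ 0‖ ≤ ε) (hK : K * h ≤ T) (huD : ∀ i < K, u i ∈ D)
    (hu : ∀ k ≤ K, u k = u 0 + ∑ i ∈ Finset.range k, h • F (u i) + w k)
    (hw : ∀ k ≤ K, ‖w k‖ ≤ ε) :
    ‖u K - γ (K * h)‖ ≤ (2 + T) * ε * Real.exp (L * T) := by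
  have hε : 0 ≤ ε := (norm_nonneg _).trans hinit
  have hT : 0 ≤ T := le_trans (by positivity) hK
  have hrec : ∀ k ≤ K, ‖u k - γ (k * h)‖ ≤
      (2 + T) * ε + L * h * ∑ i ∈ Finset.range k, ‖u i - γ (i * h)‖ := fun k hk =>
    norm_euler_sub_le_add_sum hL hγD hγ hmod hh hε hinit (le_trans (by gcongr) hK)
      (fun i hi => huD i (hi.trans_le hk)) (hu k hk) (hw k hk)
  refine (le_mul_pow_of_le_add_sum (by positivity) hrec le_rfl).trans ?_
  gcongr
  calc (1 + L * h) ^ K ≤ Real.exp (L * h) ^ K := by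
        gcongr
        rw [add_comm]
        exact Real.add_one_le_exp _
    _ = Real.exp (L * (K * h)) := by rw [← Real.exp_nat_mul]; congr 1; ring
    _ ≤ Real.exp (L * T) := by gcongr

end Euler

/-! ### The exploration as a perturbed Euler scheme -/

section Exploration
variable {d : DegreeSequence}

lemma rescaledOf_eq_potential (A : Finset (HalfEdge d)) :
    rescaledOf A = (d.size : ℝ)⁻¹ • ((potential vertexOf (legWeight 1) A,
      potential vertexOf (legWeight 2) A, potential vertexOf (legWeight 3) A) : ℝ × ℝ × ℝ) := by
  simp only [rescaledOf, card_legsOf, Prod.smul_mk, smul_eq_mul, div_eq_inv_mul]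

lemma norm_rescaledOf_le (A : Finset (HalfEdge d)) : ‖rescaledOf A‖ ≤ mass (rescaledOf A) := by
  have hnonneg : ∀ i, 0 ≤ ((legsOf A i).card : ℝ) / d.size := fun i => by positivity
  simp only [rescaledOf, mass, Prod.norm_def, Real.norm_of_nonneg (hnonneg _)]
  refine max_le ?_ (max_le ?_ ?_) <;> linarith [hnonneg 1, hnonneg 2, hnonneg 3]

lemma norm_rescaledOf_le_one (A : Finset (HalfEdge d)) : ‖rescaledOf A‖ ≤ 1 := by
  refine (norm_rescaledOf_le A).trans ?_
  rw [mass_rescaledOf]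
  exact div_le_one_of_le₀ (by exact_mod_cast (card_halfEdge d ▸ A.card_le_univ)) (by positivity)

lemma IsStep.norm_rescaledOf_sub_le {s s' : State d} (h : IsStep s s') :
    ‖rescaledOf s'.2 - rescaledOf s.2‖ ≤ 18 / d.size := by
  have hpot : ∀ i ≤ 3, |potential vertexOf (legWeight i) s'.2 -
      potential vertexOf (legWeight i) s.2| ≤ 18 := fun i hi =>
    (h.abs_potential_sub_le (legWeight_mem_Icc hi)).trans_eq (by norm_num)
  rw [rescaledOf_eq_potential, rescaledOf_eq_potential, ← smul_sub, norm_smul, norm_inv,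
    Real.norm_natCast, div_eq_inv_mul]
  gcongr
  exact max_le (hpot 1 (by norm_num)) (max_le (hpot 2 (by norm_num)) (hpot 3 le_rfl))

lemma IsTrajectory.norm_rescaledOf_sub_le {s : ℕ → State d} (hs : IsTrajectory s) {k l : ℕ}
    (hkl : k ≤ l) :
    ‖rescaledOf (s l).2 - rescaledOf (s k).2‖ ≤ 18 * ((l : ℝ) - k) / d.size := by
  induction l, hkl using Nat.le_induction with
  | base => simp
  | succ l _ ih =>
    calc _ ≤ 18 / d.size + 18 * ((l : ℝ) - k) / d.size :=
          (norm_sub_le_norm_sub_add_norm_sub _ (rescaledOf (s l).2) _).trans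
            (add_le_add (hs.step l).norm_rescaledOf_sub_le ih)
      _ = 18 * (((l + 1 : ℕ) : ℝ) - k) / d.size := by push_cast; ring

/-- The noise of the three rescaled counts. -/
noncomputable def rescaledNoise (s₀ : ℝ) (s : ℕ → State d) (k : ℕ) : ℝ × ℝ × ℝ :=
  (d.size : ℝ)⁻¹ • (noiseSum s₀ (legWeight 1) s k, noiseSum s₀ (legWeight 2) s k,
    noiseSum s₀ (legWeight 3) s k)

lemma rescaledOf_eq_add_rescaledNoise {s : ℕ → State d} {s₀ : ℝ} {k : ℕ}
    (hs : ∀ i < k, IsActive s₀ (s i).2) :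
    rescaledOf (s k).2 = rescaledOf (s 0).2 +
      ∑ i ∈ Finset.range k, (d.size : ℝ)⁻¹ • phi (rescaledOf (s i).2) + rescaledNoise s₀ s k := by
  induction k with
  | zero => ext <;> simp [rescaledNoise, noiseSum]
  | succ k ih =>
    have hact := hs k (by omega)
    have hne : (s k).2.Nonempty :=
      (Finset.nonempty_iff_ne_empty.2 hact.1).mono (Finset.filter_subset _ _)
    have hnoise : ∀ c, noiseSum s₀ c s (k + 1) = noiseSum s₀ c s k +
        (potential vertexOf c (s (k + 1)).2 - potential vertexOf c (s k).2 -
          meanDrift vertexOf c (s k).2) := fun c => by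
      rw [noiseSum, Finset.sum_range_succ, noise, if_pos hact]
      rfl
    have hk := ih fun i hi => hs i (by omega)
    rw [rescaledOf_eq_potential (s k).2] at hk
    rw [rescaledOf_eq_potential (s (k + 1)).2, Finset.sum_range_succ, phi_rescaledOf hne]
    simp only [rescaledNoise, hnoise, Prod.ext_iff, Prod.fst_add, Prod.snd_add, Prod.smul_fst,
      Prod.smul_snd, smul_eq_mul] at hk ⊢
    obtain ⟨hk₁, hk₂, hk₃⟩ := hk
    refine ⟨?_, ?_, ?_⟩ <;> simp only [mul_add, mul_sub] <;> linarith

lemma norm_rescaledNoise_le {s₀ ε : ℝ} {s : ℕ → State d} {k : ℕ} (hd : 0 < d.size)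
    (h : ∀ i ∈ Finset.Icc 1 3, |noiseSum s₀ (legWeight i) s k| ≤ ε * d.size) :
    ‖rescaledNoise s₀ s k‖ ≤ ε := by
  rw [rescaledNoise, norm_smul, norm_inv, Real.norm_natCast,
    inv_mul_le_iff₀ (by exact_mod_cast hd), mul_comm]
  exact max_le (h 1 (by decide)) (max_le (h 2 (by decide)) (h 3 (by decide)))

lemma norm_rescaledOf_sub_fluid_le (hd : 0 < d.size) {s : ℕ → State d}
    {γ : ℝ → ℝ × ℝ × ℝ} {T R δ ε : ℝ} {L : NNReal} (hR : 1 ≤ R)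
    (hL : LipschitzOnWith L phi (Metric.closedBall 0 R ∩ {u | δ ≤ mass u}))
    (hγD : ∀ t ∈ Set.Icc 0 T, γ t ∈ Metric.closedBall 0 R ∩ {u | δ ≤ mass u})
    (hγ : ∀ t ∈ Set.Icc 0 T, HasDerivAt γ (phi (γ t)) t)
    (hmod : ∀ a ∈ Set.Icc 0 T, ∀ b ∈ Set.Icc 0 T, |a - b| ≤ (d.size : ℝ)⁻¹ →
      ‖phi (γ a) - phi (γ b)‖ ≤ ε)
    (hinit : ‖rescaledOf (s 0).2 - γ 0‖ ≤ ε) {K : ℕ} (hK : (K : ℝ) ≤ T * d.size)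
    (hnoise : ∀ k ≤ K, ∀ i ∈ Finset.Icc 1 3,
      |noiseSum (δ * d.size) (legWeight i) s k| ≤ ε * d.size)
    (hs : ∀ i < K, IsActive (δ * d.size) (s i).2) :
    ‖rescaledOf (s K).2 - γ (K / d.size)‖ ≤ (2 + T) * ε * Real.exp (L * T) := by
  have hn : (0 : ℝ) < d.size := by exact_mod_cast hd
  have hmass : ∀ i < K, δ ≤ mass (rescaledOf (s i).2) := fun i hi => by
    rw [mass_rescaledOf, le_div_iff₀ hn]
    exact (hs i hi).2
  rw [div_eq_mul_inv]
  exact norm_euler_sub_le (u := fun i => rescaledOf (s i).2) hL hγD hγ hmod (by positivity) hinit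
    ((mul_inv_le_iff₀ hn).2 hK)
    (fun i hi => ⟨mem_closedBall_zero_iff.2 ((norm_rescaledOf_le_one _).trans hR), hmass i hi⟩)
    (fun k hk => rescaledOf_eq_add_rescaledNoise fun i hi => hs i (hi.trans_le hk))
    fun k hk => norm_rescaledNoise_le hd (hnoise k hk)

end Exploration

/-! ### Convergence as long as there are leaves -/

section Fluid
variable {γ : ℝ → ℝ × ℝ × ℝ} {T : ℝ}

lemma exists_norm_le_and_le_mass (hcont : Continuous γ) (hT : 0 ≤ T)
    (hmass : ∀ t ∈ Set.Icc 0 T, 0 < mass (γ t)) :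
    ∃ R δ : ℝ, 0 < δ ∧ ∀ t ∈ Set.Icc 0 T, ‖γ t‖ ≤ R ∧ 2 * δ ≤ mass (γ t) := by
  obtain ⟨t₀, ht₀, hmin⟩ := isCompact_Icc.exists_isMinOn (Set.nonempty_Icc.2 hT)
    (continuous_mass.comp hcont).continuousOn
  obtain ⟨R, hR⟩ := isCompact_Icc.exists_bound_of_continuousOn hcont.continuousOn
  refine ⟨R, mass (γ t₀) / 2, half_pos (hmass t₀ ht₀), fun t ht => ⟨hR t ht, ?_⟩⟩
  rw [mul_div_cancel₀ _ two_ne_zero]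
  exact hmin ht

lemma isActive_of_norm_rescaledOf_sub_le {d : DegreeSequence} (hd : 0 < d.size) {δ : ℝ}
    {s : ℕ → State d} {k : ℕ} (hmass : ∀ i < k, 2 * δ ≤ mass (γ (i / d.size)))
    (hlegs : ∀ i < k, legsOf (s i).2 1 ≠ ∅)
    (hclose : ∀ l < k, (∀ i < l, IsActive (δ * d.size) (s i).2) →
      ‖rescaledOf (s l).2 - γ (l / d.size)‖ ≤ δ / 3) :
    ∀ i < k, IsActive (δ * d.size) (s i).2 := by
  intro i
  induction i using Nat.strong_induction_on with
  | _ i ih =>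
    intro hik
    refine ⟨hlegs i hik, ?_⟩
    have hnorm := hclose i hik fun m hm => ih m hm (hm.trans hik)
    have hmass_sub := (abs_le.1 (abs_mass_sub_le (rescaledOf (s i).2) (γ (i / d.size)))).1
    rw [mass_rescaledOf] at hmass_sub
    rw [← le_div_iff₀ (by exact_mod_cast hd)]
    linarith [hmass i hik]

/-- Since the fluid limit has mass at least `2 * δ`, an exploration close to it has mass at least
`δ`, which is what the comparison needs in order to go on for one more step. -/
lemma exists_norm_rescaledOf_sub_fluid_le (hcont : Continuous γ) (hT : 0 ≤ T)
    (hmass : ∀ t ∈ Set.Icc 0 T, 0 < mass (γ t))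
    (hγ : ∀ t ∈ Set.Icc 0 T, HasDerivAt γ (phi (γ t)) t) {ε : ℝ} (hε : 0 < ε) :
    ∃ δ > 0, ∃ ε₁ > 0, ∃ n₀ : ℕ, ∀ (d : DegreeSequence) (s : ℕ → State d), n₀ ≤ d.size →
      ‖rescaledOf (s 0).2 - γ 0‖ ≤ ε₁ →
      ∀ k : ℕ, (k : ℝ) ≤ T * d.size → (∀ i < k, legsOf (s i).2 1 ≠ ∅) →
      (∀ l ≤ k, ∀ i ∈ Finset.Icc 1 3,
        |noiseSum (δ * d.size) (legWeight i) s l| ≤ ε₁ * d.size) →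
      ‖rescaledOf (s k).2 - γ (k / d.size)‖ ≤ ε := by
  obtain ⟨R, δ, hδ, hbound⟩ := exists_norm_le_and_le_mass hcont hT hmass
  obtain ⟨L, hL⟩ := exists_lipschitzOnWith_phi hδ (max 1 R)
  have hD : ∀ t ∈ Set.Icc 0 T, γ t ∈ Metric.closedBall 0 (max 1 R) ∩ {u | δ ≤ mass u} :=
    fun t ht => ⟨mem_closedBall_zero_iff.2 ((hbound t ht).1.trans (le_max_right _ _)),
      le_trans (by linarith) (hbound t ht).2⟩
  set ε₁ := min ε (δ / 3) / ((2 + T) * Real.exp (L * T)) with hε₁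
  have hε₁_pos : 0 < ε₁ := by positivity
  have hε₁_eq : (2 + T) * ε₁ * Real.exp (L * T) = min ε (δ / 3) := by rw [hε₁]; field_simp
  obtain ⟨ρ, hρ, huc⟩ := Metric.uniformContinuousOn_iff_le.1
    (isCompact_Icc.uniformContinuousOn_of_continuous
      (hL.continuousOn.comp hcont.continuousOn hD)) ε₁ hε₁_pos
  refine ⟨δ, hδ, ε₁, hε₁_pos, ⌈ρ⁻¹⌉₊, fun d s hn hinit k hkT hlegs hnoise => ?_⟩
  have hn_inv : ρ⁻¹ ≤ (d.size : ℝ) := (Nat.le_ceil _).trans (by exact_mod_cast hn)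
  have hn_pos : (0 : ℝ) < d.size := (inv_pos.2 hρ).trans_le hn_inv
  have hd : 0 < d.size := by exact_mod_cast hn_pos
  have hclose : ∀ l ≤ k, (∀ i < l, IsActive (δ * d.size) (s i).2) →
      ‖rescaledOf (s l).2 - γ (l / d.size)‖ ≤ min ε (δ / 3) := by
    intro l hl hactive
    rw [← hε₁_eq]
    refine norm_rescaledOf_sub_fluid_le hd (le_max_left 1 R) hL hD hγ (fun a ha b hb hab => ?_)
      hinit (le_trans (by gcongr) hkT) (fun m hm => hnoise m (hm.trans hl)) hactive
    simpa only [dist_eq_norm, Function.comp_apply] using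
      huc a ha b hb (hab.trans (inv_le_of_inv_le₀ hρ hn_inv))
  refine (hclose k le_rfl (isActive_of_norm_rescaledOf_sub_le (γ := γ) hd (fun i hi => ?_) hlegs
    fun l hl hactive => (hclose l hl.le hactive).trans (min_le_right _ _))).trans (min_le_left _ _)
  refine (hbound _ ⟨by positivity, (div_le_iff₀ hn_pos).2 (le_trans ?_ hkT)⟩).2
  exact_mod_cast hi.le

end Fluid

section Convergence
variable {d : ℕ → DegreeSequence} {Ω : ℕ → Type*} [∀ j, MeasurableSpace (Ω j)]
  {P : ∀ j, Measure (Ω j)} [∀ j, IsProbabilityMeasure (P j)] {ξ : ∀ j, ℕ → Ω j → State (d j)}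
  {γ : ℝ → ℝ × ℝ × ℝ} {T ε : ℝ}

lemma tendsto_measure_noiseSum (hsize : Tendsto (fun j => (d j).size) atTop atTop)
    (hξ : ∀ j, IsExploration (P j) (d j) (ξ j)) {δ : ℝ} (hδ : 0 < δ) (hε : 0 < ε) :
    Tendsto (fun j => P j {ω | ∃ i ∈ Finset.Icc 1 3, ∃ k : ℕ, (k : ℝ) ≤ T * (d j).size ∧
      ε * (d j).size <
        |noiseSum (δ * (d j).size) (legWeight i) (fun l => ξ j l ω) k|}) atTop (𝓝 0) := by
  obtain ⟨C, n₀, hC⟩ := exists_measure_noiseSum_le (T := T) hδ hε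
  have hsizeR : Tendsto (fun j => ((d j).size : ℝ)) atTop atTop :=
    tendsto_natCast_atTop_atTop.comp hsize
  have hlim : Tendsto (fun j => ∑ _i ∈ Finset.Icc (1 : ℕ) 3, ENNReal.ofReal (C / (d j).size))
      atTop (𝓝 0) := by
    simpa using tendsto_finsetSum (Finset.Icc (1 : ℕ) 3) fun _ _ =>
      ENNReal.tendsto_ofReal (hsizeR.const_div_atTop C)
  refine tendsto_nhds_bot_mono hlim ?_
  filter_upwards [hsizeR.eventually_ge_atTop n₀] with j hj
  set bad : ℕ → Set (Ω j) := fun i => {ω | ∃ k : ℕ, (k : ℝ) ≤ T * (d j).size ∧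
    ε * (d j).size < |noiseSum (δ * (d j).size) (legWeight i) (fun l => ξ j l ω) k|}
  calc _ ≤ P j (⋃ i ∈ Finset.Icc 1 3, bad i) := measure_mono <| by
        rintro ω ⟨i, hi, hbad⟩
        exact Set.mem_iUnion₂.2 ⟨i, hi, hbad⟩
    _ ≤ ∑ i ∈ Finset.Icc 1 3, P j (bad i) := measure_biUnion_finset_le _ _
    _ ≤ _ := Finset.sum_le_sum fun i hi => hC (d j) (Ω j) (P j) (ξ j) (hξ j) hj (legWeight i)
        (legWeight_zero i) (legWeight_mem_Icc (Finset.mem_Icc.1 hi).2)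

lemma tendsto_measure_fluid (hsize : Tendsto (fun j => (d j).size) atTop atTop)
    (hξ : ∀ j, IsExploration (P j) (d j) (ξ j))
    (hinit : Tendsto (fun j => rescaledOf (Finset.univ : Finset (HalfEdge (d j)))) atTop (𝓝 (γ 0)))
    (hcont : Continuous γ) (hT : 0 ≤ T) (hmass : ∀ t ∈ Set.Icc 0 T, 0 < mass (γ t))
    (hγ : ∀ t ∈ Set.Icc 0 T, HasDerivAt γ (phi (γ t)) t) (hε : 0 < ε) :
    Tendsto (fun j => P j {ω | ∃ k : ℕ, (k : ℝ) ≤ T * (d j).size ∧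
      (∀ i < k, legsOf (ξ j i ω).2 1 ≠ ∅) ∧
      ε < ‖rescaledOf (ξ j k ω).2 - γ (k / (d j).size)‖}) atTop (𝓝 0) := by
  obtain ⟨δ, hδ, ε₁, hε₁, n₀, hcomp⟩ :=
    exists_norm_rescaledOf_sub_fluid_le hcont hT hmass hγ hε
  refine tendsto_nhds_bot_mono (tendsto_measure_noiseSum (T := T) hsize hξ hδ hε₁) ?_
  filter_upwards [hsize.eventually_ge_atTop n₀,
    hinit.eventually (Metric.closedBall_mem_nhds _ hε₁)] with j hn hj
  refine measure_mono_ae ?_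
  filter_upwards [(hξ j).ae_isTrajectory] with ω hω
  rintro ⟨k, hkT, hlegs, hkε⟩
  by_contra hsmall
  refine hkε.not_ge (hcomp (d j) (fun l => ξ j l ω) hn ?_ k hkT hlegs fun l hl i hi => ?_)
  · rw [hω.initial]
    exact mem_closedBall_iff_norm.1 hj
  · by_contra hlarge
    exact hsmall ⟨i, hi, l, le_trans (by gcongr) hkT, not_le.1 hlarge⟩

lemma tendsto_measure_fluid_floor (hsize : Tendsto (fun j => (d j).size) atTop atTop)
    (hξ : ∀ j, IsExploration (P j) (d j) (ξ j))
    (hinit : Tendsto (fun j => rescaledOf (Finset.univ : Finset (HalfEdge (d j)))) atTop (𝓝 (γ 0)))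
    (hcont : Continuous γ) (hT : 0 ≤ T) (hmass : ∀ t ∈ Set.Icc 0 T, 0 < mass (γ t))
    (hγ : ∀ t ∈ Set.Icc 0 T, HasDerivAt γ (phi (γ t)) t) (hε : 0 < ε) :
    Tendsto (fun j => P j {ω | (∀ i : ℕ, (i : ℝ) ≤ T * (d j).size → legsOf (ξ j i ω).2 1 ≠ ∅) ∧
      ε < ‖rescaledOf (ξ j ⌊T * (d j).size⌋₊ ω).2 - γ T‖}) atTop (𝓝 0) := by
  have htime : Tendsto (fun j => (⌊T * (d j).size⌋₊ / (d j).size : ℝ)) atTop (𝓝 T) :=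
    (tendsto_nat_floor_mul_div_atTop hT).comp (tendsto_natCast_atTop_atTop.comp hsize)
  refine tendsto_nhds_bot_mono
    (tendsto_measure_fluid hsize hξ hinit hcont hT hmass hγ (half_pos hε)) ?_
  filter_upwards [((hcont.tendsto T).comp htime).eventually
    (Metric.closedBall_mem_nhds _ (half_pos hε))] with j hj
  refine measure_mono fun ω ⟨hlegs, hfar⟩ => ?_
  have hfloor : (⌊T * (d j).size⌋₊ : ℝ) ≤ T * (d j).size := Nat.floor_le (by positivity)
  refine ⟨_, hfloor, fun i hi => hlegs i (le_trans (by exact_mod_cast hi.le) hfloor), ?_⟩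
  have htri := norm_sub_le_norm_sub_add_norm_sub (rescaledOf (ξ j ⌊T * (d j).size⌋₊ ω).2)
    (γ (⌊T * (d j).size⌋₊ / (d j).size)) (γ T)
  have hnear := mem_closedBall_iff_norm.1 hj
  simp only [Function.comp_apply] at hnear
  linarith

end Convergence

/-! ### Extinction -/

section Exploration
variable {d : DegreeSequence}

lemma rescaledOf_univ : rescaledOf (Finset.univ : Finset (HalfEdge d)) =
    ((d.d₁ : ℝ) / d.size, (2 * d.d₂ : ℝ) / d.size, (3 * d.d₃ : ℝ) / d.size) := by
  have hcard : ∀ i : ℕ, ((legsOf (Finset.univ : Finset (HalfEdge d)) i).card : ℝ) =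
      d.d₁ * legWeight i 1 + (d.d₂ * legWeight i 2 + d.d₃ * legWeight i 3) := by
    intro i
    rw [card_legsOf, potential, Finset.sum_congr rfl fun v _ => by rw [deg_univ]]
    simp [Fintype.sum_sum_type, Vertex.degree]
  simp only [rescaledOf, hcard]
  norm_num [legWeight]
  exact ⟨by ring, by ring⟩

lemma legsOf_ne_empty_of_fst_rescaledOf_pos {A : Finset (HalfEdge d)} (h : 0 < (rescaledOf A).1) :
    legsOf A 1 ≠ ∅ := by
  rintro hempty
  simp [rescaledOf, hempty] at h

lemma IsTrajectory.exists_legsOf_eq_empty {s : ℕ → State d} (hs : IsTrajectory s) {k : ℕ} {a : ℝ}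
    (ha : 0 ≤ a) (hcard : ((s k).2.card : ℝ) < 2 * (a - k)) :
    ∃ i : ℕ, (i : ℝ) ≤ a ∧ legsOf (s i).2 1 = ∅ := by
  by_contra! hlegs
  have hka : (k : ℝ) ≤ a := by linarith [Nat.cast_nonneg (α := ℝ) (s k).2.card]
  have hk : k ≤ ⌊a⌋₊ := Nat.le_floor hka
  have hdecrease := hs.card_add_le k (⌊a⌋₊ + 1 - k) fun i _ hi =>
    Finset.nonempty_iff_ne_empty.1 <| hlegs i <| (Nat.le_floor_iff ha).1 (by omega)
  have hle : 2 * ((⌊a⌋₊ : ℝ) + 1) ≤ (s k).2.card + 2 * k := by exact_mod_cast (by omega)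
  linarith [Nat.lt_floor_add_one a]

variable {γ : ℝ → ℝ × ℝ × ℝ}

lemma legsOf_ne_empty_of_close {s : ℕ → State d} {b m : ℝ}
    (hb : ∀ t ∈ Set.Ico 0 m, b < (γ t).1)
    (hclose : ∀ k : ℕ, (k : ℝ) ≤ m * d.size → (∀ i < k, legsOf (s i).2 1 ≠ ∅) →
      ‖rescaledOf (s k).2 - γ (k / d.size)‖ ≤ b) {k : ℕ} (hk : (k : ℝ) < m * d.size) :
    legsOf (s k).2 1 ≠ ∅ := by
  induction k using Nat.strong_induction_on with
  | _ k ih =>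
    have hn : (0 : ℝ) < d.size := by
      refine (Nat.cast_nonneg _).lt_of_ne fun hn => ?_
      rw [← hn, mul_zero] at hk
      exact hk.not_ge (Nat.cast_nonneg k)
    have hnorm := hclose k hk.le fun i hi => ih i hi (lt_trans (by exact_mod_cast hi) hk)
    have hfst : b < (γ (k / d.size)).1 := hb _ ⟨by positivity, (div_lt_iff₀ hn).2 hk⟩
    have hfst_sub := (abs_le.1 ((norm_fst_le _).trans hnorm)).1
    rw [Prod.fst_sub] at hfst_sub
    exact legsOf_ne_empty_of_fst_rescaledOf_pos (by linarith)

end Exploration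

namespace IsExtendedFluidSolution
variable {p : ℝ × ℝ × ℝ} {tExt : ℝ} {γ : ℝ → ℝ × ℝ × ℝ} {η : ℝ}

lemma mass_pos_of_le_max (hγ : IsExtendedFluidSolution p tExt γ) (hp : 0 < mass p) (hη : 0 < η)
    {t : ℝ} (ht : t ∈ Set.Icc 0 (max (tExt - η) 0)) : 0 < mass (γ t) := by
  rcases ht.1.eq_or_lt with rfl | ht₀
  · rwa [hγ.initial]
  · have ht_lt : t < tExt := by
      rcases le_max_iff.1 ht.2 with hle | hle <;> linarith
    exact (hγ.pos t ⟨ht.1, ht_lt⟩).2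

lemma exists_lt_fst (hγ : IsExtendedFluidSolution p tExt γ) (hη : 0 < η) :
    ∃ b > 0, ∀ t ∈ Set.Ico 0 (max (tExt - η) 0), b < (γ t).1 := by
  rcases le_or_gt (tExt - η) 0 with hle | hlt
  · refine ⟨1, one_pos, fun t ht => ?_⟩
    rw [max_eq_right hle, Set.Ico_self] at ht
    exact ht.elim
  rw [max_eq_left hlt.le]
  obtain ⟨t₀, ht₀, hmin⟩ := isCompact_Icc.exists_isMinOn (Set.nonempty_Icc.2 hlt.le)
    (continuous_fst.comp hγ.continuous).continuousOn
  have hpos := (hγ.pos t₀ ⟨ht₀.1, by linarith [ht₀.2]⟩).1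
  exact ⟨(γ t₀).1 / 2, half_pos hpos, fun t ht => (half_lt_self hpos).trans_le <|
    hmin (Set.Ico_subset_Icc_self ht)⟩

lemma exists_mass_lt_of_dies (hγ : IsExtendedFluidSolution p tExt γ) (hp : 0 < mass p)
    (hdies : γ tExt = 0) (hη : 0 < η) : ∃ T ∈ Set.Ico 0 tExt, mass (γ T) < η := by
  have htExt : 0 < tExt := by
    refine hγ.nonneg.lt_of_ne fun h => ?_
    rw [← h, hγ.initial] at hdies
    simp [hdies, mass] at hp
  have hlim : Tendsto (fun t => mass (γ t)) (𝓝[<] tExt) (𝓝 0) := by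
    have hmass : mass (γ tExt) = 0 := by simp [hdies, mass]
    rw [← hmass]
    exact ((continuous_mass.comp hγ.continuous).tendsto tExt).mono_left nhdsWithin_le_nhds
  obtain ⟨T, hmass, hT⟩ := ((hlim.eventually_lt_const hη).and (Ico_mem_nhdsLT htExt)).exists
  exact ⟨T, hT, hmass⟩

end IsExtendedFluidSolution

section Convergence
variable {d : ℕ → DegreeSequence} {Ω : ℕ → Type*} [∀ j, MeasurableSpace (Ω j)]
  {P : ∀ j, Measure (Ω j)} [∀ j, IsProbabilityMeasure (P j)] {ξ : ∀ j, ℕ → Ω j → State (d j)}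
  {p : ℝ × ℝ × ℝ} {tExt η : ℝ} {γ : ℝ → ℝ × ℝ × ℝ}

/-- If the fluid limit dies at the origin, then few half-edges are left shortly before its
extinction, and they cannot keep the exploration alive for long. -/
lemma tendsto_measure_not_dead_of_dies (hsize : Tendsto (fun j => (d j).size) atTop atTop)
    (hξ : ∀ j, IsExploration (P j) (d j) (ξ j)) (hγ : IsExtendedFluidSolution p tExt γ)
    (hp : 0 < mass p)
    (hinit : Tendsto (fun j => rescaledOf (Finset.univ : Finset (HalfEdge (d j)))) atTop (𝓝 p))
    (hdies : γ tExt = 0) (hη : 0 < η) :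
    Tendsto (fun j => P j {ω | ∀ k : ℕ, (k : ℝ) ≤ (tExt + η) * (d j).size →
      legsOf (ξ j k ω).2 1 ≠ ∅}) atTop (𝓝 0) := by
  obtain ⟨T, hT, hmassT⟩ := hγ.exists_mass_lt_of_dies hp hdies hη
  have hpos : ∀ t ∈ Set.Icc 0 T, 0 < mass (γ t) := fun t ht =>
    (hγ.pos t ⟨ht.1, ht.2.trans_lt hT.2⟩).2
  refine tendsto_nhds_bot_mono (tendsto_measure_fluid_floor hsize hξ (hγ.initial ▸ hinit)
    hγ.continuous hT.1 hpos (fun t ht => hγ.hasDerivAt t ht.1 (hpos t ht)) (ε := η / 3)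
    (by positivity)) ?_
  filter_upwards [hsize.eventually_gt_atTop 0] with j hj
  have hn : (0 : ℝ) < (d j).size := by exact_mod_cast hj
  refine measure_mono_ae ?_
  filter_upwards [(hξ j).ae_isTrajectory] with ω hω
  intro hlegs
  refine ⟨fun i hi => hlegs i (hi.trans (by gcongr; linarith [hT.2])), ?_⟩
  by_contra! hnear
  set k := ⌊T * (d j).size⌋₊
  have hk : (k : ℝ) ≤ T * (d j).size := Nat.floor_le (mul_nonneg hT.1 hn.le)
  have hmass_sub := (abs_le.1 (abs_mass_sub_le (rescaledOf (ξ j k ω).2) (γ T))).2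
  have hcard : ((ξ j k ω).2.card : ℝ) < 2 * η * (d j).size := by
    rw [← div_lt_iff₀ hn, ← mass_rescaledOf]
    linarith
  obtain ⟨i, hi, hempty⟩ := hω.exists_legsOf_eq_empty (k := k) (a := (tExt + η) * (d j).size)
    (mul_nonneg (by linarith [hγ.nonneg]) hn.le) (by nlinarith [hT.2])
  exact hlegs i hi hempty

/-- If the first coordinate of the fluid limit becomes negative shortly after its extinction, then
the exploration cannot follow the fluid limit until then. -/
lemma tendsto_measure_not_dead_of_crosses (hsize : Tendsto (fun j => (d j).size) atTop atTop)
    (hξ : ∀ j, IsExploration (P j) (d j) (ξ j)) (hγ : IsExtendedFluidSolution p tExt γ)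
    (hinit : Tendsto (fun j => rescaledOf (Finset.univ : Finset (HalfEdge (d j)))) atTop (𝓝 p))
    {T : ℝ} (hT : T ∈ Set.Ioo tExt (tExt + η)) (hneg : (γ T).1 < 0)
    (hmass : ∀ t ∈ Set.Icc 0 T, 0 < mass (γ t)) :
    Tendsto (fun j => P j {ω | ∀ k : ℕ, (k : ℝ) ≤ (tExt + η) * (d j).size →
      legsOf (ξ j k ω).2 1 ≠ ∅}) atTop (𝓝 0) := by
  refine tendsto_nhds_bot_mono (tendsto_measure_fluid_floor hsize hξ (hγ.initial ▸ hinit)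
    hγ.continuous (hγ.nonneg.trans hT.1.le) hmass
    (fun t ht => hγ.hasDerivAt t ht.1 (hmass t ht)) (ε := -(γ T).1 / 2) (by linarith)) ?_
  refine Eventually.of_forall fun j => measure_mono fun ω hlegs =>
    ⟨fun i hi => hlegs i (hi.trans (by gcongr; exact hT.2.le)), ?_⟩
  set A := (ξ j ⌊T * (d j).size⌋₊ ω).2
  have hnonneg : 0 ≤ (rescaledOf A).1 := by simp only [rescaledOf]; positivity
  have hfst_sub := (le_abs_self _).trans (norm_fst_le (rescaledOf A - γ T))
  rw [Prod.fst_sub] at hfst_sub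
  linarith

lemma tendsto_measure_not_dead (hsize : Tendsto (fun j => (d j).size) atTop atTop)
    (hξ : ∀ j, IsExploration (P j) (d j) (ξ j)) (hγ : IsExtendedFluidSolution p tExt γ)
    (hp : 0 < mass p)
    (hinit : Tendsto (fun j => rescaledOf (Finset.univ : Finset (HalfEdge (d j)))) atTop (𝓝 p))
    (hη : 0 < η) :
    Tendsto (fun j => P j {ω | ∀ k : ℕ, (k : ℝ) ≤ (tExt + η) * (d j).size →
      legsOf (ξ j k ω).2 1 ≠ ∅}) atTop (𝓝 0) := by
  rcases hγ.dies_or_crosses with hdies | hcrosses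
  · exact tendsto_measure_not_dead_of_dies hsize hξ hγ hp hinit hdies hη
  · obtain ⟨T, hT, hneg, hmass⟩ := hcrosses η hη
    exact tendsto_measure_not_dead_of_crosses hsize hξ hγ hinit hT hneg hmass

/-- The trajectory `s` follows the curve `γ` until shortly before its extinction time `tExt`, and
dies out shortly after; the event whose probability tends to `1`. -/
structure FollowsFluid {d : DegreeSequence} (s : ℕ → State d) (γ : ℝ → ℝ × ℝ × ℝ)
    (tExt η ε : ℝ) : Prop where
  isTrajectory : IsTrajectory s
  close : ∀ k : ℕ, (k : ℝ) ≤ max (tExt - η) 0 * d.size →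
    ‖rescaledOf (s k).2 - γ (k / d.size)‖ ≤ ε
  alive : ∀ k : ℕ, (k : ℝ) < max (tExt - η) 0 * d.size → legsOf (s k).2 1 ≠ ∅
  dead : ∃ k : ℕ, (k : ℝ) ≤ (tExt + η) * d.size ∧ legsOf (s k).2 1 = ∅

lemma tendsto_measure_not_followsFluid (hsize : Tendsto (fun j => (d j).size) atTop atTop)
    (hξ : ∀ j, IsExploration (P j) (d j) (ξ j)) (hγ : IsExtendedFluidSolution p tExt γ)
    (hp : 0 < mass p)
    (hinit : Tendsto (fun j => rescaledOf (Finset.univ : Finset (HalfEdge (d j)))) atTop (𝓝 p))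
    (hη : 0 < η) {ε : ℝ} (hε : 0 < ε) :
    Tendsto (fun j => P j {ω | ¬ FollowsFluid (fun k => ξ j k ω) γ tExt η ε}) atTop (𝓝 0) := by
  set m := max (tExt - η) 0
  obtain ⟨b, hb, hbγ⟩ := hγ.exists_lt_fst hη
  have hmass : ∀ t ∈ Set.Icc 0 m, 0 < mass (γ t) := fun t => hγ.mass_pos_of_le_max hp hη
  have hfar := tendsto_measure_fluid hsize hξ (hγ.initial ▸ hinit) hγ.continuous
    (le_max_right _ _) hmass (fun t ht => hγ.hasDerivAt t ht.1 (hmass t ht)) (lt_min hε hb)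
  have hbad := hfar.add (tendsto_measure_not_dead hsize hξ hγ hp hinit hη)
  rw [add_zero] at hbad
  refine tendsto_nhds_bot_mono hbad (Eventually.of_forall fun j =>
    le_trans (measure_mono_ae ?_) (measure_union_le _ _))
  filter_upwards [(hξ j).ae_isTrajectory] with ω hω
  intro hnot
  by_contra hgood
  obtain ⟨hnear, hdies⟩ := not_or.1 hgood
  have hclose : ∀ k : ℕ, (k : ℝ) ≤ m * (d j).size → (∀ i < k, legsOf (ξ j i ω).2 1 ≠ ∅) →
      ‖rescaledOf (ξ j k ω).2 - γ (k / (d j).size)‖ ≤ min ε b := fun k hk hlegs =>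
    not_lt.1 fun hlt => hnear ⟨k, hk, hlegs, hlt⟩
  have halive : ∀ k : ℕ, (k : ℝ) < m * (d j).size → legsOf (ξ j k ω).2 1 ≠ ∅ := fun k =>
    legsOf_ne_empty_of_close (s := fun k => ξ j k ω) hbγ
      fun k hk hlegs => (hclose k hk hlegs).trans (min_le_right _ _)
  refine hnot ⟨hω, fun k hk => ?_, halive, ?_⟩
  · exact (hclose k hk fun i hi => halive i (lt_of_lt_of_le (by exact_mod_cast hi) hk)).trans
      (min_le_left _ _)
  · by_contra! hlegs
    exact hdies fun k hk => Finset.nonempty_iff_ne_empty.1 (hlegs k hk)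

end Convergence

/-! ### Convergence of the exploration -/

lemma natFloor_mul_div_mem_Icc {t n : ℝ} (ht : 0 ≤ t) (hn : 0 < n) :
    (⌊t * n⌋₊ : ℝ) / n ∈ Set.Icc (t - n⁻¹) t := by
  constructor
  · rw [le_div_iff₀ hn, sub_mul, inv_mul_cancel₀ hn.ne']
    linarith [Nat.lt_floor_add_one (t * n)]
  · rw [div_le_iff₀ hn]
    exact Nat.floor_le (mul_nonneg ht hn.le)

namespace FollowsFluid
variable {d : DegreeSequence} {s : ℕ → State d} {γ : ℝ → ℝ × ℝ × ℝ} {tExt η ε : ℝ}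

lemma abs_extinctionTime_sub_le {Ω : Type*} {ξ : ℕ → Ω → State d} {ω : Ω}
    (h : FollowsFluid (fun k => ξ k ω) γ tExt η ε) (hd : 0 < d.size) :
    |(extinctionTime ξ ω : ℝ) / d.size - tExt| ≤ η := by
  have hn : (0 : ℝ) < d.size := by exact_mod_cast hd
  obtain ⟨k, hk, hdead⟩ := h.dead
  have hmem : k ∈ {k : ℕ | (State.legs (ξ k ω) 1).card = 0} := Finset.card_eq_zero.2 hdead
  have hle : (extinctionTime ξ ω : ℝ) ≤ k := by exact_mod_cast Nat.sInf_le hmem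
  have hempty : legsOf (ξ (extinctionTime ξ ω) ω).2 1 = ∅ :=
    Finset.card_eq_zero.1 (Nat.sInf_mem ⟨k, hmem⟩)
  have hge : max (tExt - η) 0 * d.size ≤ extinctionTime ξ ω :=
    not_lt.1 fun hlt => h.alive _ hlt hempty
  have hlower := (le_max_left _ _).trans ((le_div_iff₀ hn).2 hge)
  have hupper := (div_le_iff₀ hn).2 (hle.trans hk)
  exact abs_le.2 ⟨by linarith, by linarith⟩

lemma norm_rescaledOf_sub_le_of_le (h : FollowsFluid s γ tExt η ε) (hd : 0 < d.size)
    (hmod : ∀ a ∈ Set.Icc 0 tExt, ∀ b ∈ Set.Icc 0 tExt, |a - b| ≤ (d.size : ℝ)⁻¹ + η →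
      ‖γ a - γ b‖ ≤ ε) {r t : ℝ} (hr : r ∈ Set.Icc 0 (max (tExt - η) 0))
    (ht : t ∈ Set.Icc r (r + η)) (htExt : t ≤ tExt) :
    ‖rescaledOf (s ⌊r * d.size⌋₊).2 - γ t‖ ≤ 2 * ε := by
  have hn : (0 : ℝ) < d.size := by exact_mod_cast hd
  obtain ⟨hlower, hupper⟩ := natFloor_mul_div_mem_Icc hr.1 hn
  have hclose := h.close ⌊r * d.size⌋₊ <|
    (Nat.floor_le (mul_nonneg hr.1 hn.le)).trans (by gcongr; exact hr.2)
  have hmove := hmod (⌊r * d.size⌋₊ / d.size) ⟨by positivity, by linarith [ht.1]⟩ t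
    ⟨hr.1.trans ht.1, htExt⟩ (abs_le.2 ⟨by linarith [ht.2], by
      linarith [ht.1, ht.2, inv_pos.2 hn]⟩)
  linarith [norm_sub_le_norm_sub_add_norm_sub (rescaledOf (s ⌊r * d.size⌋₊).2)
    (γ (⌊r * d.size⌋₊ / d.size)) (γ t)]

/-- Only the at most `(2 η + n⁻¹) n` steps before the trajectory freezes can change its state. -/
lemma norm_rescaledOf_sub_le_of_ge (h : FollowsFluid s γ tExt η ε) (hd : 0 < d.size) {t : ℝ}
    (ht : max (tExt - η) 0 ≤ t) :
    ‖rescaledOf (s ⌊t * d.size⌋₊).2 - rescaledOf (s ⌊max (tExt - η) 0 * d.size⌋₊).2‖ ≤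
      18 * (2 * η + (d.size : ℝ)⁻¹) := by
  set m := max (tExt - η) 0
  have hn : (0 : ℝ) < d.size := by exact_mod_cast hd
  have hm : 0 ≤ m := le_max_right _ _
  obtain ⟨k, hk, hdead⟩ := h.dead
  have hmk : ⌊m * d.size⌋₊ ≤ k := Nat.floor_le_of_le <| not_lt.1 fun hlt => h.alive k hlt hdead
  have hmt : ⌊m * d.size⌋₊ ≤ ⌊t * d.size⌋₊ := Nat.floor_le_floor (by gcongr)
  have hfreeze : s ⌊t * d.size⌋₊ = s (min ⌊t * d.size⌋₊ k) := by
    rcases le_total ⌊t * d.size⌋₊ k with hle | hle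
    · rw [min_eq_left hle]
    · rw [min_eq_right hle, h.isTrajectory.frozen hdead hle]
  have hmin : ((min ⌊t * d.size⌋₊ k : ℕ) : ℝ) / d.size ≤ tExt + η :=
    (div_le_iff₀ hn).2 (le_trans (by exact_mod_cast min_le_right _ _) hk)
  rw [hfreeze]
  refine (h.isTrajectory.norm_rescaledOf_sub_le (le_min hmt hmk)).trans ?_
  rw [mul_div_assoc, sub_div]
  gcongr
  linarith [le_max_left (tExt - η) 0, (natFloor_mul_div_mem_Icc hm hn).1]

lemma norm_rescaledOf_sub_le (h : FollowsFluid s γ tExt η ε) (hd : 0 < d.size)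
    (htExt : 0 ≤ tExt) (hη : 0 ≤ η)
    (hmod : ∀ a ∈ Set.Icc 0 tExt, ∀ b ∈ Set.Icc 0 tExt, |a - b| ≤ (d.size : ℝ)⁻¹ + η →
      ‖γ a - γ b‖ ≤ ε) {t : ℝ} (ht : 0 ≤ t) :
    ‖rescaledOf (s ⌊t * d.size⌋₊).2 - γ (min t tExt)‖ ≤
      2 * ε + 18 * (2 * η + (d.size : ℝ)⁻¹) := by
  set m := max (tExt - η) 0
  have hm : 0 ≤ m := le_max_right _ _
  have hmExt : m ≤ tExt := max_le (by linarith) htExt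
  have hinv : 0 ≤ (d.size : ℝ)⁻¹ := by positivity
  rcases le_total t m with htm | hmt
  · rw [min_eq_left (htm.trans hmExt)]
    linarith [h.norm_rescaledOf_sub_le_of_le hd hmod ⟨ht, htm⟩ ⟨le_rfl, by linarith⟩
      (htm.trans hmExt)]
  · have hbefore := h.norm_rescaledOf_sub_le_of_le hd hmod ⟨hm, le_rfl⟩ (t := min t tExt)
      ⟨le_min hmt hmExt, (min_le_right _ _).trans (by linarith [le_max_left (tExt - η) 0])⟩
      (min_le_right _ _)
    linarith [h.norm_rescaledOf_sub_le_of_ge hd hmt, norm_sub_le_norm_sub_add_norm_sub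
      (rescaledOf (s ⌊t * d.size⌋₊).2) (rescaledOf (s ⌊m * d.size⌋₊).2) (γ (min t tExt))]

end FollowsFluid

section Convergence
variable {d : ℕ → DegreeSequence} {p : ℝ × ℝ × ℝ}

lemma mass_eq_one_of_tendsto (hsize : Tendsto (fun j => (d j).size) atTop atTop)
    (hinit : Tendsto (fun j => rescaledOf (Finset.univ : Finset (HalfEdge (d j)))) atTop (𝓝 p)) :
    mass p = 1 := by
  refine tendsto_nhds_unique ((continuous_mass.tendsto p).comp hinit)
    (tendsto_const_nhds.congr' ?_)
  filter_upwards [hsize.eventually_gt_atTop 0] with j hj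
  have hn : ((d j).size : ℝ) ≠ 0 := by positivity
  rw [Function.comp_apply, mass_rescaledOf, Finset.card_univ, card_halfEdge, div_self hn]

variable {Ω : ℕ → Type*} [∀ j, MeasurableSpace (Ω j)]
  {P : ∀ j, Measure (Ω j)} [∀ j, IsProbabilityMeasure (P j)] {ξ : ∀ j, ℕ → Ω j → State (d j)}
  {tExt : ℝ} {γ : ℝ → ℝ × ℝ × ℝ}

lemma tendsto_measure_lt_dist (hsize : Tendsto (fun j => (d j).size) atTop atTop)
    (hξ : ∀ j, IsExploration (P j) (d j) (ξ j)) (hγ : IsExtendedFluidSolution p tExt γ)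
    (hp : 0 < mass p)
    (hinit : Tendsto (fun j => rescaledOf (Finset.univ : Finset (HalfEdge (d j)))) atTop (𝓝 p))
    {ε : ℝ} (hε : 0 < ε) :
    Tendsto (fun j => P j {ω | ∃ t : ℝ, 0 ≤ t ∧
      ε < dist (ξ j ⌊t * (d j).size⌋₊ ω).rescaled (γ (min t tExt))}) atTop (𝓝 0) := by
  obtain ⟨ρ, hρ, hmod⟩ := Metric.uniformContinuousOn_iff_le.1
    (isCompact_Icc.uniformContinuousOn_of_continuous hγ.continuous.continuousOn) (ε / 4)
    (by positivity)
  set η := min (ρ / 2) (ε / 144)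
  have hη : 0 < η := by positivity
  have hηρ : η ≤ ρ / 2 := min_le_left _ _
  have hηε : η ≤ ε / 144 := min_le_right _ _
  refine tendsto_nhds_bot_mono (tendsto_measure_not_followsFluid hsize hξ hγ hp hinit hη
    (ε := ε / 4) (by positivity)) ?_
  have hinv : Tendsto (fun j => ((d j).size : ℝ)⁻¹) atTop (𝓝 0) :=
    tendsto_inv_atTop_zero.comp (tendsto_natCast_atTop_atTop.comp hsize)
  filter_upwards [hsize.eventually_gt_atTop 0, hinv.eventually_lt_const hη] with j hj hjη
  refine measure_mono ?_
  rintro ω ⟨t, ht, hlt⟩ hfollows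
  rw [dist_eq_norm] at hlt
  refine hlt.not_ge ((hfollows.norm_rescaledOf_sub_le hj hγ.nonneg hη.le
    (fun a ha b hb hab => ?_) ht).trans (by linarith))
  exact dist_eq_norm (γ a) (γ b) ▸ hmod a ha b hb (hab.trans (by linarith))

lemma tendsto_measure_lt_abs_extinctionTime_sub
    (hsize : Tendsto (fun j => (d j).size) atTop atTop)
    (hξ : ∀ j, IsExploration (P j) (d j) (ξ j)) (hγ : IsExtendedFluidSolution p tExt γ)
    (hp : 0 < mass p)
    (hinit : Tendsto (fun j => rescaledOf (Finset.univ : Finset (HalfEdge (d j)))) atTop (𝓝 p))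
    {ε : ℝ} (hε : 0 < ε) :
    Tendsto (fun j => P j {ω | ε < |(extinctionTime (ξ j) ω : ℝ) / (d j).size - tExt|})
      atTop (𝓝 0) := by
  refine tendsto_nhds_bot_mono
    (tendsto_measure_not_followsFluid hsize hξ hγ hp hinit hε one_pos) ?_
  filter_upwards [hsize.eventually_gt_atTop 0] with j hj
  exact measure_mono fun ω hlt hfollows => hlt.not_ge (hfollows.abs_extinctionTime_sub_le hj)

end Convergence

end KarpSipser

theorem proposition3p1
    (d : ℕ → DegreeSequence)
    (heven : ∀ j, Even (d j).size)
    (hsize : Tendsto (fun j => (d j).size) atTop atTop)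
    (p₁ p₂ p₃ : ℝ)
    (h₁ : Tendsto (fun j => ((d j).d₁ : ℝ) / (d j).size) atTop (𝓝 p₁))
    (h₂ : Tendsto (fun j => (2 * (d j).d₂ : ℝ) / (d j).size) atTop (𝓝 p₂))
    (h₃ : Tendsto (fun j => (3 * (d j).d₃ : ℝ) / (d j).size) atTop (𝓝 p₃))
    (hp : 0 < p₁ ∨ 0 < p₃)
    (Ω : ℕ → Type*) [∀ j, MeasurableSpace (Ω j)]
    (P : ∀ j, Measure (Ω j)) [∀ j, IsProbabilityMeasure (P j)]
    (ξ : ∀ j, ℕ → Ω j → State (d j))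
    (hξ : ∀ j, IsExploration (P j) (d j) (ξ j)) :
    ∃ (tExt : ℝ) (γ : ℝ → ℝ × ℝ × ℝ),
      IsFluidSolution (p₁, p₂, p₃) tExt γ ∧
      (∀ (T : ℝ) (η : ℝ → ℝ × ℝ × ℝ), IsFluidSolution (p₁, p₂, p₃) T η →
        T = tExt ∧ Set.EqOn η γ (Set.Icc 0 tExt)) ∧
      (∀ ε : ℝ, 0 < ε →
        Tendsto (fun j => P j {ω | ∃ t : ℝ, 0 ≤ t ∧
            ε < dist (ξ j ⌊t * (d j).size⌋₊ ω).rescaled (γ (min t tExt))})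
          atTop (𝓝 0)) ∧
      (∀ ε : ℝ, 0 < ε →
        Tendsto (fun j => P j {ω |
            ε < |(extinctionTime (ξ j) ω : ℝ) / (d j).size - tExt|})
          atTop (𝓝 0)) := by
  have hinit : Tendsto (fun j => rescaledOf (Finset.univ : Finset (HalfEdge (d j)))) atTop
      (𝓝 (p₁, p₂, p₃)) := by
    simp only [rescaledOf_univ]
    exact h₁.prodMk_nhds (h₂.prodMk_nhds h₃)
  have hmass : mass (p₁, p₂, p₃) = 1 := mass_eq_one_of_tendsto hsize hinit
  have hmass_pos : 0 < mass (p₁, p₂, p₃) := hmass ▸ one_pos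
  obtain ⟨tExt, γ, hγ⟩ := exists_isExtendedFluidSolution
    (ge_of_tendsto' h₁ fun j => by positivity) (ge_of_tendsto' h₂ fun j => by positivity)
    (ge_of_tendsto' h₃ fun j => by positivity) hmass hp
  exact ⟨tExt, γ, hγ.isFluidSolution, fun T η hη => hγ.eq_of_isFluidSolution hη,
    fun ε hε => tendsto_measure_lt_dist hsize hξ hγ hmass_pos hinit hε,
    fun ε hε => tendsto_measure_lt_abs_extinctionTime_sub hsize hξ hγ hmass_pos hinit hε⟩
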